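/- Let $m,k_{\mathrm B}>0$, $\delta\ge 2$ and $0\le\theta\le 1$. For $\xi,\xi_*,\xi',\xi_*'\in\mathbb R^3$ and $I,I_*,I',I_*'>0$ put $g=\xi-\xi_*$, $g'=\xi'-\xi_*'$, $G=\frac{\xi+\xi_*}2$, $G'=\frac{\xi'+\xi_*'}2$, $\Delta I=I'+I_*'-I-I_*$, $|\cos\phi|=|g\cdot g'|/(|g||g'|)$, and write $h=h(\xi,I)$, $h_*=h(\xi_*,I_*)$, $h'=h(\xi',I')$, $h_*'=h(\xi_*',I_*')$ and $(h,k)=\int_{\mathbb R^3\times(0,\infty)}hk\,d\xi\,dI$. Let $\sigma_{\mathrm s}$ and $\sigma_{\mathrm r}$ be measurable functions of $(|g|,|\cos\phi|,I,I_*,I',I_*')$, positive for almost every collision, such that, writing $\sigma$ for either of them, $$(II_*)^{\delta/2-1}|g|^2\sigma(|g|,|\cos\phi|,I,I_*,I',I_*')=(I'I_*')^{\delta/2-1}|g'|^2\sigma(|g'|,|\cos\phi|,I',I_*',I,I_*),$$ $$\sigma(|g|,|\cos\phi|,I,I_*,I',I_*')=\sigma(|g|,|\cos\phi|,I,I_*,I_*',I')=\sigma(|g|,|\cos\phi|,I_*,I,I_*',I').$$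 For $\sigma_{\mathrm s}$ these relations are required for collisions conserving total energy, $\frac m4|g|^2+I+I_*=\frac m4|g'|^2+I'+I_*'$; for $\sigma_{\mathrm r}$ they are required for resonant collisions, $|g|=|g'|$ and $\Delta I=0$. Let $W_\theta=\theta W_{\mathrm s}+(1-\theta)W_{\mathrm r}$ with $$W_{\mathrm s}=(II_*)^{\delta/2-1}\sigma_{\mathrm s}\frac{|g|}{|g'|^2}\,\boldsymbol\delta_3(G-G')\,\boldsymbol\delta_1\Big(\sqrt{|g|^2-\tfrac4m\Delta I}-|g'|\Big),\qquad W_{\mathrm r}=(II_*)^{\delta/2-1}\sigma_{\mathrm r}|g|^{-1}\boldsymbol\delta_3(G-G')\,\boldsymbol\delta_1(|g|-|g'|)\,\boldsymbol\delta_1(\Delta I),$$ where $\boldsymbol\delta_3$, $\boldsymbol\delta_1$ are Dirac delta functions and $W_{\mathrm s}=0$ where $|g|^2\le\frac4m\Delta I$; let $dA_\theta=W_\theta\,d\xi\,d\xi_*\,d\xi'\,d\xi_*'\,dI\,dI_*\,dI'\,dI_*'$, and let $$Q_\theta(f,F)=\frac12\int_{(\mathbb R^3\times(0,\infty))^3}\Big(\frac{f'F_*'+f_*'F'}{(I'I_*')^{\delta/2-1}}-\frac{fF_*+f_*F}{(II_*)^{\delta/2-1}}\Big)W_\theta\,d\xi_*\,d\xi'\,d\xi_*'\,dI_*\,dI'\,dI_*'.$$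 Let $f$ be an integrable function on $\mathbb R^3\times(0,\infty)$, positive almost everywhere, such that $Q_\theta(f,f)$ and $\mathcal W_\theta[f]=\big(Q_\theta(f,f),\log(I^{1-\delta/2}f)\big)$ are defined, i.e. the integral $Q_\theta(f,f)$ converges absolutely for almost every $(\xi,I)$, and the integral of $\big(\frac{2f'f_*'}{(I'I_*')^{\delta/2-1}}-\frac{2ff_*}{(II_*)^{\delta/2-1}}\big)\log(I^{1-\delta/2}f)$ against $dA_\theta$ converges absolutely. Then $\mathcal W_\theta[f]\le 0$, and the following are equivalent: (i) $\mathcal W_\theta[f]=0$; (ii) $Q_\theta(f,f)=0$ almost everywhere; (iii) almost everywhere, $f$ equals, if $\theta\ne0$, a Maxwellian $$M_{\mathrm s}=\frac{n\,I^{\delta/2-1}}{(2\pi k_{\mathrm B}T/m)^{3/2}(k_{\mathrm B}T)^{\delta/2}\Gamma(\delta/2)}\exp\Big(-\frac{m|\xi-u|^2+2I}{2k_{\mathrm B}T}\Big)$$ with some $n,T>0$, $u\in\mathbb R^3$, and, if $\theta=0$, a Maxwellian $$M_{\mathrm r}=\frac{n\,I^{\delta/2-1}}{(2\pi k_{\mathrm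 B}T_{\mathrm{tr}}/m)^{3/2}(k_{\mathrm B}T_{\mathrm{int}})^{\delta/2}\Gamma(\delta/2)}\exp\Big(-\frac{m|\xi-u|^2}{2k_{\mathrm B}T_{\mathrm{tr}}}-\frac{I}{k_{\mathrm B}T_{\mathrm{int}}}\Big)$$ with some $n,T_{\mathrm{tr}},T_{\mathrm{int}}>0$, $u\in\mathbb R^3$. Moreover, for $M=M_{\mathrm r}$, and for $M=M_{\mathrm s}$ with $T_{\mathrm{tr}}=T_{\mathrm{int}}=T$, the parameters are the macroscopic quantities of $M$: mass and energy of $M$ are finite, $n=(1,M)$, $u=\frac1n(\xi,M)$, $T_{\mathrm{tr}}=\frac2{3k_{\mathrm B}n}\big(\frac m2|\xi-u|^2,M\big)$ and $T_{\mathrm{int}}=\frac2{\delta k_{\mathrm B}n}(I,M)$. -/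

import Mathlib

open MeasureTheory Set

namespace Polyatomic

noncomputable section

/-- Molecular velocities: Euclidean three-space. -/
abbrev Vel : Type := EuclideanSpace ℝ (Fin 3)

/-- A pair `x = (ξ, I)`: molecular velocity and energy of the internal modes.  The condition
`0 < I` is carried by the measure `phaseMeasure`. -/
abbrev Phase : Type := Vel × ℝ

/-- Unit vectors `ω ∈ 𝕊²`. -/
abbrev Dir : Type := Metric.sphere (0 : Vel) 1

/-- The measure `dξ dI` on `ℝ³ × (0, ∞)`. -/
def phaseMeasure : Measure Phase :=
  (volume : Measure Vel).prod ((volume : Measure ℝ).restrict (Ioi 0))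

/-- The surface measure `dω` on the unit sphere (of total mass `4π`). -/
def dirMeasure : Measure Dir := (volume : Measure Vel).toSphere

/-- The inner product `(f, g) = ∫ f g dξ dI`. -/
def pairing (f g : Phase → ℝ) : ℝ := ∫ x, f x * g x ∂phaseMeasure

/-! ### Scattering cross sections -/

/-- A cross section `σ (|g|, |cos φ|, I, I⁎, I', I⁎')`. -/
abbrev CrossSection : Type := ℝ → ℝ → ℝ → ℝ → ℝ → ℝ → ℝ

/-- `|cos φ|`, where `φ` is the angle between `g = ξ - ξ⁎` and `g' = ξ' - ξ⁎'`. -/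
def absCos (x y x' y' : Phase) : ℝ :=
  |inner ℝ (x.1 - y.1) (x'.1 - y'.1)| / (‖x.1 - y.1‖ * ‖x'.1 - y'.1‖)

/-- The value of the cross section at the collision `(x, y) → (x', y')`. -/
def CrossSection.at (σ : CrossSection) (x y x' y' : Phase) : ℝ :=
  σ ‖x.1 - y.1‖ (absCos x y x' y') x.2 y.2 x'.2 y'.2

/-! ### Post-collisional pairs

By conservation of momentum the velocities after a collision are `G ± (s / 2) ω`, where
`G = (ξ + ξ⁎) / 2`, `s = |g'|` and `ω = g' / |g'|`.
-/

/-- The pair `((ξ', I'), (ξ⁎', I⁎'))` with centre-of-mass velocity that of `x, y`, relative speed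
`s`, direction `ω` of the relative velocity, and internal energies `a = I'`, `b = I⁎'`. -/
def postPair (x y : Phase) (s : ℝ) (ω : Dir) (a b : ℝ) : Phase × Phase :=
  (((1 / 2 : ℝ) • (x.1 + y.1) + (s / 2) • (ω : Vel), a),
   ((1 / 2 : ℝ) • (x.1 + y.1) - (s / 2) • (ω : Vel), b))

/-- `|g'|² = |g|² - (4 / m) ΔI`, with `ΔI = I' + I⁎' - I - I⁎`: the squared relative speed that
conservation of total energy prescribes after the collision.  The collision is possible when
this is positive. -/
def postSpeedSq (m : ℝ) (x y : Phase) (a b : ℝ) : ℝ :=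
  ‖x.1 - y.1‖ ^ 2 - 4 / m * (a + b - x.2 - y.2)

/-- Parameters `(I', I⁎', ω)` of standard (inelastic) collisions. -/
abbrev ParamS : Type := ℝ × ℝ × Dir

/-- The measure `dI' dI⁎' dω`. -/
def paramSMeasure : Measure ParamS :=
  ((volume : Measure ℝ).restrict (Ioi 0)).prod
    (((volume : Measure ℝ).restrict (Ioi 0)).prod dirMeasure)

/-- Outcome of a standard collision: momentum and total energy are conserved. -/
def postS (m : ℝ) (x y : Phase) (p : ParamS) : Phase × Phase :=
  postPair x y (Real.sqrt (postSpeedSq m x y p.1 p.2.1)) p.2.2 p.1 p.2.1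

/-- Parameters `(I', ω)` of resonant collisions. -/
abbrev ParamR : Type := ℝ × Dir

/-- The measure `dI' dω`. -/
def paramRMeasure : Measure ParamR :=
  ((volume : Measure ℝ).restrict (Ioi 0)).prod dirMeasure

/-- Outcome of a resonant collision: `|g'| = |g|` and `I' + I⁎' = I + I⁎`. -/
def postR (x y : Phase) (p : ParamR) : Phase × Phase :=
  postPair x y ‖x.1 - y.1‖ p.2 p.1 (x.2 + y.2 - p.1)

/-- The assumptions on the standard cross section: positive for almost every possible collision,
microreversibility, and the symmetry relations.  Here `|g'|` in the microreversibility relation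
is the relative speed `v` determined by conservation of energy. -/
structure IsCrossSectionS (m δ : ℝ) (σ : CrossSection) : Prop where
  measurable : Measurable fun p : ℝ × ℝ × ℝ × ℝ × ℝ × ℝ =>
    σ p.1 p.2.1 p.2.2.1 p.2.2.2.1 p.2.2.2.2.1 p.2.2.2.2.2
  pos : ∀ᵐ q ∂phaseMeasure.prod (phaseMeasure.prod paramSMeasure),
    0 < postSpeedSq m q.1 q.2.1 q.2.2.1 q.2.2.2.1 →
      0 < σ.at q.1 q.2.1 (postS m q.1 q.2.1 q.2.2).1 (postS m q.1 q.2.1 q.2.2).2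
  microreversible : ∀ g v c I J a b : ℝ, 0 < g → 0 < v → 0 ≤ c → c ≤ 1 →
    0 < I → 0 < J → 0 < a → 0 < b → m / 4 * g ^ 2 + I + J = m / 4 * v ^ 2 + a + b →
      (I * J) ^ (δ / 2 - 1) * g ^ 2 * σ g c I J a b =
        (a * b) ^ (δ / 2 - 1) * v ^ 2 * σ v c a b I J
  symm_post : ∀ g v c I J a b : ℝ, 0 < g → 0 < v → 0 ≤ c → c ≤ 1 →
    0 < I → 0 < J → 0 < a → 0 < b → m / 4 * g ^ 2 + I + J = m / 4 * v ^ 2 + a + b →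
      σ g c I J a b = σ g c I J b a
  symm_swap : ∀ g v c I J a b : ℝ, 0 < g → 0 < v → 0 ≤ c → c ≤ 1 →
    0 < I → 0 < J → 0 < a → 0 < b → m / 4 * g ^ 2 + I + J = m / 4 * v ^ 2 + a + b →
      σ g c I J a b = σ g c J I b a

/-- The assumptions on the resonant cross section.  It enters only multiplied by the Dirac mass
at `ΔI = 0`, so everything is required for resonant collisions: `|g'| = |g|` and
`I' + I⁎' = I + I⁎`. -/
structure IsCrossSectionR (δ : ℝ) (σ : CrossSection) : Prop where
  measurable : Measurable fun p : ℝ × ℝ × ℝ × ℝ × ℝ × ℝ =>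
    σ p.1 p.2.1 p.2.2.1 p.2.2.2.1 p.2.2.2.2.1 p.2.2.2.2.2
  pos : ∀ᵐ q ∂phaseMeasure.prod (phaseMeasure.prod paramRMeasure),
    q.2.2.1 < q.1.2 + q.2.1.2 →
      0 < σ.at q.1 q.2.1 (postR q.1 q.2.1 q.2.2).1 (postR q.1 q.2.1 q.2.2).2
  microreversible : ∀ g c I J a b : ℝ, 0 < g → 0 ≤ c → c ≤ 1 →
    0 < I → 0 < J → 0 < a → 0 < b → I + J = a + b →
      (I * J) ^ (δ / 2 - 1) * g ^ 2 * σ g c I J a b =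
        (a * b) ^ (δ / 2 - 1) * g ^ 2 * σ g c a b I J
  symm_post : ∀ g c I J a b : ℝ, 0 < g → 0 ≤ c → c ≤ 1 →
    0 < I → 0 < J → 0 < a → 0 < b → I + J = a + b → σ g c I J a b = σ g c I J b a
  symm_swap : ∀ g c I J a b : ℝ, 0 < g → 0 ≤ c → c ≤ 1 →
    0 < I → 0 < J → 0 < a → 0 < b → I + J = a + b → σ g c I J a b = σ g c J I b a

/-! ### Transition measures

The transition probabilities are
`W_s = (I I⁎)^(δ/2-1) σ_s (|g| / |g'|²) δ₃(G - G') δ₁(√(|g|² - (4/m) ΔI) - |g'|)` and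
`W_r = (I I⁎)^(δ/2-1) σ_r |g|⁻¹ δ₃(G - G') δ₁(|g| - |g'|) δ₁(ΔI)`.
As `dξ' dξ⁎' = dG' |g'|² d|g'| dω`, integrating the Dirac masses out in `G'`, `|g'|` (and `I⁎'`
in the resonant case) gives
`W_s dξ⁎ dξ' dξ⁎' dI⁎ dI' dI⁎' = (I I⁎)^(δ/2-1) σ_s |g| dξ⁎ dI⁎ dI' dI⁎' dω`,
over `|g|² - (4/m) ΔI > 0`, and
`W_r dξ⁎ dξ' dξ⁎' dI⁎ dI' dI⁎' = (I I⁎)^(δ/2-1) σ_r |g| dξ⁎ dI⁎ dI' dω`, over `0 < I' < I + I⁎`.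
The substitutions `I' = r (1 - R) E`, `I⁎' = (1 - r) (1 - R) E`, respectively
`I' = r (I + I⁎)`, turn these into the Borgnakke-Larsen form.
-/

/-- Density of `W_s` in the variables `(ξ⁎, I⁎, I', I⁎', ω)`. -/
def densityS (m δ : ℝ) (σ : CrossSection) (x y : Phase) (p : ParamS) : ENNReal :=
  if 0 < postSpeedSq m x y p.1 p.2.1 then
    ENNReal.ofReal ((x.2 * y.2) ^ (δ / 2 - 1) * ‖x.1 - y.1‖ *
      σ.at x y (postS m x y p).1 (postS m x y p).2)
  else 0

/-- Density of `W_r` in the variables `(ξ⁎, I⁎, I', ω)`. -/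
def densityR (δ : ℝ) (σ : CrossSection) (x y : Phase) (p : ParamR) : ENNReal :=
  if p.1 < x.2 + y.2 then
    ENNReal.ofReal ((x.2 * y.2) ^ (δ / 2 - 1) * ‖x.1 - y.1‖ *
      σ.at x y (postR x y p).1 (postR x y p).2)
  else 0

/-- `W_s dξ⁎ dξ' dξ⁎' dI⁎ dI' dI⁎'` for fixed `x = (ξ, I)`, as a measure in `(x⁎, x', x⁎')`. -/
def transitionS (m δ : ℝ) (σ : CrossSection) (x : Phase) : Measure (Phase × Phase × Phase) :=
  ((phaseMeasure.prod paramSMeasure).withDensity fun q => densityS m δ σ x q.1 q.2).map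
    fun q => (q.1, postS m x q.1 q.2)

/-- `W_r dξ⁎ dξ' dξ⁎' dI⁎ dI' dI⁎'` for fixed `x = (ξ, I)`, as a measure in `(x⁎, x', x⁎')`. -/
def transitionR (δ : ℝ) (σ : CrossSection) (x : Phase) : Measure (Phase × Phase × Phase) :=
  ((phaseMeasure.prod paramRMeasure).withDensity fun q => densityR δ σ x q.1 q.2).map
    fun q => (q.1, postR x q.1 q.2)

/-- `W_θ dξ⁎ dξ' dξ⁎' dI⁎ dI' dI⁎'`, where `W_θ = θ W_s + (1 - θ) W_r`. -/
def transition (m δ θ : ℝ) (σs σr : CrossSection) (x : Phase) :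
    Measure (Phase × Phase × Phase) :=
  ENNReal.ofReal θ • transitionS m δ σs x + ENNReal.ofReal (1 - θ) • transitionR δ σr x

/-- `dA_θ` for `θ = 1`, as a measure in `(x, x⁎, x', x⁎')`. -/
def collisionMeasureS (m δ : ℝ) (σ : CrossSection) :
    Measure (Phase × Phase × Phase × Phase) :=
  ((phaseMeasure.prod (phaseMeasure.prod paramSMeasure)).withDensity
    fun q => densityS m δ σ q.1 q.2.1 q.2.2).map
    fun q => (q.1, q.2.1, postS m q.1 q.2.1 q.2.2)

/-- `dA_θ` for `θ = 0`, as a measure in `(x, x⁎, x', x⁎')`. -/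
def collisionMeasureR (δ : ℝ) (σ : CrossSection) :
    Measure (Phase × Phase × Phase × Phase) :=
  ((phaseMeasure.prod (phaseMeasure.prod paramRMeasure)).withDensity
    fun q => densityR δ σ q.1 q.2.1 q.2.2).map
    fun q => (q.1, q.2.1, postR q.1 q.2.1 q.2.2)

/-- `dA_θ = W_θ dξ dξ⁎ dξ' dξ⁎' dI dI⁎ dI' dI⁎'`. -/
def collisionMeasure (m δ θ : ℝ) (σs σr : CrossSection) :
    Measure (Phase × Phase × Phase × Phase) :=
  ENNReal.ofReal θ • collisionMeasureS m δ σs + ENNReal.ofReal (1 - θ) • collisionMeasureR δ σr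

/-! ### The collision operator and the entropy production -/

/-- `(f' F⁎' + f⁎' F') / (I' I⁎')^(δ/2-1) - (f F⁎ + f⁎ F) / (I I⁎)^(δ/2-1)`
at the collision `z = (x, x⁎, x', x⁎')`. -/
def gainLoss (δ : ℝ) (f F : Phase → ℝ) (z : Phase × Phase × Phase × Phase) : ℝ :=
  (f z.2.2.1 * F z.2.2.2 + f z.2.2.2 * F z.2.2.1) / (z.2.2.1.2 * z.2.2.2.2) ^ (δ / 2 - 1) -
    (f z.1 * F z.2.1 + f z.2.1 * F z.1) / (z.1.2 * z.2.1.2) ^ (δ / 2 - 1)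

/-- The bilinear collision operator `Q_θ (f, F)`. -/
def collisionOp (m δ θ : ℝ) (σs σr : CrossSection) (f F : Phase → ℝ) (x : Phase) : ℝ :=
  1 / 2 * ∫ z, gainLoss δ f F (x, z) ∂transition m δ θ σs σr x

/-- The function `log (I^(1-δ/2) f)`. -/
def logWeighted (δ : ℝ) (f : Phase → ℝ) (x : Phase) : ℝ :=
  Real.log (x.2 ^ (1 - δ / 2) * f x)

/-- The entropy production `𝒲_θ[f] = (Q_θ (f, f), log (I^(1-δ/2) f))`. -/
def entropyProduction (m δ θ : ℝ) (σs σr : CrossSection) (f : Phase → ℝ) : ℝ :=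
  pairing (collisionOp m δ θ σs σr f f) (logWeighted δ f)

/-- `Q_θ (f, f)` and `𝒲_θ[f]` are defined: the integral defining `Q_θ (f, f)` converges at almost
every `(ξ, I)`, and the integral of the weak form of `Q_θ (f, f)` against `log (I^(1-δ/2) f)`
converges. -/
structure IsWellDefined (m δ θ : ℝ) (σs σr : CrossSection) (f : Phase → ℝ) : Prop where
  op : ∀ᵐ x ∂phaseMeasure,
    Integrable (fun z => gainLoss δ f f (x, z)) (transition m δ θ σs σr x)
  weak : Integrable (fun z => gainLoss δ f f z * logWeighted δ f z.1)
    (collisionMeasure m δ θ σs σr)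

/-! ### Maxwellians and macroscopic quantities -/

/-- The one-temperature Maxwellian `M_s`. -/
def maxwellianS (m kB δ n : ℝ) (u : Vel) (T : ℝ) (x : Phase) : ℝ :=
  n * x.2 ^ (δ / 2 - 1) /
      ((2 * Real.pi * kB * T / m) ^ (3 / 2 : ℝ) * (kB * T) ^ (δ / 2) * Real.Gamma (δ / 2)) *
    Real.exp (-((m * ‖x.1 - u‖ ^ 2 + 2 * x.2) / (2 * kB * T)))

/-- The two-temperature Maxwellian `M_r`. -/
def maxwellianR (m kB δ n : ℝ) (u : Vel) (Ttr Tint : ℝ) (x : Phase) : ℝ :=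
  n * x.2 ^ (δ / 2 - 1) /
      ((2 * Real.pi * kB * Ttr / m) ^ (3 / 2 : ℝ) * (kB * Tint) ^ (δ / 2) *
        Real.Gamma (δ / 2)) *
    Real.exp (-(m * ‖x.1 - u‖ ^ 2 / (2 * kB * Ttr)) - x.2 / (kB * Tint))

/-- `f` has finite mass and energy, number density `n`, flow velocity `u`, translational
temperature `Ttr` and internal temperature `Tint`. -/
structure HasMoments (m kB δ : ℝ) (f : Phase → ℝ) (n : ℝ) (u : Vel) (Ttr Tint : ℝ) :
    Prop where
  integrable : Integrable f phaseMeasure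
  integrable_kinetic : Integrable (fun x => ‖x.1‖ ^ 2 * f x) phaseMeasure
  integrable_internal : Integrable (fun x => x.2 * f x) phaseMeasure
  density : n = pairing (fun _ => 1) f
  velocity : ∀ i, u i = 1 / n * pairing (fun x => x.1 i) f
  temp_tr : Ttr = 2 / (3 * kB * n) * pairing (fun x => m / 2 * ‖x.1 - u‖ ^ 2) f
  temp_int : Tint = 2 / (δ * kB * n) * pairing (fun x => x.2) f

/-- `f` is (almost everywhere) a one-temperature Maxwellian. -/
def IsMaxwellianS (m kB δ : ℝ) (f : Phase → ℝ) : Prop :=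
  ∃ (n : ℝ) (u : Vel) (T : ℝ), 0 < n ∧ 0 < T ∧ f =ᵐ[phaseMeasure] maxwellianS m kB δ n u T

/-- `f` is (almost everywhere) a two-temperature Maxwellian. -/
def IsMaxwellianR (m kB δ : ℝ) (f : Phase → ℝ) : Prop :=
  ∃ (n : ℝ) (u : Vel) (Ttr Tint : ℝ), 0 < n ∧ 0 < Ttr ∧ 0 < Tint ∧
    f =ᵐ[phaseMeasure] maxwellianR m kB δ n u Ttr Tint

end

end Polyatomic

open Polyatomic

namespace Polyatomic

noncomputable section

/-! ### Measures on the set of collisions given by a density and a parametrization -/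

/-! Entropy inequality. By Fubini, the entropy production is half the integral of `gainLoss` times
`logWeighted` against dA_θ (`entropyProduction_eq`). This measure is invariant under reversal of
collisions, by microreversibility and the substitution r dr = v dv in the relative speed, and under
exchange of the two molecules. Averaging over these four symmetries turns the integrand into a
negative multiple of (a - b)(log a - log b), where a and b are the values of `pairDensity` after and
before the collision (`entropy_inequality`). This gives the sign, and equality means a = b at almost
every collision, that is, detailed balance. Detailed balance makes Q_θ(f, f) vanish, and the
vanishing of Q_θ(f, f) makes the entropy production vanish. What remains is to find all f in
detailed balance.

Rigidity. The outcome of a collision depends on the incoming pair only through the conserved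
quantities. Incoming pairs related by a rotation of the relative velocity and a transfer of internal
energy have the same outcomes, so `pairDensity` takes the same value on them (`isRigid_of_ae`).
Standard and resonant collisions both lead to this conclusion, and one analysis serves both.

Solution. As f is only measurable, the relation holds almost everywhere and cannot be evaluated at
chosen points. It is transported to L(k, I), the Laplace transform in ξ of I^(1-δ/2) f exp(-|ξ|²),
integrated over internal energies above I. The symmetries act orthogonally on velocities, so L obeys
the same multiplicative relation, now at every point with positive energies (`laplace_mul_laplace`).
Solving the functional equation gives log L = a + b·k + c|k|² + d I
(`exists_invariant_of_conserved`). Strict monotonicity in I gives d < 0, strict convexity in k gives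
c > 0, uniqueness of the Laplace transform recovers f, and integrability of f makes the velocity
factor a genuine Gaussian (`exists_gaussian`). Thus f has two temperatures. For θ ≠ 0, comparison
with conservation of total energy at collisions that change the internal energy makes them equal
(`temperatures_eq_of_ae_gainLoss_eq_zeroS`). Conversely, a Maxwellian balances because its exponent
is conserved. Its moments factor into Gaussian and Gamma integrals. -/

/-- The measure on quadruples `(x, x⁎, x', x⁎')` with density `w` in the variables `(x, x⁎, p)`,
where `(x', x⁎') = post x x⁎ p`. -/
def fluxMeasure {N : Type} [MeasurableSpace N] (π : Measure N) (w : Phase → Phase → N → ENNReal)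
    (post : Phase → Phase → N → Phase × Phase) : Measure (Phase × Phase × Phase × Phase) :=
  ((phaseMeasure.prod (phaseMeasure.prod π)).withDensity fun q => w q.1 q.2.1 q.2.2).map
    fun q => (q.1, q.2.1, post q.1 q.2.1 q.2.2)

/-- The conditional version of `fluxMeasure` for fixed `x`. -/
def fluxTransition {N : Type} [MeasurableSpace N] (π : Measure N)
    (w : Phase → Phase → N → ENNReal) (post : Phase → Phase → N → Phase × Phase) (x : Phase) :
    Measure (Phase × Phase × Phase) :=
  ((phaseMeasure.prod π).withDensity fun q => w x q.1 q.2).map fun q => (q.1, post x q.1 q.2)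

/-- Regularity of the density and of the parametrization of the collisions. -/
structure IsFlux {N : Type} [MeasurableSpace N] (w : Phase → Phase → N → ENNReal)
    (post : Phase → Phase → N → Phase × Phase) : Prop where
  measurable_density : Measurable fun q : Phase × Phase × N => w q.1 q.2.1 q.2.2
  measurable_post : Measurable fun q : Phase × Phase × N => post q.1 q.2.1 q.2.2
  density_lt_top : ∀ x y p, w x y p < ⊤

instance : SFinite phaseMeasure := by unfold phaseMeasure; infer_instance

section Flux

variable {N : Type} [MeasurableSpace N] {π : Measure N}
  {w : Phase → Phase → N → ENNReal} {post : Phase → Phase → N → Phase × Phase}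

lemma IsFlux.measurable_quad (h : IsFlux w post) :
    Measurable fun q : Phase × Phase × N => (q.1, q.2.1, post q.1 q.2.1 q.2.2) :=
  measurable_fst.prodMk ((measurable_fst.comp measurable_snd).prodMk h.measurable_post)

lemma IsFlux.measurable_triple (h : IsFlux w post) (x : Phase) :
    Measurable fun q : Phase × N => (q.1, post x q.1 q.2) :=
  measurable_fst.prodMk (h.measurable_post.comp measurable_prodMk_left)

lemma IsFlux.measurable_density_right (h : IsFlux w post) (x : Phase) :
    Measurable fun q : Phase × N => w x q.1 q.2 :=
  h.measurable_density.comp (measurable_prodMk_left (x := x))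

lemma IsFlux.lintegral (h : IsFlux w post) {Φ : Phase × Phase × Phase × Phase → ENNReal}
    (hΦ : Measurable Φ) :
    ∫⁻ z, Φ z ∂fluxMeasure π w post = ∫⁻ q, w q.1 q.2.1 q.2.2 *
      Φ (q.1, q.2.1, post q.1 q.2.1 q.2.2) ∂phaseMeasure.prod (phaseMeasure.prod π) := by
  rw [fluxMeasure, lintegral_map hΦ h.measurable_quad]
  exact lintegral_withDensity_eq_lintegral_mul _ h.measurable_density (hΦ.comp h.measurable_quad)

lemma IsFlux.ae_iff (h : IsFlux w post) {P : Phase × Phase × Phase × Phase → Prop}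
    (hP : MeasurableSet {z | P z}) :
    (∀ᵐ z ∂fluxMeasure π w post, P z) ↔ ∀ᵐ q ∂phaseMeasure.prod (phaseMeasure.prod π),
      w q.1 q.2.1 q.2.2 ≠ 0 → P (q.1, q.2.1, post q.1 q.2.1 q.2.2) := by
  rw [fluxMeasure, ae_map_iff h.measurable_quad.aemeasurable hP,
    ae_withDensity_iff h.measurable_density]

lemma IsFlux.ae_transition (h : IsFlux w post) [SFinite π]
    {P : Phase × Phase × Phase × Phase → Prop} (hP : MeasurableSet {z | P z})
    (hae : ∀ᵐ z ∂fluxMeasure π w post, P z) :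
    ∀ᵐ x ∂phaseMeasure, ∀ᵐ z ∂fluxTransition π w post x, P (x, z) := by
  rw [h.ae_iff hP] at hae
  filter_upwards [Measure.ae_ae_of_ae_prod hae] with x hx
  have hPx : MeasurableSet {z | P (x, z)} := measurable_prodMk_left hP
  rw [fluxTransition, ae_map_iff (h.measurable_triple x).aemeasurable hPx,
    ae_withDensity_iff (h.measurable_density_right x)]
  exact hx

/-- Before being pushed forward, the flux is absolutely continuous with respect to a product
measure. Properties of almost every molecule thereby hold at the first molecule of almost every
collision. -/
lemma IsFlux.quasiMeasurePreserving_fst (h : IsFlux w post) [SFinite π] :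
    Measure.QuasiMeasurePreserving Prod.fst (fluxMeasure π w post) phaseMeasure := by
  refine ⟨measurable_fst, ?_⟩
  rw [fluxMeasure, Measure.map_map measurable_fst h.measurable_quad]
  exact (Measure.quasiMeasurePreserving_fst.mono (withDensity_absolutelyContinuous _ _)
    Measure.AbsolutelyContinuous.rfl).absolutelyContinuous

lemma IsFlux.integrable_iff (h : IsFlux w post) {G : Phase × Phase × Phase × Phase → ℝ}
    (hG : Measurable G) :
    Integrable G (fluxMeasure π w post) ↔
      Integrable (fun q : Phase × Phase × N => (w q.1 q.2.1 q.2.2).toReal *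
        G (q.1, q.2.1, post q.1 q.2.1 q.2.2)) (phaseMeasure.prod (phaseMeasure.prod π)) := by
  rw [fluxMeasure, integrable_map_measure hG.aestronglyMeasurable h.measurable_quad.aemeasurable,
    integrable_withDensity_iff_integrable_smul' h.measurable_density
      (Filter.Eventually.of_forall fun q => h.density_lt_top _ _ _)]
  rfl

lemma IsFlux.integral (h : IsFlux w post) {G : Phase × Phase × Phase × Phase → ℝ}
    (hG : Measurable G) :
    ∫ z, G z ∂fluxMeasure π w post = ∫ q, (w q.1 q.2.1 q.2.2).toReal *
        G (q.1, q.2.1, post q.1 q.2.1 q.2.2) ∂phaseMeasure.prod (phaseMeasure.prod π) := by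
  rw [fluxMeasure, integral_map h.measurable_quad.aemeasurable hG.aestronglyMeasurable,
    integral_withDensity_eq_integral_toReal_smul h.measurable_density
      (Filter.Eventually.of_forall fun q => h.density_lt_top _ _ _)]
  rfl

lemma IsFlux.integral_transition (h : IsFlux w post) {G : Phase × Phase × Phase × Phase → ℝ}
    (hG : Measurable G) (x : Phase) :
    ∫ z, G (x, z) ∂fluxTransition π w post x = ∫ q, (w x q.1 q.2).toReal *
        G (x, q.1, post x q.1 q.2) ∂phaseMeasure.prod π := by
  have hGx : Measurable fun z => G (x, z) := hG.comp measurable_prodMk_left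
  rw [fluxTransition, integral_map (h.measurable_triple x).aemeasurable hGx.aestronglyMeasurable,
    integral_withDensity_eq_integral_toReal_smul (h.measurable_density_right x)
      (Filter.Eventually.of_forall fun q => h.density_lt_top _ _ _)]
  rfl

/-- This is Fubini. The factor `c` is kept inside because integrability against `c • fluxMeasure π w
post` says nothing about the flux itself when `c = 0`; both sides then vanish. -/
lemma IsFlux.integrable_integral_transition (h : IsFlux w post) [SFinite π]
    {G : Phase × Phase × Phase × Phase → ℝ} (hG : Measurable G) {c : ENNReal} (hc : c ≠ ⊤)
    (hint : Integrable G (c • fluxMeasure π w post)) :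
    Integrable (fun x => ∫ z, G (x, z) ∂(c • fluxTransition π w post x)) phaseMeasure ∧
      ∫ x, ∫ z, G (x, z) ∂(c • fluxTransition π w post x) ∂phaseMeasure =
        ∫ z, G z ∂(c • fluxMeasure π w post) := by
  rcases eq_or_ne c 0 with rfl | hc0
  · simp
  · rw [integrable_smul_measure hc0 hc, h.integrable_iff hG] at hint
    simp only [integral_smul_measure, h.integral hG, h.integral_transition hG]
    refine ⟨hint.integral_prod_left.smul c.toReal, ?_⟩
    rw [integral_smul, integral_prod _ hint]

end Flux

/-! ### Standard and resonant collisions as fluxes -/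

lemma collisionMeasureS_eq (m δ : ℝ) (σ : CrossSection) :
    collisionMeasureS m δ σ = fluxMeasure paramSMeasure (densityS m δ σ) (postS m) := rfl

lemma collisionMeasureR_eq (δ : ℝ) (σ : CrossSection) :
    collisionMeasureR δ σ = fluxMeasure paramRMeasure (densityR δ σ) postR := rfl

lemma transitionS_eq (m δ : ℝ) (σ : CrossSection) :
    transitionS m δ σ = fluxTransition paramSMeasure (densityS m δ σ) (postS m) := rfl

lemma transitionR_eq (δ : ℝ) (σ : CrossSection) :
    transitionR δ σ = fluxTransition paramRMeasure (densityR δ σ) postR := rfl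

instance : IsFiniteMeasure dirMeasure := by unfold dirMeasure; infer_instance

instance : SFinite paramSMeasure := by unfold paramSMeasure; infer_instance

instance : SFinite paramRMeasure := by unfold paramRMeasure; infer_instance

lemma measurable_gainLoss {δ : ℝ} {f : Phase → ℝ} (hf : Measurable f) :
    Measurable (gainLoss δ f f) := by
  unfold gainLoss; fun_prop

lemma measurable_logWeighted {δ : ℝ} {f : Phase → ℝ} (hf : Measurable f) :
    Measurable (logWeighted δ f) := by
  unfold logWeighted; fun_prop

lemma measurable_postPair {α : Type} [MeasurableSpace α] {x y : α → Phase} {s a b : α → ℝ}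
    {ω : α → Dir} (hx : Measurable x) (hy : Measurable y) (hs : Measurable s) (hω : Measurable ω)
    (ha : Measurable a) (hb : Measurable b) :
    Measurable fun t => postPair (x t) (y t) (s t) (ω t) (a t) (b t) := by
  unfold postPair
  have : Measurable fun t => (ω t : Vel) := measurable_subtype_coe.comp hω
  fun_prop

lemma measurable_crossSection_at {α : Type} [MeasurableSpace α] {σ : CrossSection}
    (hσ : Measurable fun p : ℝ × ℝ × ℝ × ℝ × ℝ × ℝ =>
      σ p.1 p.2.1 p.2.2.1 p.2.2.2.1 p.2.2.2.2.1 p.2.2.2.2.2)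
    {x y x' y' : α → Phase} (hx : Measurable x) (hy : Measurable y) (hx' : Measurable x')
    (hy' : Measurable y') : Measurable fun t => σ.at (x t) (y t) (x' t) (y' t) := by
  have h1 : Measurable fun t => absCos (x t) (y t) (x' t) (y' t) := by
    unfold absCos; fun_prop
  have h2 : Measurable fun t => ‖(x t).1 - (y t).1‖ := by fun_prop
  exact hσ.comp (h2.prodMk (h1.prodMk (hx.snd.prodMk (hy.snd.prodMk (hx'.snd.prodMk hy'.snd)))))

lemma measurable_postSpeedSq {m : ℝ} :
    Measurable fun q : Phase × Phase × ParamS => postSpeedSq m q.1 q.2.1 q.2.2.1 q.2.2.2.1 := by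
  unfold postSpeedSq; fun_prop

lemma isFluxS {m δ : ℝ} {σ : CrossSection} (hσ : IsCrossSectionS m δ σ) :
    IsFlux (densityS m δ σ) (postS m) := by
  have hpost : Measurable fun q : Phase × Phase × ParamS => postS m q.1 q.2.1 q.2.2 := by
    refine measurable_postPair ?_ ?_ measurable_postSpeedSq.sqrt ?_ ?_ ?_ <;> fun_prop
  refine ⟨?_, hpost, fun x y p => ?_⟩
  · unfold densityS
    refine Measurable.ite (measurableSet_lt measurable_const measurable_postSpeedSq) ?_
      measurable_const
    have := measurable_crossSection_at hσ.measurable (x := fun q : Phase × Phase × ParamS => q.1)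
      (y := fun q => q.2.1) measurable_fst (by fun_prop) hpost.fst hpost.snd
    fun_prop
  · unfold densityS; split_ifs <;> simp

lemma isFluxR {δ : ℝ} {σ : CrossSection} (hσ : IsCrossSectionR δ σ) :
    IsFlux (densityR δ σ) postR := by
  have hpost : Measurable fun q : Phase × Phase × ParamR => postR q.1 q.2.1 q.2.2 := by
    refine measurable_postPair ?_ ?_ ?_ ?_ ?_ ?_ <;> fun_prop
  refine ⟨?_, hpost, fun x y p => ?_⟩
  · unfold densityR
    refine Measurable.ite (measurableSet_lt (by fun_prop) (by fun_prop)) ?_ measurable_const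
    have := measurable_crossSection_at hσ.measurable (x := fun q : Phase × Phase × ParamR => q.1)
      (y := fun q => q.2.1) measurable_fst (by fun_prop) hpost.fst hpost.snd
    fun_prop
  · unfold densityR; split_ifs <;> simp

/-- The entropy production is an integral over the set of collisions. -/
lemma entropyProduction_eq {m δ θ : ℝ} {σs σr : CrossSection} (hσs : IsCrossSectionS m δ σs)
    (hσr : IsCrossSectionR δ σr) {f : Phase → ℝ} (hf : Measurable f)
    (hw : IsWellDefined m δ θ σs σr f) :
    entropyProduction m δ θ σs σr f =
      1 / 2 * ∫ z, gainLoss δ f f z * logWeighted δ f z.1 ∂collisionMeasure m δ θ σs σr := by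
  have hG : Measurable fun z : Phase × Phase × Phase × Phase =>
      gainLoss δ f f z * logWeighted δ f z.1 :=
    (measurable_gainLoss hf).mul ((measurable_logWeighted hf).comp measurable_fst)
  have hi := hw.weak
  unfold collisionMeasure at hi ⊢
  have his := hi.left_of_add_measure
  have hir := hi.right_of_add_measure
  rw [collisionMeasureS_eq] at his
  rw [collisionMeasureR_eq] at hir
  obtain ⟨hs1, hs2⟩ := (isFluxS hσs).integrable_integral_transition hG ENNReal.ofReal_ne_top his
  obtain ⟨hr1, hr2⟩ := (isFluxR hσr).integrable_integral_transition hG ENNReal.ofReal_ne_top hir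
  rw [integral_add_measure hi.left_of_add_measure hi.right_of_add_measure, collisionMeasureS_eq,
    collisionMeasureR_eq, ← hs2, ← hr2, ← integral_add hs1 hr1, ← integral_const_mul]
  refine integral_congr_ae ?_
  -- Splitting the inner integral over the sum of the two transition measures needs integrability
  -- against each, which is available at almost every `x` only.
  filter_upwards [hw.op] with x hx
  simp only [integral_mul_const, ← add_mul]
  unfold collisionOp transition at *
  rw [integral_add_measure hx.left_of_add_measure hx.right_of_add_measure, transitionS_eq,
    transitionR_eq]
  ring

/-! ### The entropy inequality for a microreversible collision measure -/

/-- Exchange of the states before and after the collision. -/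
def revert (z : Phase × Phase × Phase × Phase) : Phase × Phase × Phase × Phase :=
  (z.2.2.1, z.2.2.2, z.1, z.2.1)

/-- Exchange of the two molecules. -/
def relabel (z : Phase × Phase × Phase × Phase) : Phase × Phase × Phase × Phase :=
  (z.2.1, z.1, z.2.2.2, z.2.2.1)

lemma measurable_revert : Measurable revert := by unfold revert; fun_prop

lemma measurable_relabel : Measurable relabel := by unfold relabel; fun_prop

lemma gainLoss_revert (δ : ℝ) (f : Phase → ℝ) (z : Phase × Phase × Phase × Phase) :
    gainLoss δ f f (revert z) = -gainLoss δ f f z := by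
  simp [gainLoss, revert]

lemma gainLoss_relabel (δ : ℝ) (f : Phase → ℝ) (z : Phase × Phase × Phase × Phase) :
    gainLoss δ f f (relabel z) = gainLoss δ f f z := by
  simp only [gainLoss, relabel]
  rw [mul_comm z.2.2.2.2, mul_comm z.2.1.2]
  ring

/-- `f f⁎ / (I I⁎)^(δ/2-1)`. -/
def pairDensity (δ : ℝ) (f : Phase → ℝ) (x y : Phase) : ℝ :=
  f x * f y / (x.2 * y.2) ^ (δ / 2 - 1)

lemma gainLoss_eq (δ : ℝ) (f : Phase → ℝ) (z : Phase × Phase × Phase × Phase) :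
    gainLoss δ f f z = 2 * (pairDensity δ f z.2.2.1 z.2.2.2 - pairDensity δ f z.1 z.2.1) := by
  simp only [gainLoss, pairDensity]
  ring

lemma gainLoss_eq_zero_iff (δ : ℝ) (f : Phase → ℝ) (z : Phase × Phase × Phase × Phase) :
    gainLoss δ f f z = 0 ↔ pairDensity δ f z.2.2.1 z.2.2.2 = pairDensity δ f z.1 z.2.1 := by
  rw [gainLoss_eq]
  constructor <;> intro h <;> linarith

lemma pairDensity_pos {δ : ℝ} {f : Phase → ℝ} {x y : Phase} (hx : 0 < f x ∧ 0 < x.2)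
    (hy : 0 < f y ∧ 0 < y.2) : 0 < pairDensity δ f x y :=
  div_pos (mul_pos hx.1 hy.1) (Real.rpow_pos_of_pos (mul_pos hx.2 hy.2) _)

/-- The power of the internal energies in `pairDensity` factors over the two molecules, so its
logarithm is a sum of one-molecule terms. This is what makes `logWeighted` the right test function.
-/
lemma log_pairDensity {δ : ℝ} {f : Phase → ℝ} {x y : Phase} (hx : 0 < f x ∧ 0 < x.2)
    (hy : 0 < f y ∧ 0 < y.2) :
    Real.log (pairDensity δ f x y) = logWeighted δ f x + logWeighted δ f y := by
  have key : ∀ {x : Phase}, 0 < f x ∧ 0 < x.2 →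
      logWeighted δ f x = (1 - δ / 2) * Real.log x.2 + Real.log (f x) := by
    rintro x ⟨h1, h2⟩
    rw [logWeighted, Real.log_mul (Real.rpow_pos_of_pos h2 _).ne' h1.ne', Real.log_rpow h2]
  rw [pairDensity, Real.log_div (mul_pos hx.1 hy.1).ne'
    (Real.rpow_pos_of_pos (mul_pos hx.2 hy.2) _).ne', Real.log_mul hx.1.ne' hy.1.ne',
    Real.log_rpow (mul_pos hx.2 hy.2), Real.log_mul hx.2.ne' hy.2.ne', key hx, key hy]
  ring

lemma sub_mul_log_sub_nonneg {a b : ℝ} (ha : 0 < a) (hb : 0 < b) :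
    0 ≤ (a - b) * (Real.log a - Real.log b) := by
  rcases le_total a b with h | h
  · exact mul_nonneg_of_nonpos_of_nonpos (by linarith) (by linarith [Real.log_le_log ha h])
  · exact mul_nonneg (by linarith) (by linarith [Real.log_le_log hb h])

lemma eq_of_sub_mul_log_sub_eq_zero {a b : ℝ} (ha : 0 < a) (hb : 0 < b)
    (h : (a - b) * (Real.log a - Real.log b) = 0) : a = b := by
  rcases mul_eq_zero.1 h with h | h
  · linarith
  · exact Real.log_injOn_pos ha hb (by linarith)

section Entropy

variable {δ : ℝ} {f : Phase → ℝ} {A : Measure (Phase × Phase × Phase × Phase)}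

/-- Only the first molecule is known to have an absolutely continuous law. The two symmetries
permute the four molecules transitively, which carries null sets to the other three places. -/
lemma ae_collision (hrev : MeasurePreserving revert A A) (hrel : MeasurePreserving relabel A A)
    (hfst : Measure.QuasiMeasurePreserving Prod.fst A phaseMeasure)
    {P : Phase → Prop} (hP : ∀ᵐ x ∂phaseMeasure, P x) :
    ∀ᵐ z ∂A, P z.1 ∧ P z.2.1 ∧ P z.2.2.1 ∧ P z.2.2.2 := by
  have h1 := hfst.ae hP
  have h2 := hrel.quasiMeasurePreserving.ae h1
  have h3 := hrev.quasiMeasurePreserving.ae h1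
  have h4 := hrev.quasiMeasurePreserving.ae h2
  filter_upwards [h1, h2, h3, h4] with z a b c d
  exact ⟨a, b, c, d⟩

lemma ae_phase_pos (hpos : ∀ᵐ x ∂phaseMeasure, 0 < f x) :
    ∀ᵐ x ∂phaseMeasure, 0 < f x ∧ 0 < x.2 := by
  have : ∀ᵐ x ∂phaseMeasure, 0 < x.2 :=
    Measure.quasiMeasurePreserving_snd.ae (ae_restrict_mem measurableSet_Ioi)
  exact hpos.and this

/-- The four symmetrized copies of the integrand have equal integrals, while their sum has a sign at
almost every collision. A nonnegative integrand with zero integral vanishes almost everywhere, which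
settles the case of equality. -/
lemma entropy_inequality (hf : Measurable f) (hpos : ∀ᵐ x ∂phaseMeasure, 0 < f x)
    (hrev : MeasurePreserving revert A A) (hrel : MeasurePreserving relabel A A)
    (hfst : Measure.QuasiMeasurePreserving Prod.fst A phaseMeasure)
    (hint : Integrable (fun z => gainLoss δ f f z * logWeighted δ f z.1) A) :
    ∫ z, gainLoss δ f f z * logWeighted δ f z.1 ∂A ≤ 0 ∧
      (∫ z, gainLoss δ f f z * logWeighted δ f z.1 ∂A = 0 ↔ ∀ᵐ z ∂A, gainLoss δ f f z = 0) := by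
  set Φ : Phase × Phase × Phase × Phase → ℝ := fun z => gainLoss δ f f z * logWeighted δ f z.1
    with hΦ
  have hΦm : Measurable Φ :=
    (measurable_gainLoss hf).mul ((measurable_logWeighted hf).comp measurable_fst)
  have comp : ∀ {T : Phase × Phase × Phase × Phase → Phase × Phase × Phase × Phase},
      MeasurePreserving T A A → Integrable (fun z => Φ (T z)) A ∧ ∫ z, Φ (T z) ∂A = ∫ z, Φ z ∂A :=
    fun {T} hT => ⟨(hT.integrable_comp hΦm.aestronglyMeasurable).2 hint, by
      conv_rhs => rw [← hT.map_eq]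
      rw [integral_map hT.measurable.aemeasurable hΦm.aestronglyMeasurable]⟩
  obtain ⟨i2, e2⟩ := comp hrel
  obtain ⟨i3, e3⟩ := comp hrev
  obtain ⟨i4, e4⟩ := comp (hrel.comp hrev)
  simp only [Function.comp_apply] at i4 e4
  -- `relabel` preserves `gainLoss` and `revert` changes its sign. Hence the logarithms combine into
  -- log a - log b, with a and b the pair densities after and before the collision, and `D` equals 2
  -- (a - b)(log a - log b).
  set D : Phase × Phase × Phase × Phase → ℝ := fun z =>
    -(Φ z + Φ (relabel z) + Φ (revert z) + Φ (relabel (revert z))) with hD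
  have j2 : Integrable (fun z => Φ z + Φ (relabel z)) A := hint.add i2
  have j3 : Integrable (fun z => Φ z + Φ (relabel z) + Φ (revert z)) A := j2.add i3
  have hDint : Integrable D A := (j3.add i4).neg
  have hDeq : ∫ z, D z ∂A = -4 * ∫ z, Φ z ∂A := by
    rw [hD, integral_neg, integral_add j3 i4, integral_add j2 i3, integral_add hint i2, e2, e3, e4]
    ring
  have hae := ae_collision hrev hrel hfst (ae_phase_pos hpos)
  have hDval : ∀ᵐ z ∂A, D z =
      2 * ((pairDensity δ f z.2.2.1 z.2.2.2 - pairDensity δ f z.1 z.2.1) *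
        (Real.log (pairDensity δ f z.2.2.1 z.2.2.2) - Real.log (pairDensity δ f z.1 z.2.1))) := by
    filter_upwards [hae] with z ⟨h1, h2, h3, h4⟩
    simp only [hD, hΦ, gainLoss_relabel, gainLoss_revert]
    rw [log_pairDensity h1 h2, log_pairDensity h3 h4, gainLoss_eq]
    simp only [relabel, revert]
    ring
  have hDnn : 0 ≤ᵐ[A] D := by
    filter_upwards [hDval, hae] with z hz ⟨h1, h2, h3, h4⟩
    rw [hz]
    exact mul_nonneg zero_le_two
      (sub_mul_log_sub_nonneg (pairDensity_pos h3 h4) (pairDensity_pos h1 h2))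
  refine ⟨by linarith [integral_nonneg_of_ae hDnn], fun h0 => ?_, fun h0 => ?_⟩
  · have : ∫ z, D z ∂A = 0 := by rw [hDeq, h0]; simp
    rw [integral_eq_zero_iff_of_nonneg_ae hDnn hDint] at this
    filter_upwards [this, hDval, hae] with z hz hz' ⟨h1, h2, h3, h4⟩
    rw [gainLoss_eq_zero_iff]
    refine eq_of_sub_mul_log_sub_eq_zero (pairDensity_pos h3 h4) (pairDensity_pos h1 h2) ?_
    rw [hz] at hz'
    simp only [Pi.zero_apply] at hz'
    linarith
  · rw [← integral_zero (Phase × Phase × Phase × Phase) ℝ]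
    refine integral_congr_ae ?_
    filter_upwards [h0] with z hz
    simp [hz]

end Entropy

/-! ### Centre-of-mass coordinates -/

section Permutations

variable {A B C D : Type} [MeasurableSpace A] [MeasurableSpace B] [MeasurableSpace C]
  [MeasurableSpace D]

lemma measurePreserving_prodAssoc_symm (α : Measure A) (β : Measure B) (γ : Measure C)
    [SFinite α] [SFinite β] [SFinite γ] :
    MeasurePreserving (fun t : A × B × C => ((t.1, t.2.1), t.2.2))
      (α.prod (β.prod γ)) ((α.prod β).prod γ) :=
  (measurePreserving_prodAssoc α β γ).symm MeasurableEquiv.prodAssoc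

lemma measurePreserving_prodProdProdComm (α : Measure A) (β : Measure B) (γ : Measure C)
    (κ : Measure D) [SFinite α] [SFinite β] [SFinite γ] [SFinite κ] :
    MeasurePreserving (fun t : (A × B) × C × D => ((t.1.1, t.2.1), (t.1.2, t.2.2)))
      ((α.prod β).prod (γ.prod κ)) ((α.prod γ).prod (β.prod κ)) := by
  have h1 := measurePreserving_prodAssoc α β (γ.prod κ)
  have h2 := (MeasurePreserving.id α).prod (measurePreserving_prodAssoc_symm β γ κ)
  have h3 := (MeasurePreserving.id α).prod
    ((Measure.measurePreserving_swap (μ := β) (ν := γ)).prod (MeasurePreserving.id κ))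
  have h4 := (MeasurePreserving.id α).prod (measurePreserving_prodAssoc γ β κ)
  have h5 := measurePreserving_prodAssoc_symm α γ (β.prod κ)
  exact h5.comp (h4.comp (h3.comp (h2.comp h1)))

end Permutations

/-- The measure `dξ` on the space of velocities. -/
def velMeasure : Measure Vel := volume

instance : SigmaFinite velMeasure := by unfold velMeasure; infer_instance

instance : velMeasure.IsAddHaarMeasure := by unfold velMeasure; infer_instance

instance : SFinite velMeasure := inferInstance

instance : SFinite dirMeasure := inferInstance

/-- The measure `r² dr` on `(0, ∞)`. -/
def radialMeasure : Measure ℝ :=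
  ((volume : Measure ℝ).restrict (Ioi 0)).withDensity fun r => ENNReal.ofReal (r ^ 2)

instance : SFinite radialMeasure := by unfold radialMeasure; infer_instance

/-- The measure `dI` on `(0, ∞)`. -/
abbrev energyMeasure : Measure ℝ := (volume : Measure ℝ).restrict (Ioi 0)

lemma lintegral_radialMeasure (F : ℝ → ENNReal) :
    ∫⁻ r, F r ∂radialMeasure = ∫⁻ r in Ioi 0, ENNReal.ofReal (r ^ 2) * F r := by
  rw [radialMeasure, lintegral_withDensity_eq_lintegral_mul_non_measurable _ (by fun_prop)
    (Filter.Eventually.of_forall fun _ => ENNReal.ofReal_lt_top)]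
  rfl

lemma map_volumeIoiPow_two : (Measure.volumeIoiPow 2).map Subtype.val = radialMeasure := by
  refine Measure.ext_of_lintegral _ fun F hF => ?_
  rw [lintegral_map hF measurable_subtype_coe, lintegral_radialMeasure, Measure.volumeIoiPow,
    lintegral_withDensity_eq_lintegral_mul _ (by fun_prop) (by fun_prop)]
  exact lintegral_subtype_comap measurableSet_Ioi
    (f := fun r => ENNReal.ofReal (r ^ 2) * F r)

/-- Polar coordinates are a homeomorphism onto the complement of the origin, and the origin is a
null set. -/
lemma measurePreserving_polar :
    MeasurePreserving (fun q : Dir × ℝ => q.2 • (q.1 : Vel)) (dirMeasure.prod radialMeasure)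
      velMeasure := by
  have hm : Measurable fun q : Dir × ℝ => q.2 • (q.1 : Vel) :=
    measurable_snd.smul (measurable_subtype_coe.comp measurable_fst)
  refine ⟨hm, ?_⟩
  have hfin : Module.finrank ℝ Vel - 1 = 2 := by simp
  have h1 := (volume : Measure Vel).measurePreserving_homeomorphUnitSphereProd
  rw [hfin] at h1
  have h2 := MeasurePreserving.symm (homeomorphUnitSphereProd Vel).toMeasurableEquiv h1
  have h3 : MeasurePreserving (Prod.map id Subtype.val : Dir × Ioi (0 : ℝ) → Dir × ℝ)
      (dirMeasure.prod (Measure.volumeIoiPow 2)) (dirMeasure.prod radialMeasure) :=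
    (MeasurePreserving.id dirMeasure).prod ⟨measurable_subtype_coe, map_volumeIoiPow_two⟩
  rw [← h3.map_eq, Measure.map_map hm h3.measurable]
  have h4 : (fun q : Dir × ℝ => q.2 • (q.1 : Vel)) ∘ (Prod.map id Subtype.val) =
      Subtype.val ∘ (homeomorphUnitSphereProd Vel).toMeasurableEquiv.symm := by
    ext1 q
    rfl
  rw [h4, ← Measure.map_map measurable_subtype_coe (MeasurableEquiv.measurable _)]
  have h5 := h2.map_eq
  unfold dirMeasure velMeasure
  rw [h5, map_comap_subtype_coe (measurableSet_singleton _).compl,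
    restrict_compl_singleton]

/-- The map (G, g) ↦ (G + g/2, G - g/2) is a swap followed by two shears, (g, G) ↦ (g, G - g/2) and
(x, y) ↦ (x + y, y), so its Jacobian is 1. -/
lemma measurePreserving_centre :
    MeasurePreserving (fun q : Vel × Vel => (q.1 + (1 / 2 : ℝ) • q.2, q.1 - (1 / 2 : ℝ) • q.2))
      (velMeasure.prod velMeasure) (velMeasure.prod velMeasure) := by
  have h1 : MeasurePreserving (fun q : Vel × Vel => (q.1, q.2 - (1 / 2 : ℝ) • q.1))
      (velMeasure.prod velMeasure) (velMeasure.prod velMeasure) :=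
    (MeasurePreserving.id velMeasure).skew_product (g := fun g G => G - (1 / 2 : ℝ) • g)
      (by fun_prop) (Filter.Eventually.of_forall fun g => map_sub_right_eq_self velMeasure _)
  have h2 := measurePreserving_add_prod velMeasure velMeasure
  have h3 := h2.comp (h1.comp (Measure.measurePreserving_swap (μ := velMeasure)
    (ν := velMeasure)))
  convert h3 using 1
  ext1 q
  simp only [Function.comp_apply, Prod.swap, Prod.mk.injEq, and_true]
  module

/-- The pair of molecules with centre-of-mass velocity `G`, relative velocity `r ω` and internal
energies `I`, `J`. -/
def pairAt (G : Vel) (r : ℝ) (ω : Dir) (I J : ℝ) : Phase × Phase :=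
  ((G + (r / 2) • (ω : Vel), I), (G - (r / 2) • (ω : Vel), J))

lemma postPair_pairAt (G : Vel) (r s : ℝ) (ω₀ ω : Dir) (I J a b : ℝ) :
    postPair (pairAt G r ω₀ I J).1 (pairAt G r ω₀ I J).2 s ω a b = pairAt G s ω a b := by
  have : (1 / 2 : ℝ) • ((G + (r / 2) • (ω₀ : Vel)) + (G - (r / 2) • (ω₀ : Vel))) = G := by module
  simp only [postPair, pairAt, this]

lemma pairAt_sub (G : Vel) (r : ℝ) (ω : Dir) (I J : ℝ) :
    (pairAt G r ω I J).1.1 - (pairAt G r ω I J).2.1 = r • (ω : Vel) := by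
  simp only [pairAt]; module

lemma norm_pairAt_sub (G : Vel) {r : ℝ} (hr : 0 < r) (ω : Dir) (I J : ℝ) :
    ‖(pairAt G r ω I J).1.1 - (pairAt G r ω I J).2.1‖ = r := by
  rw [pairAt_sub, norm_smul, Real.norm_of_nonneg hr.le, norm_eq_of_mem_sphere ω, mul_one]

/-- In these coordinates the angular variable is symmetric in the two directions, and so it survives
the exchange of the states before and after the collision. -/
lemma at_pairAt (σ : CrossSection) (G : Vel) {r v : ℝ} (hr : 0 < r) (hv : 0 < v) (ω₀ ω : Dir)
    (I J a b : ℝ) :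
    σ.at (pairAt G r ω₀ I J).1 (pairAt G r ω₀ I J).2 (pairAt G v ω a b).1 (pairAt G v ω a b).2 =
      σ r |inner ℝ (ω₀ : Vel) (ω : Vel)| I J a b := by
  have : absCos (pairAt G r ω₀ I J).1 (pairAt G r ω₀ I J).2 (pairAt G v ω a b).1
      (pairAt G v ω a b).2 = |inner ℝ (ω₀ : Vel) (ω : Vel)| := by
    rw [absCos, norm_pairAt_sub G hr, norm_pairAt_sub G hv, pairAt_sub, pairAt_sub,
      real_inner_smul_left, real_inner_smul_right, abs_mul, abs_mul, abs_of_pos hr, abs_of_pos hv]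
    field_simp
  rw [CrossSection.at, this, norm_pairAt_sub G hr]
  rfl

lemma abs_inner_dir_le_one (ω₀ ω : Dir) : |inner ℝ (ω₀ : Vel) (ω : Vel)| ≤ 1 := by
  have := abs_real_inner_le_norm (ω₀ : Vel) (ω : Vel)
  rwa [norm_eq_of_mem_sphere ω₀, norm_eq_of_mem_sphere ω, mul_one] at this

lemma measurePreserving_pairAt {N : Type} [MeasurableSpace N] (π : Measure N) [SFinite π] :
    MeasurePreserving (fun t : ((Vel × Dir × ℝ) × ℝ × ℝ) × N =>
        ((pairAt t.1.1.1 t.1.1.2.2 t.1.1.2.1 t.1.2.1 t.1.2.2).1,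
          (pairAt t.1.1.1 t.1.1.2.2 t.1.1.2.1 t.1.2.1 t.1.2.2).2, t.2))
      (((velMeasure.prod (dirMeasure.prod radialMeasure)).prod
        (energyMeasure.prod energyMeasure)).prod π)
      (phaseMeasure.prod (phaseMeasure.prod π)) := by
  have h1 := (MeasurePreserving.id velMeasure).prod measurePreserving_polar
  have h2 := ((measurePreserving_centre.comp h1).prod
    (MeasurePreserving.id (energyMeasure.prod energyMeasure)))
  have h3 := (measurePreserving_prodProdProdComm velMeasure velMeasure
    energyMeasure energyMeasure).comp h2
  have h4 := (measurePreserving_prodAssoc phaseMeasure phaseMeasure π).comp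
    (h3.prod (MeasurePreserving.id π))
  convert h4 using 1
  ext1 t
  obtain ⟨⟨⟨G, ω, r⟩, I, J⟩, n⟩ := t
  simp only [pairAt, Function.comp_apply, Prod.map, id, MeasurableEquiv.prodAssoc,
    MeasurableEquiv.coe_mk, Equiv.prodAssoc_apply, smul_smul]
  rw [div_eq_inv_mul, one_div]

/-- The relative speed is moved to the last place so that it is integrated first, all energies and
directions being fixed. Reversal changes the speed by a substitution whose constant depends on these
energies. -/
lemma measurePreserving_regroup {N : Type} [MeasurableSpace N] (π : Measure N) [SFinite π] :
    MeasurePreserving (fun t : (Vel × ((ℝ × ℝ) × Dir) × N) × ℝ =>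
        (((t.1.1, (t.1.2.1.2, t.2)), t.1.2.1.1), t.1.2.2))
      ((velMeasure.prod (((energyMeasure.prod energyMeasure).prod dirMeasure).prod π)).prod
        radialMeasure)
      (((velMeasure.prod (dirMeasure.prod radialMeasure)).prod
        (energyMeasure.prod energyMeasure)).prod π) := by
  set α : Measure Vel := velMeasure
  set ε := energyMeasure.prod energyMeasure
  set β := dirMeasure
  set ρ := radialMeasure
  have i1 := measurePreserving_prodAssoc (ε.prod β) π ρ
  have i2 := (MeasurePreserving.id (ε.prod β)).prod
    (Measure.measurePreserving_swap (μ := π) (ν := ρ))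
  have i3 := measurePreserving_prodAssoc_symm (ε.prod β) ρ π
  have i4 := (measurePreserving_prodAssoc ε β ρ).prod (MeasurePreserving.id π)
  have i5 := (Measure.measurePreserving_swap (μ := ε) (ν := β.prod ρ)).prod
    (MeasurePreserving.id π)
  have j := (MeasurePreserving.id α).prod (i5.comp (i4.comp (i3.comp (i2.comp i1))))
  have k1 := measurePreserving_prodAssoc α ((ε.prod β).prod π) ρ
  have k2 := measurePreserving_prodAssoc_symm α ((β.prod ρ).prod ε) π
  have k3 := (measurePreserving_prodAssoc_symm α (β.prod ρ) ε).prod (MeasurePreserving.id π)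
  exact k3.comp (k2.comp (j.comp k1))

/-- Integration over the pre-collisional pair in centre-of-mass coordinates. -/
lemma lintegral_centre {N : Type} [MeasurableSpace N] (π : Measure N) [SFinite π]
    {F : Phase × Phase × N → ENNReal} (hF : Measurable F) :
    ∫⁻ q, F q ∂phaseMeasure.prod (phaseMeasure.prod π) =
      ∫⁻ z, ∫⁻ r, F ((pairAt z.1 r z.2.1.2 z.2.1.1.1 z.2.1.1.2).1,
          (pairAt z.1 r z.2.1.2 z.2.1.1.1 z.2.1.1.2).2, z.2.2) ∂radialMeasure
        ∂velMeasure.prod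
          (((energyMeasure.prod energyMeasure).prod dirMeasure).prod π) := by
  have h := (measurePreserving_pairAt π).comp (measurePreserving_regroup π)
  rw [← h.map_eq, lintegral_map hF h.measurable]
  exact lintegral_prod _ (hF.comp h.measurable).aemeasurable

/-- This is the substitution v = √(r² - c), for which v dv = r dr. In use, c is 4/m times the gain
of internal energy, and v is the speed after the collision. -/
lemma lintegral_speed_change (c : ℝ) (g : ℝ → ENNReal) :
    ∫⁻ v in {v : ℝ | 0 < v ∧ 0 < v ^ 2 + c}, ENNReal.ofReal v * g v =
      ∫⁻ r in {r : ℝ | 0 < r ∧ 0 < r ^ 2 - c}, ENNReal.ofReal r * g (√(r ^ 2 - c)) := by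
  set s : Set ℝ := {r : ℝ | 0 < r ∧ 0 < r ^ 2 - c}
  have himg : {v : ℝ | 0 < v ∧ 0 < v ^ 2 + c} = (fun r => √(r ^ 2 - c)) '' s := by
    ext v
    constructor
    · rintro ⟨h1, h2⟩
      refine ⟨√(v ^ 2 + c), ⟨Real.sqrt_pos.2 h2, ?_⟩, ?_⟩
      · rw [Real.sq_sqrt h2.le]; nlinarith
      · simp only [Real.sq_sqrt h2.le, add_sub_cancel_right, Real.sqrt_sq h1.le]
    · rintro ⟨r, ⟨h1, h2⟩, rfl⟩
      refine ⟨Real.sqrt_pos.2 h2, ?_⟩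
      simp only [Real.sq_sqrt h2.le]
      nlinarith
  have hs : MeasurableSet s :=
    (measurableSet_lt measurable_const measurable_id).inter
      (measurableSet_lt measurable_const ((measurable_id.pow_const 2).sub_const c))
  have hd : ∀ r ∈ s, HasDerivWithinAt (fun r => √(r ^ 2 - c)) (r / √(r ^ 2 - c)) s r := by
    rintro r ⟨h1, h2⟩
    have h := (((hasDerivAt_id r).pow 2).sub_const c).sqrt (by simpa using h2.ne')
    refine (h.congr_deriv ?_).hasDerivWithinAt
    simp
    field_simp
  have hinj : InjOn (fun r => √(r ^ 2 - c)) s := by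
    rintro r ⟨h1, h2⟩ r' ⟨h1', h2'⟩ h
    have := (Real.sqrt_inj h2.le h2'.le).1 h
    exact (pow_left_inj₀ h1.le h1'.le two_ne_zero).1 (by linarith)
  rw [himg, lintegral_image_eq_lintegral_abs_deriv_mul hs hd hinj]
  refine setLIntegral_congr_fun hs ?_
  rintro r ⟨h1, h2⟩
  have hv := Real.sqrt_pos.2 h2
  simp only
  rw [← mul_assoc, ← ENNReal.ofReal_mul (abs_nonneg _), abs_of_pos (div_pos h1 hv),
    div_mul_cancel₀ _ hv.ne']

/-! ### Microreversibility of the collision measures -/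

lemma measurePreserving_of_lintegral_comp {X : Type} [MeasurableSpace X] {A : Measure X} {T : X → X}
    (hT : Measurable T) (h : ∀ Φ : X → ENNReal, Measurable Φ →
      ∫⁻ z, (Φ ∘ T) z ∂A = ∫⁻ z, Φ z ∂A) :
    MeasurePreserving T A A :=
  ⟨hT, Measure.ext_of_lintegral _ fun Φ hΦ => by rw [lintegral_map hΦ hT, ← h Φ hΦ]; rfl⟩

lemma ae_energyMeasure_pos : ∀ᵐ I ∂energyMeasure, 0 < I := ae_restrict_mem measurableSet_Ioi

lemma postSpeedSq_pairAt (m : ℝ) (G : Vel) {r : ℝ} (hr : 0 < r) (ω : Dir) (I J a b : ℝ) :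
    postSpeedSq m (pairAt G r ω I J).1 (pairAt G r ω I J).2 a b =
      r ^ 2 - 4 / m * (a + b - I - J) := by
  rw [postSpeedSq, norm_pairAt_sub G hr]
  rfl

lemma IsFlux.measurable_integrand {N : Type} [MeasurableSpace N]
    {w : Phase → Phase → N → ENNReal} {post : Phase → Phase → N → Phase × Phase}
    (h : IsFlux w post) {Φ : Phase × Phase × Phase × Phase → ENNReal} (hΦ : Measurable Φ) :
    Measurable fun q : Phase × Phase × N =>
      w q.1 q.2.1 q.2.2 * Φ (q.1, q.2.1, post q.1 q.2.1 q.2.2) :=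
  h.measurable_density.mul (hΦ.comp h.measurable_quad)

/-- The inner integral, over the relative speed, of a flux in centre-of-mass coordinates. -/
def speedIntegral {N : Type} (w : Phase → Phase → N → ENNReal)
    (post : Phase → Phase → N → Phase × Phase) (Φ : Phase × Phase × Phase × Phase → ENNReal)
    (z : Vel × ((ℝ × ℝ) × Dir) × N) : ENNReal :=
  ∫⁻ r, w (pairAt z.1 r z.2.1.2 z.2.1.1.1 z.2.1.1.2).1
      (pairAt z.1 r z.2.1.2 z.2.1.1.1 z.2.1.1.2).2 z.2.2 *
    Φ ((pairAt z.1 r z.2.1.2 z.2.1.1.1 z.2.1.1.2).1, (pairAt z.1 r z.2.1.2 z.2.1.1.1 z.2.1.1.2).2,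
      post (pairAt z.1 r z.2.1.2 z.2.1.1.1 z.2.1.1.2).1
        (pairAt z.1 r z.2.1.2 z.2.1.1.1 z.2.1.1.2).2 z.2.2) ∂radialMeasure

/-- A flux is invariant under the reversal of collisions if its speed integrals are. -/
lemma IsFlux.measurePreserving_revert {N : Type} [MeasurableSpace N] {π : Measure N} [SFinite π]
    {w : Phase → Phase → N → ENNReal} {post : Phase → Phase → N → Phase × Phase}
    (h : IsFlux w post) {τ : Vel × ((ℝ × ℝ) × Dir) × N → Vel × ((ℝ × ℝ) × Dir) × N}
    (hτ : MeasurePreserving τ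
      (velMeasure.prod (((energyMeasure.prod energyMeasure).prod dirMeasure).prod π))
      (velMeasure.prod (((energyMeasure.prod energyMeasure).prod dirMeasure).prod π)))
    (hw : ∀ Φ : Phase × Phase × Phase × Phase → ENNReal,
      ∀ᵐ z ∂velMeasure.prod (((energyMeasure.prod energyMeasure).prod dirMeasure).prod π),
        speedIntegral w post (Φ ∘ revert) (τ z) = speedIntegral w post Φ z) :
    MeasurePreserving revert (fluxMeasure π w post) (fluxMeasure π w post) := by
  have key : ∀ Φ : Phase × Phase × Phase × Phase → ENNReal, Measurable Φ →
      Measurable (speedIntegral w post Φ) ∧ ∫⁻ z, Φ z ∂fluxMeasure π w post =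
        ∫⁻ z, speedIntegral w post Φ z
          ∂velMeasure.prod (((energyMeasure.prod energyMeasure).prod dirMeasure).prod π) :=
    fun Φ hΦ => ⟨((h.measurable_integrand hΦ).comp ((measurePreserving_pairAt π).comp
      (measurePreserving_regroup π)).measurable).lintegral_prod_right' (ν := radialMeasure), by
      rw [h.lintegral hΦ, lintegral_centre π (h.measurable_integrand hΦ)]
      rfl⟩
  refine measurePreserving_of_lintegral_comp measurable_revert fun Φ hΦ => ?_
  obtain ⟨h1, h2⟩ := key (Φ ∘ revert) (hΦ.comp measurable_revert)
  rw [h2, (key Φ hΦ).2, ← hτ.lintegral_comp h1]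
  exact lintegral_congr_ae (hw Φ)

/-- The standard flux density in centre-of-mass coordinates. -/
lemma lintegral_densityS_pairAt {m δ : ℝ} (σ : CrossSection)
    (Φ : Phase × Phase × Phase × Phase → ENNReal) (G : Vel) (ω₀ ω : Dir) (I J a b : ℝ) :
    ∫⁻ r, densityS m δ σ (pairAt G r ω₀ I J).1 (pairAt G r ω₀ I J).2 (a, b, ω) *
        Φ ((pairAt G r ω₀ I J).1, (pairAt G r ω₀ I J).2,
          postS m (pairAt G r ω₀ I J).1 (pairAt G r ω₀ I J).2 (a, b, ω)) ∂radialMeasure =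
      ∫⁻ r in {r : ℝ | 0 < r ∧ 0 < r ^ 2 - 4 / m * (a + b - I - J)}, ENNReal.ofReal r *
        (ENNReal.ofReal ((I * J) ^ (δ / 2 - 1) * r ^ 2 *
            σ r |inner ℝ (ω₀ : Vel) (ω : Vel)| I J a b) *
          Φ ((pairAt G r ω₀ I J).1, (pairAt G r ω₀ I J).2,
            pairAt G √(r ^ 2 - 4 / m * (a + b - I - J)) ω a b)) := by
  set c := 4 / m * (a + b - I - J)
  have hms : MeasurableSet {r : ℝ | 0 < r ^ 2 - c} :=
    measurableSet_lt measurable_const ((measurable_id.pow_const 2).sub_const c)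
  have hset : {r : ℝ | 0 < r ∧ 0 < r ^ 2 - c} = {r : ℝ | 0 < r ^ 2 - c} ∩ Ioi 0 := by
    ext r; exact and_comm
  rw [lintegral_radialMeasure, hset, ← Measure.restrict_restrict hms, ← lintegral_indicator hms]
  refine setLIntegral_congr_fun measurableSet_Ioi fun r hr => ?_
  have hr : 0 < r := hr
  simp only [densityS, postSpeedSq_pairAt m G hr]
  by_cases h : 0 < r ^ 2 - c
  · have hpost : postS m (pairAt G r ω₀ I J).1 (pairAt G r ω₀ I J).2 (a, b, ω) =
        pairAt G √(r ^ 2 - c) ω a b := by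
      rw [postS, postSpeedSq_pairAt m G hr, postPair_pairAt]
    -- The radial weight r² times the flux factor |g| = r is split as r · r²: the single r goes with
    -- dr in the substitution r dr = v dv, and r² belongs to the microreversibility relation.
    rw [if_pos h, indicator_of_mem (by exact h), hpost, at_pairAt σ G hr (Real.sqrt_pos.2 h),
      norm_pairAt_sub G hr, ← mul_assoc, ← mul_assoc, ← ENNReal.ofReal_mul (by positivity),
      ← ENNReal.ofReal_mul hr.le]
    congr 2
    simp only [pairAt]
    ring
  · rw [if_neg h, indicator_of_notMem (by exact h)]
    simp

lemma measurePreserving_exchangeS :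
    MeasurePreserving (fun z : Vel × ((ℝ × ℝ) × Dir) × ParamS =>
        (z.1, ((z.2.2.1, z.2.2.2.1), z.2.2.2.2), (z.2.1.1.1, z.2.1.1.2, z.2.1.2)))
      (velMeasure.prod (((energyMeasure.prod energyMeasure).prod dirMeasure).prod paramSMeasure))
      (velMeasure.prod
        (((energyMeasure.prod energyMeasure).prod dirMeasure).prod paramSMeasure)) := by
  have h1 := measurePreserving_prodAssoc energyMeasure energyMeasure dirMeasure
  have h2 := measurePreserving_prodAssoc_symm energyMeasure energyMeasure dirMeasure
  exact (MeasurePreserving.id velMeasure).prod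
    (Measure.measurePreserving_swap.comp (h1.prod h2))

/-- Once (I, J, ω₀) and (a, b, ω) are exchanged, the two speed integrals differ by the substitution
of `lintegral_speed_change`, and microreversibility identifies the remaining densities. -/
lemma measurePreserving_revertS {m δ : ℝ} (hm : 0 < m) {σ : CrossSection}
    (hσ : IsCrossSectionS m δ σ) :
    MeasurePreserving revert (collisionMeasureS m δ σ) (collisionMeasureS m δ σ) := by
  refine (isFluxS hσ).measurePreserving_revert measurePreserving_exchangeS fun Φ => ?_
  have hE1 : ∀ᵐ u ∂(energyMeasure.prod energyMeasure).prod dirMeasure, 0 < u.1.1 ∧ 0 < u.1.2 :=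
    Measure.quasiMeasurePreserving_fst.ae
      ((Measure.quasiMeasurePreserving_fst.ae ae_energyMeasure_pos).and
        (Measure.quasiMeasurePreserving_snd.ae ae_energyMeasure_pos))
  have hE2 : ∀ᵐ u ∂paramSMeasure, 0 < u.1 ∧ 0 < u.2.1 :=
    (Measure.quasiMeasurePreserving_fst.ae ae_energyMeasure_pos).and
      (Measure.quasiMeasurePreserving_snd.ae
        (Measure.quasiMeasurePreserving_fst.ae ae_energyMeasure_pos))
  filter_upwards [Measure.quasiMeasurePreserving_snd.ae
    ((Measure.quasiMeasurePreserving_fst.ae hE1).and (Measure.quasiMeasurePreserving_snd.ae hE2))]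
    with z hz
  obtain ⟨G, ⟨⟨I, J⟩, ω₀⟩, a, b, ω⟩ := z
  obtain ⟨⟨hI, hJ⟩, ha, hb⟩ := hz
  simp only at hI hJ ha hb
  refine (lintegral_densityS_pairAt σ (Φ ∘ revert) G ω ω₀ a b I J).trans
    (Eq.trans ?_ (lintegral_densityS_pairAt σ Φ G ω₀ ω I J a b).symm)
  set c := 4 / m * (a + b - I - J) with hc
  -- The backward collision releases the internal energy that the forward one absorbs, so its
  -- constant is `-c`.
  have hc' : 4 / m * (I + J - a - b) = -c := by rw [hc]; ring
  simp only [hc', sub_neg_eq_add]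
  rw [lintegral_speed_change c]
  have hms : MeasurableSet {r : ℝ | 0 < r ∧ 0 < r ^ 2 - c} :=
    (measurableSet_lt measurable_const measurable_id).inter
      (measurableSet_lt measurable_const ((measurable_id.pow_const 2).sub_const c))
  refine setLIntegral_congr_fun hms ?_
  rintro r ⟨hr, hrc⟩
  have hv := Real.sqrt_pos.2 hrc
  have hsq := Real.sq_sqrt hrc.le
  have hback : √(√(r ^ 2 - c) ^ 2 + c) = r := by
    rw [hsq, sub_add_cancel, Real.sqrt_sq hr.le]
  have hmic := hσ.microreversible r √(r ^ 2 - c) |inner ℝ (ω₀ : Vel) (ω : Vel)| I J a b hr hv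
    (abs_nonneg _) (abs_inner_dir_le_one _ _) hI hJ ha hb (by
      rw [hsq, hc]; field_simp; ring)
  simp only [hback, Function.comp_apply, revert]
  rw [real_inner_comm, hmic]

/-! ### Symmetry under exchange of the molecules -/

/-- The change of labels of the molecules, in the parameters of standard collisions. -/
lemma relabel_postPair (x y : Phase) (s : ℝ) (ω : Dir) (a b : ℝ) :
    postPair y x s (-ω) b a = ((postPair x y s ω a b).2, (postPair x y s ω a b).1) := by
  simp only [postPair, Prod.mk.injEq, and_true, add_comm y.1 x.1]
  constructor <;> (simp only [coe_neg_sphere]; module)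

lemma absCos_relabel (x y x' y' : Phase) : absCos y x y' x' = absCos x y x' y' := by
  unfold absCos
  rw [← neg_sub x.1 y.1, ← neg_sub x'.1 y'.1, inner_neg_neg, norm_neg, norm_neg]

lemma absCos_nonneg (x y x' y' : Phase) : 0 ≤ absCos x y x' y' := by
  unfold absCos; positivity

lemma absCos_le_one (x y x' y' : Phase) : absCos x y x' y' ≤ 1 :=
  div_le_one_of_le₀ (abs_real_inner_le_norm _ _) (by positivity)

/-- The surface measure of a set is a multiple of the volume of the cone over it, and the cone over
-s is the reflection of the cone over s. -/
lemma measurePreserving_neg_dir : MeasurePreserving (fun ω : Dir => -ω) dirMeasure dirMeasure := by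
  have hm : Measurable fun ω : Dir => -ω := by
    refine Measurable.subtype_mk (f := fun ω : Dir => -(ω : Vel)) ?_
    exact measurable_subtype_coe.neg
  refine ⟨hm, ?_⟩
  ext s hs
  rw [Measure.map_apply hm hs, dirMeasure, Measure.toSphere_apply' _ hs,
    Measure.toSphere_apply' _ (hm hs)]
  congr 1
  rw [← Measure.measure_neg volume]
  congr 1
  ext v
  simp only [Set.mem_neg, Set.mem_smul, mem_image, mem_preimage]
  constructor
  · rintro ⟨r, hr, _, ⟨ω, hω, rfl⟩, h⟩
    exact ⟨r, hr, -ω, ⟨-ω, hω, rfl⟩, by simp [h]⟩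
  · rintro ⟨r, hr, _, ⟨ω, hω, rfl⟩, h⟩
    exact ⟨r, hr, -ω, ⟨-ω, by simpa using hω, rfl⟩, by simp [h]⟩

/-- A flux is invariant under the change of labels if its density and parametrization are. -/
lemma IsFlux.measurePreserving_relabel {N : Type} [MeasurableSpace N] {π : Measure N} [SFinite π]
    {w : Phase → Phase → N → ENNReal} {post : Phase → Phase → N → Phase × Phase}
    (h : IsFlux w post) {T : Phase × Phase × N → Phase × Phase × N}
    (hT : MeasurePreserving T (phaseMeasure.prod (phaseMeasure.prod π))
      (phaseMeasure.prod (phaseMeasure.prod π)))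
    (hTw : ∀ᵐ q ∂phaseMeasure.prod (phaseMeasure.prod π),
      w (T q).1 (T q).2.1 (T q).2.2 = w q.1 q.2.1 q.2.2 ∧ (w q.1 q.2.1 q.2.2 ≠ 0 →
        relabel ((T q).1, (T q).2.1, post (T q).1 (T q).2.1 (T q).2.2) =
          (q.1, q.2.1, post q.1 q.2.1 q.2.2))) :
    MeasurePreserving relabel (fluxMeasure π w post) (fluxMeasure π w post) := by
  refine measurePreserving_of_lintegral_comp measurable_relabel fun Φ hΦ => ?_
  have hΨ := hΦ.comp measurable_relabel
  rw [h.lintegral hΨ, h.lintegral hΦ]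
  rw [← hT.lintegral_comp (h.measurable_integrand hΨ)]
  refine lintegral_congr_ae ?_
  filter_upwards [hTw] with q hq
  rcases eq_or_ne (w q.1 q.2.1 q.2.2) 0 with h0 | h0
  · simp only [hq.1, h0, zero_mul]
  · simp only [Function.comp_apply, hq.1, hq.2 h0]

lemma ae_collision_nondegenerate {N : Type} [MeasurableSpace N] (π : Measure N) [SFinite π] :
    ∀ᵐ q ∂phaseMeasure.prod (phaseMeasure.prod π),
      0 < q.1.2 ∧ 0 < q.2.1.2 ∧ 0 < ‖q.1.1 - q.2.1.1‖ := by
  have hE : ∀ᵐ x ∂phaseMeasure, 0 < x.2 :=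
    Measure.quasiMeasurePreserving_snd.ae (ae_restrict_mem measurableSet_Ioi)
  have h1 : ∀ᵐ q ∂phaseMeasure.prod (phaseMeasure.prod π), 0 < q.1.2 :=
    Measure.quasiMeasurePreserving_fst.ae hE
  have h2 : ∀ᵐ q ∂phaseMeasure.prod (phaseMeasure.prod π), 0 < q.2.1.2 :=
    Measure.quasiMeasurePreserving_snd.ae (Measure.quasiMeasurePreserving_fst.ae hE)
  have h3 : ∀ᵐ q ∂phaseMeasure.prod (phaseMeasure.prod π), 0 < ‖q.1.1 - q.2.1.1‖ := by
    have hms : MeasurableSet {q : Phase × Phase × N | 0 < ‖q.1.1 - q.2.1.1‖} :=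
      measurableSet_lt measurable_const (by fun_prop)
    rw [Measure.ae_prod_iff_ae_ae hms]
    refine Filter.Eventually.of_forall fun x => ?_
    have : ∀ᵐ y ∂phaseMeasure, y.1 ≠ x.1 :=
      Measure.quasiMeasurePreserving_fst.ae (Measure.ae_ne volume x.1)
    filter_upwards [Measure.quasiMeasurePreserving_fst.ae this] with y hy
    exact norm_pos_iff.2 (sub_ne_zero.2 (Ne.symm hy))
  filter_upwards [h1, h2, h3] with q a b c
  exact ⟨a, b, c⟩

lemma measurePreserving_swap_phase {N : Type} [MeasurableSpace N] {π : Measure N} [SFinite π]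
    {ρ : N → N} (hρ : MeasurePreserving ρ π π) :
    MeasurePreserving (fun q : Phase × Phase × N => (q.2.1, q.1, ρ q.2.2))
      (phaseMeasure.prod (phaseMeasure.prod π)) (phaseMeasure.prod (phaseMeasure.prod π)) := by
  have h1 := measurePreserving_prodAssoc_symm phaseMeasure phaseMeasure π
  have h2 := (Measure.measurePreserving_swap (μ := phaseMeasure) (ν := phaseMeasure)).prod hρ
  have h3 := measurePreserving_prodAssoc phaseMeasure phaseMeasure π
  exact h3.comp (h2.comp h1)

lemma postSpeedSq_relabel (m : ℝ) (x y : Phase) (a b : ℝ) :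
    postSpeedSq m y x b a = postSpeedSq m x y a b := by
  rw [postSpeedSq, postSpeedSq, norm_sub_rev]
  ring

lemma ae_paramS_pos : ∀ᵐ p ∂paramSMeasure, 0 < p.1 ∧ 0 < p.2.1 :=
  (Measure.quasiMeasurePreserving_fst.ae ae_energyMeasure_pos).and
    (Measure.quasiMeasurePreserving_snd.ae
      (Measure.quasiMeasurePreserving_fst.ae ae_energyMeasure_pos))

/-- Exchanging the incoming molecules together with (a, b, ω) ↦ (b, a, -ω) yields the same collision
with its labels exchanged. The density is unchanged by `symm_swap`. -/
lemma measurePreserving_relabelS {m δ : ℝ} (hm : 0 < m) {σ : CrossSection}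
    (hσ : IsCrossSectionS m δ σ) :
    MeasurePreserving relabel (collisionMeasureS m δ σ) (collisionMeasureS m δ σ) := by
  rw [collisionMeasureS_eq]
  have hρ : MeasurePreserving (fun p : ParamS => (p.2.1, p.1, -p.2.2)) paramSMeasure
      paramSMeasure := by
    have h1 := measurePreserving_prodAssoc_symm energyMeasure energyMeasure dirMeasure
    have h2 := (Measure.measurePreserving_swap (μ := energyMeasure) (ν := energyMeasure)).prod
      measurePreserving_neg_dir
    have h3 := measurePreserving_prodAssoc energyMeasure energyMeasure dirMeasure
    exact h3.comp (h2.comp h1)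
  refine (isFluxS hσ).measurePreserving_relabel (measurePreserving_swap_phase hρ) ?_
  have hp : ∀ᵐ q ∂phaseMeasure.prod (phaseMeasure.prod paramSMeasure),
      0 < q.2.2.1 ∧ 0 < q.2.2.2.1 :=
    Measure.quasiMeasurePreserving_snd.ae (Measure.quasiMeasurePreserving_snd.ae ae_paramS_pos)
  filter_upwards [ae_collision_nondegenerate paramSMeasure, hp] with q hq hq'
  obtain ⟨x, y, a, b, ω⟩ := q
  obtain ⟨hI, hJ, hg⟩ := hq
  obtain ⟨ha, hb⟩ := hq'
  simp only at hI hJ hg ha hb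
  have hpost : postS m y x (b, a, -ω) = ((postS m x y (a, b, ω)).2, (postS m x y (a, b, ω)).1) := by
    simp only [postS]
    rw [postSpeedSq_relabel, relabel_postPair]
  refine ⟨?_, ?_⟩
  · simp only [densityS, postSpeedSq_relabel m x y]
    split_ifs with hs
    · rw [hpost, mul_comm y.2, norm_sub_rev]
      congr 2
      have hv := Real.sqrt_pos.2 hs
      have := hσ.symm_swap ‖x.1 - y.1‖ √(postSpeedSq m x y a b)
        (absCos x y (postS m x y (a, b, ω)).1 (postS m x y (a, b, ω)).2) x.2 y.2 a b hg hv
        (absCos_nonneg _ _ _ _) (absCos_le_one _ _ _ _) hI hJ ha hb (by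
          rw [Real.sq_sqrt hs.le, postSpeedSq]; field_simp; ring)
      simp only [CrossSection.at, absCos_relabel x y, norm_sub_rev y.1]
      exact this.symm
    · rfl
  · intro _
    simp only [relabel, hpost]

/-! ### Symmetries of resonant collisions -/

/-- The exchange of the internal energies in a resonant collision, `(I, J, a) ↦ (a, I + J - a, I)`,
extended by the identity to `a ≥ I + J`. -/
def exchangeEnergies (t : (ℝ × ℝ) × ℝ) : (ℝ × ℝ) × ℝ :=
  if t.2 < t.1.1 + t.1.2 then ((t.2, t.1.1 + t.1.2 - t.2), t.1.1) else t

/-- The map is composed of transpositions and two shears: (I, J, a) goes to (I, I + J, a), then by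
permutation to (a, I + J, I), then to (a, I + J - a, I). -/
lemma measurePreserving_exchange_volume :
    MeasurePreserving (fun t : (ℝ × ℝ) × ℝ => ((t.2, t.1.1 + t.1.2 - t.2), t.1.1))
      (((volume : Measure ℝ).prod volume).prod volume)
      (((volume : Measure ℝ).prod volume).prod volume) := by
  set ν : Measure ℝ := volume
  have shear1 : MeasurePreserving (fun t : (ℝ × ℝ) × ℝ => ((t.1.1, t.1.1 + t.1.2), t.2))
      ((ν.prod ν).prod ν) ((ν.prod ν).prod ν) :=
    (measurePreserving_prod_add ν ν).prod (MeasurePreserving.id ν)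
  have shear2 : MeasurePreserving (fun t : (ℝ × ℝ) × ℝ => ((t.1.1, t.1.2 - t.1.1), t.2))
      ((ν.prod ν).prod ν) ((ν.prod ν).prod ν) :=
    (measurePreserving_prod_sub ν ν).prod (MeasurePreserving.id ν)
  have s23 : MeasurePreserving (fun t : (ℝ × ℝ) × ℝ => ((t.1.1, t.2), t.1.2))
      ((ν.prod ν).prod ν) ((ν.prod ν).prod ν) :=
    (measurePreserving_prodAssoc_symm ν ν ν).comp
      (((MeasurePreserving.id ν).prod (Measure.measurePreserving_swap (μ := ν) (ν := ν))).comp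
        (measurePreserving_prodAssoc ν ν ν))
  have s12 : MeasurePreserving (fun t : (ℝ × ℝ) × ℝ => ((t.1.2, t.1.1), t.2))
      ((ν.prod ν).prod ν) ((ν.prod ν).prod ν) :=
    (Measure.measurePreserving_swap (μ := ν) (ν := ν)).prod (MeasurePreserving.id ν)
  exact shear2.comp (s23.comp (s12.comp (s23.comp shear1)))

lemma measurePreserving_exchangeEnergies :
    MeasurePreserving exchangeEnergies ((energyMeasure.prod energyMeasure).prod energyMeasure)
      ((energyMeasure.prod energyMeasure).prod energyMeasure) := by
  have hlt : MeasurableSet {t : (ℝ × ℝ) × ℝ | t.2 < t.1.1 + t.1.2} :=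
    measurableSet_lt (by fun_prop) (by fun_prop)
  have hm : Measurable exchangeEnergies := by
    unfold exchangeEnergies
    exact Measurable.ite hlt (by fun_prop) (by fun_prop)
  refine measurePreserving_of_lintegral_comp hm fun Φ hΦ => ?_
  simp only [Measure.prod_restrict]
  set ν := ((volume : Measure ℝ).prod (volume : Measure ℝ)).prod (volume : Measure ℝ)
  set O : Set ((ℝ × ℝ) × ℝ) := (Ioi 0 ×ˢ Ioi 0) ×ˢ Ioi 0
  have hO : MeasurableSet O := (measurableSet_Ioi.prod measurableSet_Ioi).prod measurableSet_Ioi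
  set D : Set ((ℝ × ℝ) × ℝ) := {t | t.2 < t.1.1 + t.1.2}
  rw [← lintegral_inter_add_sdiff (Φ ∘ exchangeEnergies) O hlt, ← lintegral_inter_add_sdiff Φ O hlt]
  congr 1
  · have hpre : (fun t : (ℝ × ℝ) × ℝ => ((t.2, t.1.1 + t.1.2 - t.2), t.1.1)) ⁻¹' (O ∩ D) =
        O ∩ D := by
      ext ⟨⟨I, J⟩, a⟩
      simp only [O, D, mem_preimage, mem_inter_iff, mem_prod, mem_Ioi, mem_ofPred_eq]
      constructor <;> rintro ⟨⟨⟨h1, h2⟩, h3⟩, h4⟩ <;> refine ⟨⟨⟨?_, ?_⟩, ?_⟩, ?_⟩ <;> linarith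
    have h := measurePreserving_exchange_volume.restrict_preimage (hO.inter hlt)
    rw [hpre] at h
    rw [← h.lintegral_comp hΦ]
    refine setLIntegral_congr_fun (hO.inter hlt) fun t ht => ?_
    simp only [Function.comp_apply, exchangeEnergies]
    rw [if_pos (show t.2 < t.1.1 + t.1.2 from ht.2)]
  · refine setLIntegral_congr_fun (hO.diff hlt) fun t ht => ?_
    simp only [Function.comp_apply, exchangeEnergies]
    rw [if_neg (show ¬t.2 < t.1.1 + t.1.2 from ht.2)]

/-- The exchange of the states before and after a resonant collision, in centre-of-mass
coordinates. -/
def exchangeR (z : Vel × ((ℝ × ℝ) × Dir) × ParamR) : Vel × ((ℝ × ℝ) × Dir) × ParamR :=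
  (z.1, ((exchangeEnergies (z.2.1.1, z.2.2.1)).1, z.2.2.2),
    ((exchangeEnergies (z.2.1.1, z.2.2.1)).2, z.2.1.2))

lemma measurePreserving_exchangeR :
    MeasurePreserving exchangeR
      (velMeasure.prod (((energyMeasure.prod energyMeasure).prod dirMeasure).prod paramRMeasure))
      (velMeasure.prod
        (((energyMeasure.prod energyMeasure).prod dirMeasure).prod paramRMeasure)) := by
  have h1 := measurePreserving_prodProdProdComm (energyMeasure.prod energyMeasure) dirMeasure
    energyMeasure dirMeasure
  have h2 := measurePreserving_exchangeEnergies.prod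
    (Measure.measurePreserving_swap (μ := dirMeasure) (ν := dirMeasure))
  have h3 := measurePreserving_prodProdProdComm (energyMeasure.prod energyMeasure) energyMeasure
    dirMeasure dirMeasure
  exact (MeasurePreserving.id velMeasure).prod (h3.comp (h2.comp h1))

lemma densityR_pairAt {δ : ℝ} (σ : CrossSection) (G : Vel) {r : ℝ} (hr : 0 < r) (ω₀ ω : Dir)
    {I J a b : ℝ} (hab : I + J = a + b) (hb : 0 < b) :
    densityR δ σ (pairAt G r ω₀ I J).1 (pairAt G r ω₀ I J).2 (a, ω) =
        ENNReal.ofReal ((I * J) ^ (δ / 2 - 1) * r * σ r |inner ℝ (ω₀ : Vel) (ω : Vel)| I J a b) ∧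
      postR (pairAt G r ω₀ I J).1 (pairAt G r ω₀ I J).2 (a, ω) = pairAt G r ω a b := by
  have hpost : postR (pairAt G r ω₀ I J).1 (pairAt G r ω₀ I J).2 (a, ω) = pairAt G r ω a b := by
    rw [postR, norm_pairAt_sub G hr, postPair_pairAt]
    congr 1
    simp only [pairAt]
    linarith
  refine ⟨?_, hpost⟩
  rw [densityR, if_pos (by simp only [pairAt]; linarith), hpost, at_pairAt σ G hr hr,
    norm_pairAt_sub G hr]
  rfl

/-- The relative speed does not change, so no substitution is needed and the integrands agree for
each r > 0. -/
lemma measurePreserving_revertR {δ : ℝ} {σ : CrossSection} (hσ : IsCrossSectionR δ σ) :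
    MeasurePreserving revert (collisionMeasureR δ σ) (collisionMeasureR δ σ) := by
  refine (isFluxR hσ).measurePreserving_revert measurePreserving_exchangeR fun Φ => ?_
  have hE1 : ∀ᵐ u ∂(energyMeasure.prod energyMeasure).prod dirMeasure, 0 < u.1.1 ∧ 0 < u.1.2 :=
    Measure.quasiMeasurePreserving_fst.ae
      ((Measure.quasiMeasurePreserving_fst.ae ae_energyMeasure_pos).and
        (Measure.quasiMeasurePreserving_snd.ae ae_energyMeasure_pos))
  have hE2 : ∀ᵐ u ∂paramRMeasure, 0 < u.1 := Measure.quasiMeasurePreserving_fst.ae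
    ae_energyMeasure_pos
  filter_upwards [Measure.quasiMeasurePreserving_snd.ae
    ((Measure.quasiMeasurePreserving_fst.ae hE1).and (Measure.quasiMeasurePreserving_snd.ae hE2))]
    with z hz
  obtain ⟨G, ⟨⟨I, J⟩, ω₀⟩, a, ω⟩ := z
  obtain ⟨⟨hI, hJ⟩, ha⟩ := hz
  simp only at hI hJ ha
  simp only [speedIntegral, exchangeR, exchangeEnergies]
  split_ifs with hlt
  · rw [lintegral_radialMeasure, lintegral_radialMeasure]
    refine setLIntegral_congr_fun measurableSet_Ioi fun r hr => ?_
    have hr : 0 < r := hr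
    obtain ⟨b, hb⟩ : ∃ b, b = I + J - a := ⟨_, rfl⟩
    have hb0 : 0 < b := by linarith
    have hab : I + J = a + b := by linarith
    simp only [← hb, Function.comp_apply]
    obtain ⟨h1, h2⟩ := densityR_pairAt (δ := δ) σ G hr ω₀ ω hab hb0
    obtain ⟨h3, h4⟩ := densityR_pairAt (δ := δ) σ G hr ω ω₀ hab.symm hJ
    rw [h1, h2, h3, h4]
    have hmic := hσ.microreversible r |inner ℝ (ω₀ : Vel) (ω : Vel)| I J a b hr
      (abs_nonneg _) (abs_inner_dir_le_one _ _) hI hJ ha hb0 hab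
    have hmic' : (a * b) ^ (δ / 2 - 1) * r * σ r |inner ℝ (ω : Vel) (ω₀ : Vel)| a b I J =
        (I * J) ^ (δ / 2 - 1) * r * σ r |inner ℝ (ω₀ : Vel) (ω : Vel)| I J a b := by
      rw [real_inner_comm]
      -- The flux carries one factor of the speed and microreversibility carries two.
      refine mul_left_cancel₀ hr.ne' ?_
      linarith
    rw [hmic']
    rfl
  -- Here a ≥ I + J, where the exchange is the identity and no collision is possible.
  · have hzero : ∀ r ω₀ ω,
        densityR δ σ (pairAt G r ω₀ I J).1 (pairAt G r ω₀ I J).2 (a, ω) = 0 :=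
      fun r ω₀ ω => if_neg (by simpa only [pairAt] using hlt)
    simp [hzero]

/-- The reflection of `(0, c)`, extended by the identity. -/
def reflectBelow (c a : ℝ) : ℝ := if a < c then c - a else a

lemma measurable_reflectBelow : Measurable fun t : ℝ × ℝ => reflectBelow t.1 t.2 := by
  unfold reflectBelow
  exact Measurable.ite (measurableSet_lt (by fun_prop) (by fun_prop)) (by fun_prop) (by fun_prop)

lemma measurePreserving_reflectBelow (c : ℝ) :
    MeasurePreserving (reflectBelow c) energyMeasure energyMeasure := by
  refine measurePreserving_of_lintegral_comp (measurable_reflectBelow.comp measurable_prodMk_left)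
    fun Φ hΦ => ?_
  have hlt : MeasurableSet (Iio c) := measurableSet_Iio
  rw [← lintegral_inter_add_sdiff (Φ ∘ reflectBelow c) (Ioi 0) hlt,
    ← lintegral_inter_add_sdiff Φ (Ioi 0) hlt]
  congr 1
  · have hpre : (fun a : ℝ => c - a) ⁻¹' (Ioi 0 ∩ Iio c) = Ioi 0 ∩ Iio c := by
      ext a
      simp only [mem_preimage, mem_inter_iff, mem_Ioi, mem_Iio]
      constructor <;> rintro ⟨h1, h2⟩ <;> constructor <;> linarith
    have h := (Measure.measurePreserving_sub_left (volume : Measure ℝ) c).restrict_preimage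
      ((measurableSet_Ioi (a := (0 : ℝ))).inter hlt)
    rw [hpre] at h
    rw [← h.lintegral_comp hΦ]
    refine setLIntegral_congr_fun (measurableSet_Ioi.inter hlt) fun t ht => ?_
    simp only [Function.comp_apply, reflectBelow]
    rw [if_pos (show t < c from ht.2)]
  · refine setLIntegral_congr_fun (measurableSet_Ioi.diff hlt) fun t ht => ?_
    simp only [Function.comp_apply, reflectBelow]
    rw [if_neg (show ¬t < c from ht.2)]

/-- A resonant collision is parametrized by the energy of one outgoing molecule, so exchanging
labels replaces a by I + J - a. This reflection depends on the incoming pair, hence the skew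
product. -/
lemma measurePreserving_swap_phaseR :
    MeasurePreserving (fun q : Phase × Phase × ParamR =>
        (q.2.1, q.1, (reflectBelow (q.1.2 + q.2.1.2) q.2.2.1, -q.2.2.2)))
      (phaseMeasure.prod (phaseMeasure.prod paramRMeasure))
      (phaseMeasure.prod (phaseMeasure.prod paramRMeasure)) := by
  have h1 := measurePreserving_prodAssoc_symm phaseMeasure phaseMeasure paramRMeasure
  have h3 := measurePreserving_prodAssoc phaseMeasure phaseMeasure paramRMeasure
  have h2 := (Measure.measurePreserving_swap (μ := phaseMeasure)
    (ν := phaseMeasure)).skew_product (μc := paramRMeasure) (μd := paramRMeasure)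
    (g := fun u p => (reflectBelow (u.1.2 + u.2.2) p.1, -p.2))
    (by
      have hn := measurePreserving_neg_dir.measurable
      refine Measurable.prodMk ?_ (hn.comp (by fun_prop))
      exact measurable_reflectBelow.comp (f := fun t : (Phase × Phase) × ParamR =>
        (t.1.1.2 + t.1.2.2, t.2.1)) (by fun_prop))
    (Filter.Eventually.of_forall fun u =>
      ((measurePreserving_reflectBelow (u.1.2 + u.2.2)).prod measurePreserving_neg_dir).map_eq)
  exact h3.comp (h2.comp h1)

lemma measurePreserving_relabelR {δ : ℝ} {σ : CrossSection} (hσ : IsCrossSectionR δ σ) :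
    MeasurePreserving relabel (collisionMeasureR δ σ) (collisionMeasureR δ σ) := by
  refine (isFluxR hσ).measurePreserving_relabel measurePreserving_swap_phaseR ?_
  have hp : ∀ᵐ q ∂phaseMeasure.prod (phaseMeasure.prod paramRMeasure), 0 < q.2.2.1 :=
    Measure.quasiMeasurePreserving_snd.ae (Measure.quasiMeasurePreserving_snd.ae
      (Measure.quasiMeasurePreserving_fst.ae ae_energyMeasure_pos))
  filter_upwards [ae_collision_nondegenerate paramRMeasure, hp] with q hq ha
  obtain ⟨x, y, a, ω⟩ := q
  obtain ⟨hI, hJ, hg⟩ := hq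
  simp only at hI hJ hg ha
  by_cases hlt : a < x.2 + y.2
  · have hb : 0 < x.2 + y.2 - a := by linarith
    have hpost : postR y x (x.2 + y.2 - a, -ω) =
        ((postR x y (a, ω)).2, (postR x y (a, ω)).1) := by
      simp only [postR]
      rw [norm_sub_rev, ← relabel_postPair]
      congr 1
      ring
    simp only [reflectBelow, if_pos hlt]
    refine ⟨?_, fun _ => by simp only [relabel, hpost]⟩
    simp only [densityR]
    rw [if_pos (by linarith), if_pos hlt, hpost, mul_comm y.2, norm_sub_rev]
    congr 2
    have := hσ.symm_swap ‖x.1 - y.1‖ (absCos x y (postR x y (a, ω)).1 (postR x y (a, ω)).2)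
      x.2 y.2 a (x.2 + y.2 - a) hg (absCos_nonneg _ _ _ _) (absCos_le_one _ _ _ _) hI hJ ha hb
      (by ring)
    simp only [CrossSection.at, absCos_relabel x y, norm_sub_rev y.1]
    exact this.symm
  · simp only [reflectBelow, if_neg hlt, densityR]
    rw [if_neg (by linarith)]
    simp

/-! ### Rigidity: conservation of the pair density along symmetries of the collision -/

/-- The measure `dξ dI` on `ℝ³ × ℝ`. -/
def phaseVolume : Measure Phase := velMeasure.prod volume

instance : SigmaFinite phaseVolume := by unfold phaseVolume; infer_instance

instance : SFinite phaseVolume := inferInstance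

instance : phaseVolume.IsAddHaarMeasure := by unfold phaseVolume; infer_instance

lemma phaseMeasure_eq_restrict : phaseMeasure = phaseVolume.restrict {x | 0 < x.2} := by
  have : {x : Phase | 0 < x.2} = univ ×ˢ Ioi 0 := by ext; simp
  rw [this, phaseVolume, ← Measure.prod_restrict, Measure.restrict_univ]
  rfl

lemma measurableSet_phase_pos : MeasurableSet {x : Phase | 0 < x.2} :=
  measurableSet_lt measurable_const measurable_snd

lemma ae_phaseMeasure_iff {P : Phase → Prop} :
    (∀ᵐ x ∂phaseMeasure, P x) ↔ ∀ᵐ x ∂phaseVolume, 0 < x.2 → P x := by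
  rw [phaseMeasure_eq_restrict, ae_restrict_iff' measurableSet_phase_pos]
  rfl

lemma ae_phaseMeasure_prod_iff {P : Phase × Phase → Prop} :
    (∀ᵐ q ∂phaseMeasure.prod phaseMeasure, P q) ↔
      ∀ᵐ q ∂phaseVolume.prod phaseVolume, 0 < q.1.2 ∧ 0 < q.2.2 → P q := by
  rw [phaseMeasure_eq_restrict, Measure.prod_restrict,
    ae_restrict_iff' (measurableSet_phase_pos.prod measurableSet_phase_pos)]
  rfl

/-- The map of pairs which rotates the relative velocity by `O` and transfers the internal energy
`t` from the second molecule to the first. -/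
def pairMove (O : Vel ≃ₗᵢ[ℝ] Vel) (t : ℝ) (q : Phase × Phase) : Phase × Phase :=
  (((1 / 2 : ℝ) • (q.1.1 + q.2.1) + (1 / 2 : ℝ) • O (q.1.1 - q.2.1), q.1.2 + t),
    ((1 / 2 : ℝ) • (q.1.1 + q.2.1) - (1 / 2 : ℝ) • O (q.1.1 - q.2.1), q.2.2 - t))

/-- In the coordinates difference and midpoint, reached by shears, the map rotates the relative
velocity, adds `2 * t` to the energy difference and fixes the midpoint. -/
lemma measurePreserving_pairMove (O : Vel ≃ₗᵢ[ℝ] Vel) (t : ℝ) :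
    MeasurePreserving (pairMove O t) (phaseVolume.prod phaseVolume)
      (phaseVolume.prod phaseVolume) := by
  set μ := phaseVolume
  have hO : MeasurePreserving (fun g : Phase => (O g.1, g.2 + 2 * t)) μ μ :=
    MeasurePreserving.prod (μa := velMeasure) (μb := velMeasure) (μc := volume) (μd := volume)
      (f := O) (g := fun s => s + 2 * t) O.measurePreserving
      (measurePreserving_add_right volume (2 * t))
  have h1 := measurePreserving_sub_prod μ μ
  have h2 : MeasurePreserving (fun q : Phase × Phase => (q.1, q.2 + (1 / 2 : ℝ) • q.1))
      (μ.prod μ) (μ.prod μ) :=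
    (MeasurePreserving.id μ).skew_product (g := fun g c => c + (1 / 2 : ℝ) • g)
      (by fun_prop) (Filter.Eventually.of_forall fun g => map_add_right_eq_self μ _)
  have h3 := hO.prod (MeasurePreserving.id μ)
  have h4 : MeasurePreserving (fun q : Phase × Phase => (q.1, q.2 - (1 / 2 : ℝ) • q.1))
      (μ.prod μ) (μ.prod μ) :=
    (MeasurePreserving.id μ).skew_product (g := fun g c => c - (1 / 2 : ℝ) • g)
      (by fun_prop) (Filter.Eventually.of_forall fun g => map_sub_right_eq_self μ _)
  have h5 := measurePreserving_add_prod μ μ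
  have h := h5.comp (h4.comp (h3.comp (h2.comp h1)))
  convert h using 1
  ext1 ⟨x, y⟩
  refine Prod.ext (Prod.ext ?_ ?_) (Prod.ext ?_ ?_) <;>
    simp only [pairMove, Function.comp_apply, Prod.map, id, Prod.fst_add, Prod.snd_add,
      Prod.fst_sub, Prod.snd_sub, Prod.smul_fst, Prod.smul_snd, smul_eq_mul]
  · module
  · ring
  · module
  · ring

lemma pairMove_add (O : Vel ≃ₗᵢ[ℝ] Vel) (t : ℝ) (q : Phase × Phase) :
    (pairMove O t q).1.1 + (pairMove O t q).2.1 = q.1.1 + q.2.1 := by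
  simp only [pairMove]; module

lemma pairMove_sub (O : Vel ≃ₗᵢ[ℝ] Vel) (t : ℝ) (q : Phase × Phase) :
    (pairMove O t q).1.1 - (pairMove O t q).2.1 = O (q.1.1 - q.2.1) := by
  simp only [pairMove]; module

lemma norm_pairMove_sub (O : Vel ≃ₗᵢ[ℝ] Vel) (t : ℝ) (q : Phase × Phase) :
    ‖(pairMove O t q).1.1 - (pairMove O t q).2.1‖ = ‖q.1.1 - q.2.1‖ := by
  rw [pairMove_sub, O.norm_map]

/-- `B` is almost everywhere invariant under rotations of the relative velocity and under
transfer of internal energy. -/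
def IsRigid (B : Phase → Phase → ℝ) : Prop :=
  ∀ (O : Vel ≃ₗᵢ[ℝ] Vel) (t : ℝ), ∀ᵐ q ∂phaseVolume.prod phaseVolume,
    0 < q.1.2 → 0 < q.2.2 → 0 < q.1.2 + t → 0 < q.2.2 - t →
      B (pairMove O t q).1 (pairMove O t q).2 = B q.1 q.2

/-- A pair and its image under `pairMove` have the same outcome for every parameter. Since possible
parameters form a set that is not null, one can be chosen at which conservation holds for both
pairs, and the common outcome links the two values of `B`. -/
lemma isRigid_of_ae {N : Type} [MeasurableSpace N] {π : Measure N} [SFinite π]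
    {B : Phase → Phase → ℝ} {post : Phase → Phase → N → Phase × Phase}
    {poss : Phase → Phase → N → Prop}
    (h : ∀ᵐ q ∂phaseMeasure.prod (phaseMeasure.prod π), poss q.1 q.2.1 q.2.2 →
      B (post q.1 q.2.1 q.2.2).1 (post q.1 q.2.1 q.2.2).2 = B q.1 q.2.1)
    (hpost : ∀ O t q p, post (pairMove O t q).1 (pairMove O t q).2 p = post q.1 q.2 p)
    (hposs : ∀ O t q p, poss q.1 q.2 p → poss (pairMove O t q).1 (pairMove O t q).2 p)
    (hne : ∀ x y : Phase, 0 < x.2 → 0 < y.2 → ∃ᵐ p ∂π, poss x y p) :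
    IsRigid B := by
  have h' := (measurePreserving_prodAssoc phaseMeasure phaseMeasure π).quasiMeasurePreserving.ae h
  have h1 := ae_phaseMeasure_prod_iff.1 (Measure.ae_ae_of_ae_prod h')
  intro O t
  have h2 := (measurePreserving_pairMove O t).quasiMeasurePreserving.ae h1
  filter_upwards [h1, h2] with q hq1 hq2 hx hy hx' hy'
  obtain ⟨p, hp, e1, e2⟩ :=
    ((hne q.1 q.2 hx hy).and_eventually ((hq1 ⟨hx, hy⟩).and (hq2 ⟨hx', hy'⟩))).exists
  have e1 := e1 hp
  have e2 := e2 (hposs O t q p hp)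
  simp only [MeasurableEquiv.prodAssoc, MeasurableEquiv.coe_mk, Equiv.prodAssoc_apply] at e1 e2
  rw [hpost] at e2
  exact e2.symm.trans e1

lemma measurableSet_gainLoss_eq_zero {δ : ℝ} {f : Phase → ℝ} (hf : Measurable f) :
    MeasurableSet {z | gainLoss δ f f z = 0} :=
  measurable_gainLoss hf (measurableSet_singleton 0)

lemma postPair_pairMove (O : Vel ≃ₗᵢ[ℝ] Vel) (t : ℝ) (q : Phase × Phase) (s : ℝ) (ω : Dir)
    (a b : ℝ) :
    postPair (pairMove O t q).1 (pairMove O t q).2 s ω a b = postPair q.1 q.2 s ω a b := by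
  simp only [postPair, pairMove_add]

lemma postSpeedSq_pairMove (m : ℝ) (O : Vel ≃ₗᵢ[ℝ] Vel) (t : ℝ) (q : Phase × Phase) (a b : ℝ) :
    postSpeedSq m (pairMove O t q).1 (pairMove O t q).2 a b = postSpeedSq m q.1 q.2 a b := by
  simp only [postSpeedSq, norm_pairMove_sub]
  simp only [pairMove]
  ring

lemma dirMeasure_univ_ne_zero : dirMeasure univ ≠ 0 := by
  rw [Ne, Measure.measure_univ_eq_zero]
  exact Measure.toSphere_ne_zero _

lemma energyMeasure_Iio_ne_zero {c : ℝ} (hc : 0 < c) : energyMeasure (Iio c) ≠ 0 := by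
  rw [Measure.restrict_apply measurableSet_Iio, inter_comm, Ioi_inter_Iio, Real.volume_Ioo]
  simpa using hc

/-- Positivity of the cross section is used here: it makes the density nonzero at almost every
possible collision, so that null sets of the collision measure are null for the parameters. -/
lemma ae_conserved_of_gainLoss_eq_zeroS {m δ : ℝ} {σ : CrossSection}
    (hσ : IsCrossSectionS m δ σ) {f : Phase → ℝ} (hf : Measurable f)
    (h : ∀ᵐ z ∂collisionMeasureS m δ σ, gainLoss δ f f z = 0) :
    ∀ᵐ q ∂phaseMeasure.prod (phaseMeasure.prod paramSMeasure),
      0 < postSpeedSq m q.1 q.2.1 q.2.2.1 q.2.2.2.1 →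
        pairDensity δ f (postS m q.1 q.2.1 q.2.2).1 (postS m q.1 q.2.1 q.2.2).2 =
          pairDensity δ f q.1 q.2.1 := by
  rw [collisionMeasureS_eq, (isFluxS hσ).ae_iff (measurableSet_gainLoss_eq_zero hf)] at h
  filter_upwards [h, hσ.pos, ae_collision_nondegenerate paramSMeasure] with q hq hp hn hs
  refine (gainLoss_eq_zero_iff δ f _).1 (hq ?_)
  rw [densityS, if_pos hs]
  have := hp hs
  have := Real.rpow_pos_of_pos (mul_pos hn.1 hn.2.1) (δ / 2 - 1)
  have := hn.2.2
  simp only [ne_eq, ENNReal.ofReal_eq_zero, not_le]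
  positivity

lemma ae_conserved_of_gainLoss_eq_zeroR {δ : ℝ} {σ : CrossSection}
    (hσ : IsCrossSectionR δ σ) {f : Phase → ℝ} (hf : Measurable f)
    (h : ∀ᵐ z ∂collisionMeasureR δ σ, gainLoss δ f f z = 0) :
    ∀ᵐ q ∂phaseMeasure.prod (phaseMeasure.prod paramRMeasure),
      q.2.2.1 < q.1.2 + q.2.1.2 →
        pairDensity δ f (postR q.1 q.2.1 q.2.2).1 (postR q.1 q.2.1 q.2.2).2 =
          pairDensity δ f q.1 q.2.1 := by
  rw [collisionMeasureR_eq, (isFluxR hσ).ae_iff (measurableSet_gainLoss_eq_zero hf)] at h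
  filter_upwards [h, hσ.pos, ae_collision_nondegenerate paramRMeasure] with q hq hp hn hs
  refine (gainLoss_eq_zero_iff δ f _).1 (hq ?_)
  rw [densityR, if_pos hs]
  have := hp hs
  have := Real.rpow_pos_of_pos (mul_pos hn.1 hn.2.1) (δ / 2 - 1)
  have := hn.2.2
  simp only [ne_eq, ENNReal.ofReal_eq_zero, not_le]
  positivity

lemma isRigidS {m δ : ℝ} (hm : 0 < m) {σ : CrossSection} (hσ : IsCrossSectionS m δ σ)
    {f : Phase → ℝ} (hf : Measurable f)
    (h : ∀ᵐ z ∂collisionMeasureS m δ σ, gainLoss δ f f z = 0) :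
    IsRigid (pairDensity δ f) := by
  refine isRigid_of_ae (π := paramSMeasure) (post := postS m)
    (poss := fun (x y : Phase) (p : ParamS) => 0 < postSpeedSq m x y p.1 p.2.1)
    (ae_conserved_of_gainLoss_eq_zeroS hσ hf h) (fun O t q p => ?_) (fun O t q p hp => ?_)
    (fun x y hx hy => ?_)
  · simp only [postS, postSpeedSq_pairMove, postPair_pairMove]
  · rw [postSpeedSq_pairMove]; exact hp
  -- Outcomes with a < I and b < J release internal energy, so they are possible whatever the
  -- relative speed.
  · have hset : paramSMeasure (Iio x.2 ×ˢ (Iio y.2 ×ˢ univ)) ≠ 0 := by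
      rw [paramSMeasure, Measure.prod_prod, Measure.prod_prod]
      exact mul_ne_zero (energyMeasure_Iio_ne_zero hx)
        (mul_ne_zero (energyMeasure_Iio_ne_zero hy) dirMeasure_univ_ne_zero)
    refine (frequently_ae_mem_iff.2 hset).mono ?_
    rintro ⟨a, b, ω⟩ ⟨ha, hb, -⟩
    have ha : a < x.2 := ha
    have hb : b < y.2 := hb
    have : 0 < 4 / m * (x.2 + y.2 - a - b) := mul_pos (by positivity) (by linarith)
    simp only [postSpeedSq]
    nlinarith [sq_nonneg ‖x.1 - y.1‖]

lemma isRigidR {δ : ℝ} {σ : CrossSection} (hσ : IsCrossSectionR δ σ)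
    {f : Phase → ℝ} (hf : Measurable f)
    (h : ∀ᵐ z ∂collisionMeasureR δ σ, gainLoss δ f f z = 0) :
    IsRigid (pairDensity δ f) := by
  have hsum : ∀ O t q, (pairMove O t q).1.2 + (pairMove O t q).2.2 = q.1.2 + q.2.2 := by
    intro O t q
    simp only [pairMove]; ring
  refine isRigid_of_ae (π := paramRMeasure) (post := postR)
    (poss := fun (x y : Phase) (p : ParamR) => p.1 < x.2 + y.2)
    (ae_conserved_of_gainLoss_eq_zeroR hσ hf h) (fun O t q p => ?_) (fun O t q p hp => ?_)
    (fun x y hx hy => ?_)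
  · simp only [postR, norm_pairMove_sub, hsum, postPair_pairMove]
  · simpa only [hsum] using hp
  · have hset : paramRMeasure (Iio (x.2 + y.2) ×ˢ univ) ≠ 0 := by
      rw [paramRMeasure, Measure.prod_prod]
      exact mul_ne_zero (energyMeasure_Iio_ne_zero (add_pos hx hy)) dirMeasure_univ_ne_zero
    exact (frequently_ae_mem_iff.2 hset).mono fun p hp => hp.1

/-! ### The functional equation of the collision invariants -/

/-- The function extends to an odd additive function on the whole line. A measurable additive
function is continuous, hence linear. -/
lemma exists_linear_of_additive_nonneg {q : ℝ → ℝ} (hq : Measurable q)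
    (hadd : ∀ s t, 0 ≤ s → 0 ≤ t → q (s + t) = q s + q t) : ∃ c, ∀ s, 0 ≤ s → q s = c * s := by
  have hq0 : q 0 = 0 := by have := hadd 0 0 le_rfl le_rfl; simp at this; exact this
  set Q : ℝ → ℝ := fun s => q (max s 0) - q (max (-s) 0) with hQ
  -- The value of `Q` at a difference does not depend on the chosen representation by nonnegative
  -- numbers, which makes additivity immediate.
  have key : ∀ a b, 0 ≤ a → 0 ≤ b → Q (a - b) = q a - q b := by
    intro a b ha hb
    have h1 := hadd a (max (-(a - b)) 0) ha (le_max_right _ _)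
    have h2 := hadd b (max (a - b) 0) hb (le_max_right _ _)
    have h3 : a + max (-(a - b)) 0 = b + max (a - b) 0 := by
      rcases le_total a b with h | h
      · rw [max_eq_left (by linarith), max_eq_right (by linarith)]; ring
      · rw [max_eq_right (by linarith), max_eq_left (by linarith)]; ring
    rw [h3] at h1
    simp only [hQ]
    linarith
  have hpm : ∀ s : ℝ, s = max s 0 - max (-s) 0 := by
    intro s
    rcases le_total s 0 with h | h
    · rw [max_eq_right h, max_eq_left (by linarith)]; ring
    · rw [max_eq_left h, max_eq_right (by linarith)]; ring
  have hQadd : ∀ s t, Q (s + t) = Q s + Q t := by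
    intro s t
    have hst : s + t = (max s 0 + max t 0) - (max (-s) 0 + max (-t) 0) := by
      linarith [hpm s, hpm t]
    rw [hst, key _ _ (by positivity) (by positivity), hadd _ _ (le_max_right _ _) (le_max_right _ _),
      hadd _ _ (le_max_right _ _) (le_max_right _ _)]
    simp only [hQ]
    ring
  have hQm : Measurable Q := by fun_prop
  set Qh : ℝ →+ ℝ := AddMonoidHom.mk' Q hQadd
  set Ql := Qh.toRealLinearMap (MeasureTheory.Measure.AddMonoidHom.continuous_of_measurable Qh hQm)
  refine ⟨Q 1, fun s hs => ?_⟩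
  have h1 : Ql (s • (1 : ℝ)) = s • Ql 1 := map_smul _ _ _
  have h2 : Q (s • (1 : ℝ)) = s • Q 1 := h1
  have h3 := key s 0 hs le_rfl
  simp only [smul_eq_mul, mul_one, sub_zero, hq0] at h2 h3
  rw [← h3, h2, mul_comm]

lemma exists_norm_eq_inner_eq_zero (S : Vel) {r : ℝ} (hr : 0 ≤ r) :
    ∃ v : Vel, ‖v‖ = r ∧ inner ℝ S v = 0 := by
  have hne : (ℝ ∙ S)ᗮ ≠ ⊥ := by
    rw [Ne, Submodule.orthogonal_eq_bot_iff]
    intro h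
    have h1 := finrank_span_le_card (R := ℝ) ({S} : Set Vel)
    rw [h, finrank_top] at h1
    simp at h1
  obtain ⟨w, hw, hw0⟩ := Submodule.exists_mem_ne_zero_of_ne_bot hne
  refine ⟨(r / ‖w‖) • w, ?_, ?_⟩
  · rw [norm_smul, Real.norm_of_nonneg (by positivity), div_mul_cancel₀ _ (norm_ne_zero_iff.2 hw0)]
  · rw [real_inner_smul_right, Submodule.mem_orthogonal_singleton_iff_inner_right.1 hw, mul_zero]

lemma norm_add_eq_norm_sub_of_inner_eq_zero {k l : Vel} (h : inner ℝ k l = 0) :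
    ‖k + l‖ = ‖k - l‖ := by
  refine (pow_left_inj₀ (norm_nonneg _) (norm_nonneg _) two_ne_zero).1 ?_
  rw [norm_add_sq_real, norm_sub_sq_real, h]
  ring

lemma norm_add_sq_of_inner_eq_zero {k l : Vel} (h : inner ℝ k l = 0) :
    ‖k + l‖ ^ 2 = ‖k‖ ^ 2 + ‖l‖ ^ 2 := by
  rw [norm_add_sq_real, h]
  ring

/-- A measurable function `φ` of the velocity such that `φ k + φ l` depends only on `k + l` and
`|k - l|` is a quadratic polynomial. -/
lemma exists_quadratic_of_conserved {φ : Vel → ℝ} (hφ : Measurable φ) (hφ0 : φ 0 = 0)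
    (hc : ∀ k l k' l', k + l = k' + l' → ‖k - l‖ = ‖k' - l'‖ → φ k + φ l = φ k' + φ l') :
    ∃ (b : Vel) (c : ℝ), ∀ k, φ k = inner ℝ b k + c * ‖k‖ ^ 2 := by
  have hcneg : ∀ k l k' l', k + l = k' + l' → ‖k - l‖ = ‖k' - l'‖ →
      φ (-k) + φ (-l) = φ (-k') + φ (-l') := by
    intro k l k' l' h1 h2
    refine hc _ _ _ _ (by rw [← neg_add, ← neg_add, h1]) ?_
    rw [← neg_sub', ← neg_sub', norm_neg, norm_neg, h2]
  -- For orthogonal k and l, the pairs (k, l) and (k + l, 0) have the same sum and the same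
  -- distance.
  have horth : ∀ k l, inner ℝ k l = 0 → φ (k + l) = φ k + φ l ∧ φ (-(k + l)) = φ (-k) + φ (-l) := by
    intro k l h
    have h1 : k + l = (k + l) + 0 := by simp
    have h2 : ‖k - l‖ = ‖(k + l) - 0‖ := by
      rw [sub_zero, norm_add_eq_norm_sub_of_inner_eq_zero h]
    have h3 := hc _ _ _ _ h1 h2
    have h4 := hcneg _ _ _ _ h1 h2
    rw [neg_zero, hφ0] at *
    exact ⟨by linarith, by linarith⟩
  -- the even part
  obtain ⟨e₁, he₁, -⟩ := exists_norm_eq_inner_eq_zero 0 zero_le_one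
  obtain ⟨e₂, he₂, he₁₂⟩ := exists_norm_eq_inner_eq_zero e₁ zero_le_one
  have hrad : ∀ k k' : Vel, ‖k‖ = ‖k'‖ → φ k + φ (-k) = φ k' + φ (-k') := by
    intro k k' h
    refine hc _ _ _ _ (by simp) ?_
    rw [sub_neg_eq_add, sub_neg_eq_add, ← two_smul ℝ k, ← two_smul ℝ k', norm_smul, norm_smul, h]
  -- The even part is radial. As a function of s = ‖k‖² it is additive, by Pythagoras and additivity
  -- on orthogonal vectors.
  set q : ℝ → ℝ := fun s => φ (√s • e₁) + φ (-(√s • e₁)) with hq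
  have hqm : Measurable q := by fun_prop
  have hqk : ∀ k, φ k + φ (-k) = q (‖k‖ ^ 2) := by
    intro k
    refine hrad _ _ ?_
    rw [Real.sqrt_sq (norm_nonneg _), norm_smul, he₁, mul_one, norm_norm]
  have hqadd : ∀ s t, 0 ≤ s → 0 ≤ t → q (s + t) = q s + q t := by
    intro s t hs ht
    have ho : inner ℝ (√s • e₁) (√t • e₂) = 0 := by
      rw [real_inner_smul_left, real_inner_smul_right, he₁₂]; simp
    obtain ⟨h1, h2⟩ := horth _ _ ho
    have n1 : ‖√s • e₁‖ ^ 2 = s := by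
      rw [norm_smul, he₁, mul_one, Real.norm_of_nonneg (Real.sqrt_nonneg _), Real.sq_sqrt hs]
    have n2 : ‖√t • e₂‖ ^ 2 = t := by
      rw [norm_smul, he₂, mul_one, Real.norm_of_nonneg (Real.sqrt_nonneg _), Real.sq_sqrt ht]
    have h3 := hqk (√s • e₁ + √t • e₂)
    have h4 := hqk (√s • e₁)
    have h5 := hqk (√t • e₂)
    rw [norm_add_sq_of_inner_eq_zero ho, n1, n2] at h3
    rw [n1] at h4
    rw [n2] at h5
    linarith
  obtain ⟨c, hqc⟩ := exists_linear_of_additive_nonneg hqm hqadd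
  -- the odd part
  set o : Vel → ℝ := fun k => φ k - φ (-k) with ho
  have ho0 : o 0 = 0 := by simp [ho]
  -- Jensen's equation for the odd part: (k, l) is replaced by (S + v, S - v) with v orthogonal to
  -- the midpoint S, and the contributions of v and -v cancel. With o(0) = 0 it implies additivity.
  have hmid : ∀ k l, o k + o l = 2 * o ((1 / 2 : ℝ) • (k + l)) := by
    intro k l
    set S := (1 / 2 : ℝ) • (k + l) with hS
    obtain ⟨v, hv, hSv⟩ := exists_norm_eq_inner_eq_zero S (r := ‖k - l‖ / 2) (by positivity)
    have h1 : k + l = (S + v) + (S + -v) := by rw [hS]; module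
    have h2 : ‖k - l‖ = ‖(S + v) - (S + -v)‖ := by
      have : (S + v) - (S + -v) = (2 : ℝ) • v := by module
      rw [this, norm_smul, hv]
      norm_num
      ring
    have e1 := hc _ _ _ _ h1 h2
    have e2 := hcneg _ _ _ _ h1 h2
    obtain ⟨e3, e4⟩ := horth S v hSv
    obtain ⟨e5, e6⟩ := horth S (-v) (by rw [inner_neg_right, hSv, neg_zero])
    rw [neg_neg] at e6
    simp only [ho]
    linarith
  have hoadd : ∀ k l, o (k + l) = o k + o l := by
    intro k l
    have h := hmid (k + l) 0
    rw [ho0, add_zero] at h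
    rw [hmid k l]
    simpa using h
  have hom : Measurable o := by fun_prop
  set oh : Vel →+ ℝ := AddMonoidHom.mk' o hoadd
  set ol := oh.toRealLinearMap (MeasureTheory.Measure.AddMonoidHom.continuous_of_measurable oh hom)
  refine ⟨(1 / 2 : ℝ) • (InnerProductSpace.toDual ℝ Vel).symm ol, c / 2, fun k => ?_⟩
  have h1 : o k = inner ℝ ((InnerProductSpace.toDual ℝ Vel).symm ol) k :=
    (InnerProductSpace.toDual_symm_apply (y := ol) (x := k)).symm
  have h2 := hqk k
  rw [hqc _ (sq_nonneg _)] at h2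
  rw [real_inner_smul_left, ← h1]
  simp only [ho]
  linarith

/-- Solution of the functional equation of the collision invariants, in the velocity and the
internal energy. -/
lemma exists_invariant_of_conserved {ψ : Vel → ℝ → ℝ} (hm : ∀ I, 0 < I → Measurable fun k => ψ k I)
    (ha : AntitoneOn (ψ 0) (Ioi 0))
    (hc : ∀ k l k' l' I J I' J', 0 < I → 0 < J → 0 < I' → 0 < J' → k + l = k' + l' →
      ‖k - l‖ = ‖k' - l'‖ → I + J = I' + J' → ψ k I + ψ l J = ψ k' I' + ψ l' J') :
    ∃ (a : ℝ) (b : Vel) (c d : ℝ), ∀ k I, 0 < I →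
      ψ k I = a + inner ℝ b k + c * ‖k‖ ^ 2 + d * I := by
  obtain ⟨b, c, hbc⟩ := exists_quadratic_of_conserved (φ := fun k => ψ k 1 - ψ 0 1)
    ((hm 1 one_pos).sub_const _) (by simp) (fun k l k' l' h1 h2 => by
      linarith [hc k l k' l' 1 1 1 1 one_pos one_pos one_pos one_pos h1 h2 rfl])
  -- The base point is 1 because nothing is assumed about ψ at energy 0; the truncation makes the
  -- function antitone on the whole line.
  set q : ℝ → ℝ := fun s => ψ 0 (1 + max s 0) - ψ 0 1 with hq
  have hqm : Measurable q := by
    refine Antitone.measurable fun s t hst => ?_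
    have h1 : (0 : ℝ) < 1 + max s 0 := by positivity
    have h2 : (0 : ℝ) < 1 + max t 0 := by positivity
    have := ha h1 h2 (by gcongr)
    simp only [hq]
    linarith
  have hqadd : ∀ s t, 0 ≤ s → 0 ≤ t → q (s + t) = q s + q t := by
    intro s t hs ht
    simp only [hq, max_eq_left hs, max_eq_left ht, max_eq_left (add_nonneg hs ht)]
    have := hc 0 0 0 0 (1 + (s + t)) 1 (1 + s) (1 + t) (by positivity) one_pos (by positivity)
      (by positivity) rfl rfl (by ring)
    linarith
  obtain ⟨d, hd⟩ := exists_linear_of_additive_nonneg hqm hqadd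
  refine ⟨ψ 0 1 - d, b, c, d, fun k I hI => ?_⟩
  -- Exchanging the energies I and 1 between velocities k and 0 separates the two variables.
  have h1 := hc k 0 k 0 I 1 1 I hI one_pos one_pos hI rfl rfl (add_comm _ _)
  have h2 := hbc k
  -- This relates energy I, possibly below 1, to the energy 1 + I covered by `q`.
  have h3 := hc 0 0 0 0 I (1 + 1) 1 (1 + I) hI (by norm_num) one_pos (by positivity) rfl rfl
    (by ring)
  have h4 := hd 1 zero_le_one
  have h5 := hd I hI.le
  simp only [hq, max_eq_left hI.le, max_eq_left (zero_le_one (α := ℝ))] at h4 h5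
  linarith

/-! ### Uniqueness of the Laplace transform -/

/-- Two finite measures on `ℝ³` with the same finite Laplace transform are equal. -/
lemma measure_ext_of_laplace {μ ν : Measure Vel} [IsFiniteMeasure μ] [IsFiniteMeasure ν]
    (hfin : ∀ k : Vel, ∫⁻ v, ENNReal.ofReal (Real.exp (inner ℝ k v)) ∂μ ≠ ⊤)
    (h : ∀ k : Vel, ∫⁻ v, ENNReal.ofReal (Real.exp (inner ℝ k v)) ∂μ =
      ∫⁻ v, ENNReal.ofReal (Real.exp (inner ℝ k v)) ∂ν) : μ = ν := by
  have hmeas : ∀ k : Vel, Measurable fun v : Vel => Real.exp (inner ℝ k v) := fun k => by fun_prop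
  have hint : ∀ k : Vel, Integrable (fun v : Vel => Real.exp (inner ℝ k v)) μ := fun k =>
    ⟨(hmeas k).aestronglyMeasurable, by
      rw [hasFiniteIntegral_iff_ofReal (Filter.Eventually.of_forall fun _ => (Real.exp_pos _).le)]
      exact (hfin k).lt_top⟩
  have heq : ∀ k : Vel, ∫ v, Real.exp (inner ℝ k v) ∂μ = ∫ v, Real.exp (inner ℝ k v) ∂ν :=
    fun k => by
      rw [integral_eq_lintegral_of_nonneg_ae (Filter.Eventually.of_forall fun _ =>
        (Real.exp_pos _).le) (hmeas k).aestronglyMeasurable,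
        integral_eq_lintegral_of_nonneg_ae (Filter.Eventually.of_forall fun _ =>
        (Real.exp_pos _).le) (hmeas k).aestronglyMeasurable, h k]
  have hzero : μ = 0 ↔ ν = 0 := by
    have h0 := h 0
    simp only [inner_zero_left, Real.exp_zero, ENNReal.ofReal_one, lintegral_one] at h0
    rw [← Measure.measure_univ_eq_zero, ← Measure.measure_univ_eq_zero, h0]
  refine Measure.ext_of_charFun ?_
  ext t
  set X : Vel → ℝ := fun v => inner ℝ v t with hX
  have hXs : ∀ s v, s * X v = inner ℝ (s • t) v := fun s v => by
    rw [hX, real_inner_smul_left, real_inner_comm]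
  have hmgf : ProbabilityTheory.mgf X μ = ProbabilityTheory.mgf X ν := by
    ext s
    simp only [ProbabilityTheory.mgf, hXs]
    exact heq _
  have hset : ProbabilityTheory.integrableExpSet X μ = univ := by
    refine eq_univ_of_forall fun s => ?_
    simp only [ProbabilityTheory.integrableExpSet, mem_ofPred_eq, hXs]
    exact hint _
  -- The real transform is finite everywhere, so equality extends analytically to the complex plane;
  -- at the imaginary unit it is equality of characteristic functions at `t`.
  have hc := ProbabilityTheory.eqOn_complexMGF_of_mgf' hmgf hzero
    (show Complex.I ∈ {z : ℂ | z.re ∈ interior (ProbabilityTheory.integrableExpSet X μ)} by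
      rw [hset]; simp)
  simp only [ProbabilityTheory.complexMGF] at hc
  rw [charFun_apply, charFun_apply]
  simpa only [mul_comm Complex.I] using hc

lemma measure_real_ext_of_Ioi {μ ν : Measure ℝ} [IsFiniteMeasure μ] (c : ℝ)
    (hμ : μ (Iic c) = 0) (hν : ν (Iic c) = 0) (h : ∀ a, c ≤ a → μ (Ioi a) = ν (Ioi a)) :
    μ = ν := by
  have huniv : ∀ ρ : Measure ℝ, ρ (Iic c) = 0 → ρ univ = ρ (Ioi c) := by
    intro ρ hρ
    have := measure_add_measure_compl (μ := ρ) (measurableSet_Iic (a := c))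
    rw [hρ, zero_add, compl_Iic] at this
    exact this.symm
  have hfin : μ univ = ν univ := by rw [huniv μ hμ, huniv ν hν, h c le_rfl]
  have : IsFiniteMeasure ν := ⟨by rw [← hfin]; exact measure_lt_top _ _⟩
  refine Measure.ext_of_Iic μ ν fun a => ?_
  rcases le_total a c with hac | hac
  · rw [measure_mono_null (Iic_subset_Iic.2 hac) hμ, measure_mono_null (Iic_subset_Iic.2 hac) hν]
  · rw [← compl_Ioi, measure_compl measurableSet_Ioi (measure_ne_top _ _),
      measure_compl measurableSet_Ioi (measure_ne_top _ _), h a hac, hfin]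

/-- Two densities on `ℝ³ × (c, ∞)` whose Laplace transforms in the velocity, integrated over
`(I, ∞)`, agree and are finite for all `I ≥ c`, are equal almost everywhere. -/
lemma ae_eq_of_laplace {c : ℝ} {u v : Phase → ENNReal} (hu : Measurable u) (hv : Measurable v)
    (hfin : ∀ (k : Vel) (I : ℝ), c ≤ I →
      ∫⁻ x in {x | I < x.2}, ENNReal.ofReal (Real.exp (inner ℝ k x.1)) * u x ∂phaseVolume ≠ ⊤)
    (h : ∀ (k : Vel) (I : ℝ), c ≤ I →
      ∫⁻ x in {x | I < x.2}, ENNReal.ofReal (Real.exp (inner ℝ k x.1)) * u x ∂phaseVolume =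
        ∫⁻ x in {x | I < x.2}, ENNReal.ofReal (Real.exp (inner ℝ k x.1)) * v x ∂phaseVolume) :
    ∀ᵐ x ∂phaseVolume, c < x.2 → u x = v x := by
  have hms : ∀ I : ℝ, MeasurableSet {x : Phase | I < x.2} := fun I =>
    measurableSet_lt measurable_const measurable_snd
  have hexp : ∀ k : Vel, Measurable fun w : Vel => ENNReal.ofReal (Real.exp (inner ℝ k w)) :=
    fun k => by fun_prop
  -- the Laplace transform of the velocity marginals
  have hmarg : ∀ {w : Phase → ENNReal}, Measurable w → ∀ (k : Vel) (I : ℝ),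
      ∫⁻ ξ, ENNReal.ofReal (Real.exp (inner ℝ k ξ))
        ∂(((phaseVolume.restrict {x | I < x.2}).withDensity w).map Prod.fst) =
      ∫⁻ x in {x | I < x.2}, ENNReal.ofReal (Real.exp (inner ℝ k x.1)) * w x ∂phaseVolume := by
    intro w hw k I
    rw [lintegral_map (hexp k) measurable_fst]
    refine (lintegral_withDensity_eq_lintegral_mul _ hw
      ((hexp k).comp measurable_fst)).trans ?_
    refine lintegral_congr fun x => ?_
    simp only [Pi.mul_apply, Function.comp_apply]
    rw [mul_comm]
  have hfm : ∀ {w : Phase → ENNReal} (I : ℝ),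
      ∫⁻ x in {x | I < x.2}, ENNReal.ofReal (Real.exp (inner ℝ (0 : Vel) x.1)) * w x
        ∂phaseVolume ≠ ⊤ →
      IsFiniteMeasure ((phaseVolume.restrict {x | I < x.2}).withDensity w) := by
    intro w I hI
    refine isFiniteMeasure_withDensity ?_
    simpa using hI
  have hmeq : ∀ I, c ≤ I → ((phaseVolume.restrict {x | I < x.2}).withDensity u).map Prod.fst =
      ((phaseVolume.restrict {x | I < x.2}).withDensity v).map Prod.fst := by
    intro I hI
    have := hfm I (hfin 0 I hI)
    have := hfm I (h 0 I hI ▸ hfin 0 I hI)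
    refine measure_ext_of_laplace (fun k => ?_) fun k => ?_
    · rw [hmarg hu]; exact hfin k I hI
    · rw [hmarg hu, hmarg hv]; exact h k I hI
  have h1 := hfm c (hfin 0 c le_rfl)
  have hrect : ∀ {w : Phase → ENNReal}, Measurable w → ∀ (A : Set Vel) (I : ℝ), MeasurableSet A →
      c ≤ I → ((phaseVolume.restrict {x | c < x.2}).withDensity w) (A ×ˢ Ioi I) =
        ((phaseVolume.restrict {x | I < x.2}).withDensity w).map Prod.fst A := by
    intro w hw A I hA hI
    rw [Measure.map_apply measurable_fst hA, withDensity_apply _ (hA.prod measurableSet_Ioi),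
      withDensity_apply _ (measurable_fst hA),
      Measure.restrict_restrict (hA.prod measurableSet_Ioi),
      Measure.restrict_restrict (measurable_fst hA)]
    congr 2
    ext x
    simp only [mem_inter_iff, mem_prod, mem_Ioi, mem_ofPred_eq, mem_preimage]
    constructor
    · rintro ⟨⟨a, b⟩, -⟩; exact ⟨a, b⟩
    · rintro ⟨a, b⟩; exact ⟨⟨a, b⟩, hI.trans_lt b⟩
  -- Equality on the sets A × (I, ∞) is known from the velocity marginals. For fixed `A`, both sides
  -- are measures in the energy determined by their values on rays.
  have hmeas : (phaseVolume.restrict {x | c < x.2}).withDensity u =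
      (phaseVolume.restrict {x | c < x.2}).withDensity v := by
    refine Measure.ext_prod fun {A} {B} hA hB => ?_
    have hreal : ∀ w : Phase → ENNReal,
        ((phaseVolume.restrict {x | c < x.2}).withDensity w) (A ×ˢ B) =
        ((((phaseVolume.restrict {x | c < x.2}).withDensity w).restrict
          (Prod.fst ⁻¹' A)).map Prod.snd) B := by
      intro w
      rw [Measure.map_apply measurable_snd hB, Measure.restrict_apply (measurable_snd hB)]
      congr 1
      ext x
      simp [and_comm]
    rw [hreal, hreal]
    congr 1
    have hIic : ∀ {w : Phase → ENNReal}, Measurable w →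
        ((((phaseVolume.restrict {x | c < x.2}).withDensity w).restrict
          (Prod.fst ⁻¹' A)).map Prod.snd) (Iic c) = 0 := by
      intro w hw
      rw [Measure.map_apply measurable_snd measurableSet_Iic,
        Measure.restrict_apply (measurable_snd measurableSet_Iic)]
      refine measure_mono_null inter_subset_left ?_
      rw [withDensity_apply _ (measurable_snd measurableSet_Iic),
        Measure.restrict_restrict (measurable_snd measurableSet_Iic)]
      have : Prod.snd ⁻¹' Iic c ∩ {x : Phase | c < x.2} = ∅ := by
        ext x; simp
      rw [this]
      simp
    refine measure_real_ext_of_Ioi c (hIic hu) (hIic hv) fun I hI => ?_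
    have hIoi : ∀ {w : Phase → ENNReal}, Measurable w →
        ((((phaseVolume.restrict {x | c < x.2}).withDensity w).restrict
          (Prod.fst ⁻¹' A)).map Prod.snd) (Ioi I) =
        ((phaseVolume.restrict {x | I < x.2}).withDensity w).map Prod.fst A := by
      intro w hw
      rw [← hrect hw A I hA hI, Measure.map_apply measurable_snd measurableSet_Ioi,
        Measure.restrict_apply (measurable_snd measurableSet_Ioi)]
      congr 1
      ext x
      simp [and_comm]
    rw [hIoi hu, hIoi hv, hmeq I hI]
  have h2 := (withDensity_eq_iff_of_sigmaFinite hu.aemeasurable hv.aemeasurable).1 hmeas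
  exact (ae_restrict_iff' (hms c)).1 h2

/-! ### The Laplace transform of a rigid density -/

/-- `I^(1-δ/2) f`, with values in `[0, ∞]`. -/
def reduced (δ : ℝ) (f : Phase → ℝ) (x : Phase) : ENNReal :=
  ENNReal.ofReal (f x / x.2 ^ (δ / 2 - 1))

/-- The exponential weight `exp (k · ξ - |ξ|²)`. -/
def expWeight (k : Vel) (x : Phase) : ENNReal :=
  ENNReal.ofReal (Real.exp (inner ℝ k x.1 - ‖x.1‖ ^ 2))

/-- The Laplace transform in the velocity of `I^(1-δ/2) f exp (-|ξ|²)`, integrated over internal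
energies larger than `I`. -/
def laplace (δ : ℝ) (f : Phase → ℝ) (k : Vel) (I : ℝ) : ENNReal :=
  ∫⁻ x in {x | I < x.2}, expWeight k x * reduced δ f x ∂phaseVolume

lemma measurable_reduced {δ : ℝ} {f : Phase → ℝ} (hf : Measurable f) :
    Measurable (reduced δ f) := by
  unfold reduced; fun_prop

lemma measurable_expWeight (k : Vel) : Measurable (expWeight k) := by
  unfold expWeight; fun_prop

lemma measurableSet_energy_gt (I : ℝ) : MeasurableSet {x : Phase | I < x.2} :=
  measurableSet_lt measurable_const measurable_snd

lemma laplace_eq_indicator (δ : ℝ) (f : Phase → ℝ) (k : Vel) (I : ℝ) :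
    laplace δ f k I = ∫⁻ x, {x : Phase | I < x.2}.indicator (expWeight k) x * reduced δ f x
      ∂phaseVolume := by
  rw [laplace, ← lintegral_indicator (measurableSet_energy_gt I)]
  refine lintegral_congr fun x => ?_
  by_cases hx : x ∈ {x : Phase | I < x.2}
  · rw [indicator_of_mem hx, indicator_of_mem hx]
  · rw [indicator_of_notMem hx, indicator_of_notMem hx, zero_mul]

section

variable {δ : ℝ} {f : Phase → ℝ}

lemma ae_reduced_mul (hpos : ∀ᵐ x ∂phaseMeasure, 0 < f x)
    (hr : IsRigid (pairDensity δ f)) (O : Vel ≃ₗᵢ[ℝ] Vel) (t : ℝ) :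
    ∀ᵐ q ∂phaseVolume.prod phaseVolume, 0 < q.1.2 → 0 < q.2.2 → 0 < q.1.2 + t → 0 < q.2.2 - t →
      reduced δ f (pairMove O t q).1 * reduced δ f (pairMove O t q).2 =
        reduced δ f q.1 * reduced δ f q.2 := by
  have hpos' := ae_phaseMeasure_iff.1 hpos
  have h1 : ∀ᵐ q ∂phaseVolume.prod phaseVolume,
      (0 < q.1.2 → 0 < f q.1) ∧ (0 < q.2.2 → 0 < f q.2) :=
    (Measure.quasiMeasurePreserving_fst.ae hpos').and (Measure.quasiMeasurePreserving_snd.ae hpos')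
  have h2 := (measurePreserving_pairMove O t).quasiMeasurePreserving.ae h1
  have key : ∀ x y : Phase, 0 < x.2 → 0 < y.2 → 0 < f x →
      reduced δ f x * reduced δ f y = ENNReal.ofReal (pairDensity δ f x y) := by
    intro x y hx hy hfx
    have := Real.rpow_pos_of_pos hx (δ / 2 - 1)
    rw [reduced, reduced, ← ENNReal.ofReal_mul (by positivity), pairDensity,
      Real.mul_rpow hx.le hy.le, div_mul_div_comm]
  filter_upwards [hr O t, h1, h2] with q hq h1 h2 a b c d
  rw [key _ _ c d (h2.1 c), key _ _ a b (h1.1 a), hq a b c d]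

lemma exists_isometry_map_eq {a b : Vel} (h : ‖a‖ = ‖b‖) : ∃ O : Vel ≃ₗᵢ[ℝ] Vel, O a = b :=
  ⟨_, Submodule.reflection_sub h⟩

/-- By polarization the exponent depends on the sum and the difference of the velocities. The sum
and the length of the difference are unchanged, and the rotation of the difference is compensated by
that of k' - l'. -/
lemma inner_sub_norm_pairMove {k l k' l' : Vel} {O : Vel ≃ₗᵢ[ℝ] Vel} (h : k + l = k' + l')
    (hO : O (k' - l') = k - l) (t : ℝ) (q : Phase × Phase) :
    (inner ℝ k (pairMove O t q).1.1 - ‖(pairMove O t q).1.1‖ ^ 2) +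
        (inner ℝ l (pairMove O t q).2.1 - ‖(pairMove O t q).2.1‖ ^ 2) =
      (inner ℝ k' q.1.1 - ‖q.1.1‖ ^ 2) + (inner ℝ l' q.2.1 - ‖q.2.1‖ ^ 2) := by
  have pol : ∀ v w : Vel, ‖v‖ ^ 2 + ‖w‖ ^ 2 = (‖v + w‖ ^ 2 + ‖v - w‖ ^ 2) / 2 := by
    intro v w
    rw [norm_add_sq_real, norm_sub_sq_real]; ring
  have bil : ∀ k l v w : Vel, inner ℝ k v + inner ℝ l w =
      (inner ℝ (k + l) (v + w) + inner ℝ (k - l) (v - w)) / 2 := by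
    intro k l v w
    simp only [inner_add_left, inner_add_right, inner_sub_left, inner_sub_right]; ring
  have e1 := pol (pairMove O t q).1.1 (pairMove O t q).2.1
  have e2 := bil k l (pairMove O t q).1.1 (pairMove O t q).2.1
  have e3 := pol q.1.1 q.2.1
  have e4 := bil k' l' q.1.1 q.2.1
  rw [pairMove_add, norm_pairMove_sub] at e1
  rw [pairMove_add, pairMove_sub, h, ← hO, O.inner_map_map] at e2
  linarith

/-- In the product written as a double integral, substituting `pairMove O (I - I')` turns the
thresholds I, J into I', J' and the frequencies k, l into k', l', while rigidity preserves the
product of the densities. -/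
lemma laplace_mul_laplace (hf : Measurable f) (hpos : ∀ᵐ x ∂phaseMeasure, 0 < f x)
    (hr : IsRigid (pairDensity δ f)) {k l k' l' : Vel} {I J I' J' : ℝ} (hI : 0 < I) (hJ : 0 < J)
    (hI' : 0 < I') (hJ' : 0 < J') (h1 : k + l = k' + l') (h2 : ‖k - l‖ = ‖k' - l'‖)
    (h3 : I + J = I' + J') :
    laplace δ f k I * laplace δ f l J = laplace δ f k' I' * laplace δ f l' J' := by
  have hm : ∀ (k : Vel) (I : ℝ), Measurable fun x : Phase =>
      {x : Phase | I < x.2}.indicator (expWeight k) x * reduced δ f x := fun k I =>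
    ((measurable_expWeight k).indicator (measurableSet_energy_gt I)).mul (measurable_reduced hf)
  have hprod : ∀ (k l : Vel) (I J : ℝ), laplace δ f k I * laplace δ f l J =
      ∫⁻ q, ({x : Phase | I < x.2}.indicator (expWeight k) q.1 * reduced δ f q.1) *
        ({x : Phase | J < x.2}.indicator (expWeight l) q.2 * reduced δ f q.2)
        ∂phaseVolume.prod phaseVolume := by
    intro k l I J
    rw [laplace_eq_indicator, laplace_eq_indicator,
      lintegral_prod_mul (hm k I).aemeasurable (hm l J).aemeasurable]
  obtain ⟨O, hO⟩ := exists_isometry_map_eq h2.symm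
  have hmm : Measurable fun q : Phase × Phase =>
      ({x : Phase | I < x.2}.indicator (expWeight k) q.1 * reduced δ f q.1) *
        ({x : Phase | J < x.2}.indicator (expWeight l) q.2 * reduced δ f q.2) :=
    ((hm k I).comp measurable_fst).mul ((hm l J).comp measurable_snd)
  rw [hprod, hprod, ← (measurePreserving_pairMove O (I - I')).lintegral_comp hmm]
  refine lintegral_congr_ae ?_
  filter_upwards [ae_reduced_mul hpos hr O (I - I')] with q hq
  by_cases hs : I' < q.1.2 ∧ J' < q.2.2
  · have m1 : (pairMove O (I - I') q).1 ∈ {x : Phase | I < x.2} := by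
      simp only [mem_ofPred_eq, pairMove]; linarith
    have m2 : (pairMove O (I - I') q).2 ∈ {x : Phase | J < x.2} := by
      simp only [mem_ofPred_eq, pairMove]; linarith
    have m3 : q.1 ∈ {x : Phase | I' < x.2} := hs.1
    have m4 : q.2 ∈ {x : Phase | J' < x.2} := hs.2
    have hq' := hq (by linarith) (by linarith) (by linarith) (by linarith)
    have hw : expWeight k (pairMove O (I - I') q).1 * expWeight l (pairMove O (I - I') q).2 =
        expWeight k' q.1 * expWeight l' q.2 := by
      simp only [expWeight]
      rw [← ENNReal.ofReal_mul (Real.exp_pos _).le, ← ENNReal.ofReal_mul (Real.exp_pos _).le,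
        ← Real.exp_add, ← Real.exp_add, inner_sub_norm_pairMove h1 hO]
    simp only [indicator_of_mem m1, indicator_of_mem m2,
      indicator_of_mem m3, indicator_of_mem m4]
    rw [mul_mul_mul_comm, hw, hq', mul_mul_mul_comm]
  · rcases not_and_or.1 hs with h | h
    · have m1 : (pairMove O (I - I') q).1 ∉ {x : Phase | I < x.2} := by
        simp only [mem_ofPred_eq, pairMove]; intro h'; exact h (by linarith)
      have m3 : q.1 ∉ {x : Phase | I' < x.2} := h
      simp only [indicator_of_notMem m1, indicator_of_notMem m3, zero_mul]
    · have m2 : (pairMove O (I - I') q).2 ∉ {x : Phase | J < x.2} := by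
        simp only [mem_ofPred_eq, pairMove]; intro h'; exact h (by linarith)
      have m4 : q.2 ∉ {x : Phase | J' < x.2} := h
      simp only [indicator_of_notMem m2, indicator_of_notMem m4, zero_mul, mul_zero]

/-- Completing the square in k·ξ - |ξ|². The Gaussian factor thus makes the transform finite for all
k although f is only integrable. -/
lemma expWeight_le (k : Vel) (x : Phase) :
    expWeight k x ≤ ENNReal.ofReal (Real.exp (‖k‖ ^ 2 / 4)) := by
  refine ENNReal.ofReal_le_ofReal (Real.exp_le_exp.2 ?_)
  have := real_inner_le_norm k x.1
  nlinarith [sq_nonneg (‖x.1‖ - ‖k‖ / 2)]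

/-- For δ ≥ 2 the factor I^(1-δ/2) is bounded away from energy 0, which is why the transform is cut
off at a positive threshold. -/
lemma lintegral_reduced_lt_top (hδ : 2 ≤ δ) (hpos : ∀ᵐ x ∂phaseMeasure, 0 < f x)
    (hint : Integrable f phaseMeasure) {I : ℝ} (hI : 0 < I) :
    ∫⁻ x in {x | I < x.2}, reduced δ f x ∂phaseVolume < ⊤ := by
  have hIp := Real.rpow_pos_of_pos hI (δ / 2 - 1)
  have hpos' := ae_phaseMeasure_iff.1 hpos
  have h1 : ∫⁻ x in {x | I < x.2}, reduced δ f x ∂phaseVolume ≤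
      ∫⁻ x in {x | I < x.2}, ENNReal.ofReal (1 / I ^ (δ / 2 - 1)) * ENNReal.ofReal (f x)
        ∂phaseVolume := by
    refine setLIntegral_mono_ae' (measurableSet_energy_gt I) ?_
    filter_upwards [hpos'] with x hx hIx
    have hIx : I < x.2 := hIx
    have hfx := hx (hI.trans hIx)
    rw [← ENNReal.ofReal_mul (by positivity)]
    refine ENNReal.ofReal_le_ofReal ?_
    rw [one_div, inv_mul_eq_div]
    exact div_le_div_of_nonneg_left hfx.le hIp
      (Real.rpow_le_rpow hI.le hIx.le (by linarith))
  refine h1.trans_lt ?_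
  rw [lintegral_const_mul' _ _ ENNReal.ofReal_ne_top]
  refine ENNReal.mul_lt_top ENNReal.ofReal_lt_top ?_
  refine lt_of_le_of_lt ?_ hint.lintegral_lt_top
  rw [phaseMeasure_eq_restrict]
  exact lintegral_mono_set fun x hx => lt_trans hI hx

lemma laplace_ne_top (hδ : 2 ≤ δ) (hpos : ∀ᵐ x ∂phaseMeasure, 0 < f x)
    (hint : Integrable f phaseMeasure) (k : Vel) {I : ℝ} (hI : 0 < I) :
    laplace δ f k I ≠ ⊤ := by
  have h1 : laplace δ f k I ≤ ∫⁻ x in {x | I < x.2},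
      ENNReal.ofReal (Real.exp (‖k‖ ^ 2 / 4)) * reduced δ f x ∂phaseVolume :=
    lintegral_mono fun x => mul_le_mul_left (expWeight_le k x) _
  refine (h1.trans_lt ?_).ne
  rw [lintegral_const_mul' _ _ ENNReal.ofReal_ne_top]
  exact ENNReal.mul_lt_top ENNReal.ofReal_lt_top (lintegral_reduced_lt_top hδ hpos hint hI)

lemma ae_expWeight_mul_reduced_pos (hpos : ∀ᵐ x ∂phaseMeasure, 0 < f x) (k : Vel) :
    ∀ᵐ x ∂phaseVolume, 0 < x.2 → expWeight k x * reduced δ f x ≠ 0 := by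
  filter_upwards [ae_phaseMeasure_iff.1 hpos] with x hx h
  have := Real.rpow_pos_of_pos h (δ / 2 - 1)
  have := hx h
  refine mul_ne_zero ?_ ?_
  · simp only [expWeight, ne_eq, ENNReal.ofReal_eq_zero, not_le]; positivity
  · simp only [reduced, ne_eq, ENNReal.ofReal_eq_zero, not_le]; positivity

lemma setLIntegral_reduced_ne_zero (hf : Measurable f) (hpos : ∀ᵐ x ∂phaseMeasure, 0 < f x)
    (k : Vel) {s : Set Phase} (hs : MeasurableSet s) (hs0 : ∀ x ∈ s, 0 < x.2)
    (hμ : phaseVolume s ≠ 0) :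
    ∫⁻ x in s, expWeight k x * reduced δ f x ∂phaseVolume ≠ 0 := by
  have hm : Measurable fun x => expWeight k x * reduced δ f x :=
    (measurable_expWeight k).mul (measurable_reduced hf)
  rw [Ne, setLIntegral_eq_zero_iff hs hm]
  intro h
  refine hμ ?_
  rw [measure_eq_zero_iff_ae_notMem]
  filter_upwards [h, ae_expWeight_mul_reduced_pos (δ := δ) hpos k] with x h1 h2 hx
  exact h2 (hs0 x hx) (h1 hx)

lemma phaseVolume_univ_prod_ne_zero {t : Set ℝ} (ht : volume t ≠ 0) :
    phaseVolume (univ ×ˢ t) ≠ 0 := by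
  rw [phaseVolume, Measure.prod_prod]
  refine mul_ne_zero ?_ ht
  rw [Ne, Measure.measure_univ_eq_zero]
  exact NeZero.ne velMeasure

lemma laplace_ne_zero (hf : Measurable f) (hpos : ∀ᵐ x ∂phaseMeasure, 0 < f x)
    (k : Vel) {I : ℝ} (hI : 0 < I) : laplace δ f k I ≠ 0 := by
  refine setLIntegral_reduced_ne_zero hf hpos k (measurableSet_energy_gt I)
    (fun x hx => lt_trans hI hx) ?_
  have : {x : Phase | I < x.2} = univ ×ˢ Ioi I := by ext; simp
  rw [this]
  exact phaseVolume_univ_prod_ne_zero (by simp)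

lemma laplace_strictAnti (hδ : 2 ≤ δ) (hf : Measurable f) (hpos : ∀ᵐ x ∂phaseMeasure, 0 < f x)
    (hint : Integrable f phaseMeasure) (k : Vel) {I J : ℝ} (hI : 0 < I) (hIJ : I < J) :
    laplace δ f k J < laplace δ f k I := by
  have hset : {x : Phase | I < x.2} = {x : Phase | J < x.2} ∪ univ ×ˢ Ioc I J := by
    ext x
    simp only [mem_ofPred_eq, mem_union, mem_prod, mem_univ, true_and, mem_Ioc]
    constructor
    · intro h
      rcases lt_or_ge J x.2 with h' | h'
      · exact Or.inl h'
      · exact Or.inr ⟨h, h'⟩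
    · rintro (h | h)
      · exact hIJ.trans h
      · exact h.1
  have hd : Disjoint {x : Phase | J < x.2} (univ ×ˢ Ioc I J) := by
    rw [Set.disjoint_left]
    rintro x hx ⟨-, hx'⟩
    exact absurd hx'.2 (not_le.2 hx)
  have hms : MeasurableSet ((univ : Set Vel) ×ˢ Ioc I J) := MeasurableSet.univ.prod measurableSet_Ioc
  have h0 := setLIntegral_reduced_ne_zero (δ := δ) hf hpos k hms
    (fun x hx => hI.trans hx.2.1) (phaseVolume_univ_prod_ne_zero (by simpa using hIJ))
  have : laplace δ f k I = laplace δ f k J +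
      ∫⁻ x in univ ×ˢ Ioc I J, expWeight k x * reduced δ f x ∂phaseVolume := by
    rw [laplace, hset, lintegral_union hms hd]
    rfl
  rw [this]
  exact ENNReal.lt_add_right (laplace_ne_top hδ hpos hint k (hI.trans hIJ)) h0

lemma measurable_laplace (hf : Measurable f) (I : ℝ) : Measurable fun k => laplace δ f k I := by
  unfold laplace
  refine Measurable.lintegral_prod_right' (f := fun p : Vel × Phase =>
    expWeight p.1 p.2 * reduced δ f p.2) ?_
  have h1 : Measurable fun p : Vel × Phase => reduced δ f p.2 :=
    (measurable_reduced hf).comp measurable_snd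
  have h2 : Measurable fun p : Vel × Phase => expWeight p.1 p.2 := by
    unfold expWeight
    have : Measurable fun p : Vel × Phase => inner ℝ p.1 p.2.1 :=
      (continuous_fst.inner (continuous_fst.comp continuous_snd)).measurable
    fun_prop
  exact h2.mul h1

/-- The Laplace transform of a rigid density is the exponential of a collision invariant. -/
lemma exists_laplace_eq (hδ : 2 ≤ δ) (hf : Measurable f) (hpos : ∀ᵐ x ∂phaseMeasure, 0 < f x)
    (hint : Integrable f phaseMeasure) (hr : IsRigid (pairDensity δ f)) :
    ∃ (a : ℝ) (b : Vel) (c d : ℝ), d < 0 ∧ ∀ k I, 0 < I → laplace δ f k I =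
      ENNReal.ofReal (Real.exp (a + inner ℝ b k + c * ‖k‖ ^ 2 + d * I)) := by
  have hLpos : ∀ k {I : ℝ}, 0 < I → 0 < (laplace δ f k I).toReal := fun k I hI =>
    ENNReal.toReal_pos (laplace_ne_zero hf hpos k hI) (laplace_ne_top hδ hpos hint k hI)
  have hanti : ∀ I J : ℝ, 0 < I → I < J → Real.log (laplace δ f 0 J).toReal <
      Real.log (laplace δ f 0 I).toReal := fun I J hI hIJ =>
    Real.log_lt_log (hLpos 0 (hI.trans hIJ)) ((ENNReal.toReal_lt_toReal
      (laplace_ne_top hδ hpos hint 0 (hI.trans hIJ)) (laplace_ne_top hδ hpos hint 0 hI)).2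
        (laplace_strictAnti hδ hf hpos hint 0 hI hIJ))
  obtain ⟨a, b, c, d, h⟩ := exists_invariant_of_conserved
    (ψ := fun k I => Real.log (laplace δ f k I).toReal)
    (fun I _ => (measurable_laplace hf I).ennreal_toReal.log)
    (fun I hI J _ hIJ => by
      rcases hIJ.eq_or_lt with rfl | hlt
      · exact le_rfl
      · exact (hanti I J hI hlt).le)
    (fun k l k' l' I J I' J' hI hJ hI' hJ' h1 h2 h3 => by
      rw [← Real.log_mul (hLpos k hI).ne' (hLpos l hJ).ne',
        ← Real.log_mul (hLpos k' hI').ne' (hLpos l' hJ').ne', ← ENNReal.toReal_mul,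
        ← ENNReal.toReal_mul, laplace_mul_laplace hf hpos hr hI hJ hI' hJ' h1 h2 h3])
  refine ⟨a, b, c, d, ?_, fun k I hI => ?_⟩
  · have h1 := h 0 1 one_pos
    have h2 := h 0 2 two_pos
    have h3 := hanti 1 2 one_pos (by norm_num)
    rw [h1, h2] at h3
    linarith
  · rw [← h k I hI, Real.exp_log (hLpos k hI),
      ENNReal.ofReal_toReal (laplace_ne_top hδ hpos hint k hI)]

lemma ae_inner_ne {k : Vel} (hk : k ≠ 0) (s : ℝ) : ∀ᵐ v ∂velMeasure, inner ℝ k v ≠ s := by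
  have hms : MeasurableSet {v : Vel | inner ℝ k v = s} :=
    measurableSet_eq_fun (by fun_prop) measurable_const
  set S : AffineSubspace ℝ Vel := (AffineSubspace.mk' ((s / ‖k‖ ^ 2) • k) (ℝ ∙ k)ᗮ) with hS
  have hmem : ∀ v : Vel, inner ℝ k v = s → v ∈ S := by
    intro v hv
    rw [hS, AffineSubspace.mem_mk', Submodule.mem_orthogonal_singleton_iff_inner_right,
      vsub_eq_sub, inner_sub_right, hv, real_inner_smul_right, real_inner_self_eq_norm_sq,
      div_mul_cancel₀ _ (by positivity), sub_self]
  have hne : S ≠ ⊤ := by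
    intro h
    have h1 : S.direction = ⊤ := by rw [h, AffineSubspace.direction_top]
    rw [hS, AffineSubspace.direction_mk', Submodule.orthogonal_eq_top_iff,
      Submodule.span_singleton_eq_bot] at h1
    exact hk h1
  have h0 : velMeasure (S : Set Vel) = 0 := Measure.addHaar_affineSubspace velMeasure S hne
  have := measure_eq_zero_iff_ae_notMem.1 h0
  filter_upwards [this] with v hv h
  exact hv (hmem v h)

/-- The quadratic coefficient of the logarithm of the Laplace transform is positive. -/
lemma laplace_quadratic_pos (hδ : 2 ≤ δ) (hf : Measurable f)
    (hpos : ∀ᵐ x ∂phaseMeasure, 0 < f x) (hint : Integrable f phaseMeasure)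
    {a : ℝ} {b : Vel} {c d : ℝ} (h : ∀ k I, 0 < I → laplace δ f k I =
      ENNReal.ofReal (Real.exp (a + inner ℝ b k + c * ‖k‖ ^ 2 + d * I))) : 0 < c := by
  obtain ⟨k, hk, -⟩ := exists_norm_eq_inner_eq_zero 0 zero_le_one
  have hk0 : k ≠ 0 := by rintro rfl; simp at hk
  set s : ℝ := inner ℝ b k with hs
  set A : Set Phase := {x | 1 < x.2} with hA
  have hm : ∀ k, Measurable fun x => expWeight k x * reduced δ f x := fun k =>
    (measurable_expWeight k).mul (measurable_reduced hf)
  have hrest : phaseVolume.restrict A ≠ 0 := by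
    rw [Ne, Measure.restrict_eq_zero]
    have : A = univ ×ˢ Ioi 1 := by ext; simp [hA]
    rw [this]
    exact phaseVolume_univ_prod_ne_zero (by simp)
  -- The weights `exp (∓s)` cancel the linear term of log L at `±k`. The inequality is `2 < exp t +
  -- exp (-t)` off the null hyperplane t = 0; inserted in the formula for L with ‖k‖ = 1, it becomes
  -- exp c > 1.
  have hlt : ∫⁻ x in A, ENNReal.ofReal 2 * (expWeight 0 x * reduced δ f x) ∂phaseVolume <
      ∫⁻ x in A, (ENNReal.ofReal (Real.exp (-s)) * (expWeight k x * reduced δ f x) +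
        ENNReal.ofReal (Real.exp s) * (expWeight (-k) x * reduced δ f x)) ∂phaseVolume := by
    refine lintegral_strict_mono hrest
      (((hm k).const_mul _).add ((hm (-k)).const_mul _)).aemeasurable ?_ ?_
    · rw [lintegral_const_mul _ (hm 0)]
      exact ENNReal.mul_ne_top ENNReal.ofReal_ne_top (laplace_ne_top hδ hpos hint 0 one_pos)
    · rw [ae_restrict_iff' (measurableSet_energy_gt 1)]
      have hn : ∀ᵐ x ∂phaseVolume, inner ℝ k x.1 ≠ s :=
        Measure.quasiMeasurePreserving_fst.ae (ae_inner_ne hk0 s)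
      filter_upwards [hn, ae_phaseMeasure_iff.1 hpos] with x hx hfx hx1
      have hx0 : 0 < x.2 := lt_trans one_pos hx1
      have hfx := hfx hx0
      have hp := Real.rpow_pos_of_pos hx0 (δ / 2 - 1)
      have hw : 0 < f x / x.2 ^ (δ / 2 - 1) := by positivity
      simp only [expWeight, reduced]
      simp only [← ENNReal.ofReal_mul (Real.exp_pos _).le,
        ← ENNReal.ofReal_mul (zero_le_two (α := ℝ))]
      rw [← ENNReal.ofReal_add (by positivity) (by positivity),
        ENNReal.ofReal_lt_ofReal_iff (by positivity)]
      set t := inner ℝ k x.1 - s with ht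
      have ht0 : t ≠ 0 := sub_ne_zero.2 hx
      have e1 : Real.exp (-s) * (Real.exp (inner ℝ k x.1 - ‖x.1‖ ^ 2) *
          (f x / x.2 ^ (δ / 2 - 1))) =
          Real.exp t * (Real.exp (-‖x.1‖ ^ 2) * (f x / x.2 ^ (δ / 2 - 1))) := by
        rw [← mul_assoc, ← mul_assoc, ← Real.exp_add, ← Real.exp_add, ht]
        congr 2; ring
      have e2 : Real.exp s * (Real.exp (inner ℝ (-k) x.1 - ‖x.1‖ ^ 2) *
          (f x / x.2 ^ (δ / 2 - 1))) =
          Real.exp (-t) * (Real.exp (-‖x.1‖ ^ 2) * (f x / x.2 ^ (δ / 2 - 1))) := by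
        rw [← mul_assoc, ← mul_assoc, ← Real.exp_add, ← Real.exp_add, ht, inner_neg_left]
        congr 2; ring
      have e3 : inner ℝ (0 : Vel) x.1 - ‖x.1‖ ^ 2 = -‖x.1‖ ^ 2 := by
        rw [inner_zero_left]; ring
      rw [e1, e2, e3, ← add_mul]
      have h2 : 2 < Real.exp t + Real.exp (-t) := by
        have := Real.one_lt_cosh.2 ht0
        rw [Real.cosh_eq] at this
        linarith
      exact mul_lt_mul_of_pos_right h2 (by positivity)
  rw [lintegral_const_mul _ (hm 0), lintegral_add_left ((hm k).const_mul _),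
    lintegral_const_mul _ (hm k), lintegral_const_mul _ (hm (-k))] at hlt
  change ENNReal.ofReal 2 * laplace δ f 0 1 < ENNReal.ofReal (Real.exp (-s)) * laplace δ f k 1 +
    ENNReal.ofReal (Real.exp s) * laplace δ f (-k) 1 at hlt
  rw [h 0 1 one_pos, h k 1 one_pos, h (-k) 1 one_pos,
    ← ENNReal.ofReal_mul zero_le_two, ← ENNReal.ofReal_mul (Real.exp_pos _).le,
    ← ENNReal.ofReal_mul (Real.exp_pos _).le, ← ENNReal.ofReal_add (by positivity) (by positivity),
    ENNReal.ofReal_lt_ofReal_iff (by positivity), ← Real.exp_add, ← Real.exp_add, norm_neg, hk,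
    inner_neg_right, ← hs] at hlt
  simp only [inner_zero_right, norm_zero] at hlt
  ring_nf at hlt
  have h3 := lt_of_mul_lt_mul_right hlt zero_le_two
  rw [Real.exp_lt_exp] at h3
  linarith

end

/-! ### Identification of rigid densities -/

lemma integral_gaussian_vel {β : ℝ} (hβ : 0 < β) :
    ∫ v, Real.exp (-(β * ‖v‖ ^ 2)) ∂velMeasure = (Real.pi / β) ^ (3 / 2 : ℝ) := by
  have h := GaussianFourier.integral_rexp_neg_mul_sq_norm (V := Vel) hβ
  simp only [neg_mul, finrank_euclideanSpace_fin, Nat.cast_ofNat] at h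
  exact h

lemma integrable_gaussian_vel {β : ℝ} (hβ : 0 < β) :
    Integrable (fun v => Real.exp (-(β * ‖v‖ ^ 2))) velMeasure := by
  -- A function that is not integrable has Bochner integral 0, while the value here is positive.
  refine not_imp_comm.1 integral_undef ?_
  rw [integral_gaussian_vel hβ]
  positivity

lemma lintegral_gaussian_tilted {c : ℝ} (hc : 0 < c) (k b : Vel) :
    ∫⁻ v, ENNReal.ofReal (Real.exp (inner ℝ k v)) *
        ENNReal.ofReal (Real.exp (-(1 / (4 * c) * ‖v - b‖ ^ 2))) ∂velMeasure =
      ENNReal.ofReal (Real.exp (inner ℝ b k + c * ‖k‖ ^ 2) *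
        (Real.pi / (1 / (4 * c))) ^ (3 / 2 : ℝ)) := by
  have hβ : 0 < 1 / (4 * c) := by positivity
  -- Completing the square moves the centre of the Gaussian from `b` to `b + (2 * c) • k`.
  have key : ∀ v : Vel, ENNReal.ofReal (Real.exp (inner ℝ k v)) *
      ENNReal.ofReal (Real.exp (-(1 / (4 * c) * ‖v - b‖ ^ 2))) =
      ENNReal.ofReal (Real.exp (inner ℝ b k + c * ‖k‖ ^ 2)) *
        ENNReal.ofReal (Real.exp (-(1 / (4 * c) * ‖v - (b + (2 * c) • k)‖ ^ 2))) := by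
    intro v
    rw [← ENNReal.ofReal_mul (Real.exp_pos _).le, ← ENNReal.ofReal_mul (Real.exp_pos _).le,
      ← Real.exp_add, ← Real.exp_add, ← sub_sub, norm_sub_sq_real (v - b), real_inner_smul_right,
      norm_smul, inner_sub_left, real_inner_comm k v, mul_pow, Real.norm_eq_abs, sq_abs]
    congr 2
    field_simp
    ring
  simp_rw [key]
  rw [lintegral_const_mul' _ _ ENNReal.ofReal_ne_top,
    lintegral_sub_right_eq_self
      (fun v : Vel => ENNReal.ofReal (Real.exp (-(1 / (4 * c) * ‖v‖ ^ 2)))),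
    ← ofReal_integral_eq_lintegral_ofReal (integrable_gaussian_vel hβ)
      (Filter.Eventually.of_forall fun _ => (Real.exp_pos _).le),
    integral_gaussian_vel hβ, ENNReal.ofReal_mul (Real.exp_pos _).le]

lemma lintegral_exp_Ioi {d : ℝ} (hd : d < 0) (I : ℝ) :
    ∫⁻ s in Ioi I, ENNReal.ofReal (Real.exp (d * s)) =
      ENNReal.ofReal (-Real.exp (d * I) / d) := by
  rw [← ofReal_integral_eq_lintegral_ofReal (integrableOn_exp_mul_Ioi hd I)
      (Filter.Eventually.of_forall fun _ => (Real.exp_pos _).le), integral_exp_mul_Ioi hd]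

section

variable {δ : ℝ} {f : Phase → ℝ}

/-- A rigid integrable density is the exponential of a quadratic polynomial, up to the power of
the internal energy. -/
lemma exists_quadratic_exponent (hδ : 2 ≤ δ) (hf : Measurable f)
    (hpos : ∀ᵐ x ∂phaseMeasure, 0 < f x) (hint : Integrable f phaseMeasure)
    (hr : IsRigid (pairDensity δ f)) :
    ∃ (C c d : ℝ) (b : Vel), 0 < C ∧ 0 < c ∧ d < 0 ∧ ∀ᵐ x ∂phaseMeasure,
      f x = C * x.2 ^ (δ / 2 - 1) *
        Real.exp (‖x.1‖ ^ 2 - 1 / (4 * c) * ‖x.1 - b‖ ^ 2 + d * x.2) := by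
  obtain ⟨a, b, c, d, hd, hL⟩ := exists_laplace_eq hδ hf hpos hint hr
  have hc := laplace_quadratic_pos hδ hf hpos hint hL
  set Z : ℝ := (Real.pi / (1 / (4 * c))) ^ (3 / 2 : ℝ) with hZ
  have hZpos : 0 < Z := by positivity
  -- `C` is fixed by matching transforms: the Gaussian contributes `Z`, and the integral over
  -- energies above I contributes -exp(d I) / d.
  set C : ℝ := -d * Real.exp a / Z with hC
  have hCpos : 0 < C := by
    have : 0 < -d := by linarith
    positivity
  set u : Phase → ENNReal := fun x => ENNReal.ofReal (Real.exp (-‖x.1‖ ^ 2)) * reduced δ f x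
    with hu
  set v : Phase → ENNReal := fun x => ENNReal.ofReal C *
    (ENNReal.ofReal (Real.exp (-(1 / (4 * c) * ‖x.1 - b‖ ^ 2))) *
      ENNReal.ofReal (Real.exp (d * x.2))) with hv
  have hum : Measurable u := by
    have h1 : Measurable fun x : Phase => ENNReal.ofReal (Real.exp (-‖x.1‖ ^ 2)) := by fun_prop
    exact h1.mul (measurable_reduced hf)
  have hvm : Measurable v := by rw [hv]; fun_prop
  have hLu : ∀ (k : Vel) (I : ℝ),
      ∫⁻ x in {x | I < x.2}, ENNReal.ofReal (Real.exp (inner ℝ k x.1)) * u x ∂phaseVolume =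
        laplace δ f k I := by
    intro k I
    refine lintegral_congr fun x => ?_
    rw [hu, ← mul_assoc, expWeight, ← ENNReal.ofReal_mul (Real.exp_pos _).le, ← Real.exp_add,
      ← sub_eq_add_neg]
  have hLv : ∀ (k : Vel) (I : ℝ),
      ∫⁻ x in {x | I < x.2}, ENNReal.ofReal (Real.exp (inner ℝ k x.1)) * v x ∂phaseVolume =
        ENNReal.ofReal (Real.exp (a + inner ℝ b k + c * ‖k‖ ^ 2 + d * I)) := by
    intro k I
    have hset : {x : Phase | I < x.2} = univ ×ˢ Ioi I := by ext; simp
    have hre : ∀ x : Phase, ENNReal.ofReal (Real.exp (inner ℝ k x.1)) * v x =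
        ENNReal.ofReal C * ((ENNReal.ofReal (Real.exp (inner ℝ k x.1)) *
          ENNReal.ofReal (Real.exp (-(1 / (4 * c) * ‖x.1 - b‖ ^ 2)))) *
          ENNReal.ofReal (Real.exp (d * x.2))) := fun x => by rw [hv]; ring
    have hm1 : Measurable fun w : Vel => ENNReal.ofReal (Real.exp (inner ℝ k w)) *
        ENNReal.ofReal (Real.exp (-(1 / (4 * c) * ‖w - b‖ ^ 2))) := by fun_prop
    have hm2 : Measurable fun s : ℝ => ENNReal.ofReal (Real.exp (d * s)) := by fun_prop
    simp_rw [hre]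
    rw [lintegral_const_mul' _ _ ENNReal.ofReal_ne_top, hset, phaseVolume,
      ← Measure.prod_restrict, Measure.restrict_univ,
      lintegral_prod_mul hm1.aemeasurable hm2.aemeasurable, lintegral_gaussian_tilted hc,
      lintegral_exp_Ioi hd, ← hZ, ← ENNReal.ofReal_mul (by positivity),
      ← ENNReal.ofReal_mul hCpos.le]
    congr 1
    rw [hC, show a + inner ℝ b k + c * ‖k‖ ^ 2 + d * I =
      a + ((inner ℝ b k + c * ‖k‖ ^ 2) + d * I) by ring, Real.exp_add a, Real.exp_add _ (d * I)]
    have := hd.ne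
    field_simp
  refine ⟨C, c, d, b, hCpos, hc, hd, ?_⟩
  -- Uniqueness applies above a positive energy threshold only, so (0, ∞) is exhausted by the
  -- thresholds 1/(N + 1).
  have hall : ∀ N : ℕ, ∀ᵐ x ∂phaseVolume, 1 / ((N : ℝ) + 1) < x.2 → u x = v x := by
    intro N
    have hN : (0 : ℝ) < 1 / ((N : ℝ) + 1) := by positivity
    refine ae_eq_of_laplace hum hvm (fun k I hI => ?_) fun k I hI => ?_
    · rw [hLu]; exact laplace_ne_top hδ hpos hint k (hN.trans_le hI)
    · rw [hLu, hLv, hL k I (hN.trans_le hI)]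
  rw [ae_phaseMeasure_iff]
  filter_upwards [ae_all_iff.2 hall, ae_phaseMeasure_iff.1 hpos] with x hx hfx hx0
  obtain ⟨N, hN⟩ := exists_nat_one_div_lt hx0
  have h1 := hx N hN
  have hfx := hfx hx0
  have hp := Real.rpow_pos_of_pos hx0 (δ / 2 - 1)
  simp only [hu, hv, reduced] at h1
  rw [← ENNReal.ofReal_mul (Real.exp_pos _).le, ← ENNReal.ofReal_mul (Real.exp_pos _).le,
    ← ENNReal.ofReal_mul hCpos.le, ENNReal.ofReal_eq_ofReal_iff (by positivity) (by positivity),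
    ← Real.exp_add] at h1
  have h2 : f x = Real.exp (‖x.1‖ ^ 2) * (Real.exp (-‖x.1‖ ^ 2) * (f x / x.2 ^ (δ / 2 - 1))) *
      x.2 ^ (δ / 2 - 1) := by
    rw [← mul_assoc, ← Real.exp_add]
    field_simp
    simp
  rw [h2, h1, show ‖x.1‖ ^ 2 - 1 / (4 * c) * ‖x.1 - b‖ ^ 2 + d * x.2 =
    ‖x.1‖ ^ 2 + (-(1 / (4 * c) * ‖x.1 - b‖ ^ 2) + d * x.2) by ring,
    Real.exp_add (‖x.1‖ ^ 2)]
  ring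

/-- The set and its reflection cover the space, which has infinite measure. -/
lemma velMeasure_halfSpace (b : Vel) : velMeasure {v | 0 ≤ inner ℝ b v} = ⊤ := by
  set H : Set Vel := {v | 0 ≤ inner ℝ b v} with hH
  have hu : H ∪ -H = univ := by
    ext v
    simp only [hH, mem_union, mem_neg, mem_ofPred_eq, inner_neg_right, mem_univ, iff_true]
    rcases le_total 0 (inner ℝ b v) with h | h
    · exact Or.inl h
    · exact Or.inr (by linarith)
  by_contra h
  have h1 : velMeasure (univ : Set Vel) < ⊤ := by
    rw [← hu]
    refine (measure_union_le _ _).trans_lt ?_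
    rw [Measure.measure_neg]
    exact ENNReal.add_lt_top.2 ⟨Ne.lt_top h, Ne.lt_top h⟩
  rw [measure_univ_of_isAddLeftInvariant] at h1
  exact lt_irrefl _ h1

/-- A rigid integrable density is a Maxwellian with two temperatures. -/
lemma exists_gaussian (hδ : 2 ≤ δ) (hf : Measurable f)
    (hpos : ∀ᵐ x ∂phaseMeasure, 0 < f x) (hint : Integrable f phaseMeasure)
    (hr : IsRigid (pairDensity δ f)) :
    ∃ (C α γ : ℝ) (u : Vel), 0 < C ∧ 0 < α ∧ 0 < γ ∧ ∀ᵐ x ∂phaseMeasure,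
      f x = C * x.2 ^ (δ / 2 - 1) * Real.exp (-(α * ‖x.1 - u‖ ^ 2) - γ * x.2) := by
  obtain ⟨C, c, d, b, hC, hc, hd, hfx⟩ := exists_quadratic_exponent hδ hf hpos hint hr
  -- Subtracting 1 undoes the weight exp(-|ξ|²).
  set α : ℝ := 1 / (4 * c) - 1 with hα
  have hcα : 1 / (4 * c) = α + 1 := by rw [hα]; ring
  have hαpos : 0 < α := by
    -- If α ≤ 0, then f is at least ε on the half-space b·ξ ≥ 0 times energies in (1, 2], a set of
    -- infinite measure, contrary to integrability.
    by_contra hneg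
    set ε : ℝ := C * Real.exp (-((α + 1) * ‖b‖ ^ 2) + d * 2) with hε
    have hεpos : 0 < ε := by positivity
    have hlt := hint.measure_ge_lt_top hεpos
    have hsub : velMeasure.prod volume ({v | 0 ≤ inner ℝ b v} ×ˢ Ioc (1 : ℝ) 2) ≤
        phaseMeasure {x | ε ≤ f x} := by
      rw [phaseMeasure_eq_restrict, Measure.restrict_apply₀' measurableSet_phase_pos.nullMeasurableSet]
      refine measure_mono_ae ?_
      filter_upwards [ae_phaseMeasure_iff.1 hfx] with x hx hxm
      obtain ⟨hx1, hx2, hx3⟩ := hxm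
      have hx0 : 0 < x.2 := lt_trans one_pos hx2
      refine ⟨?_, hx0⟩
      change ε ≤ f x
      rw [hx hx0, hε, mul_assoc]
      refine mul_le_mul_of_nonneg_left ?_ hC.le
      have hp : 1 ≤ x.2 ^ (δ / 2 - 1) := Real.one_le_rpow hx2.le (by linarith)
      refine le_trans ?_ (le_mul_of_one_le_left (Real.exp_pos _).le hp)
      refine Real.exp_le_exp.2 ?_
      have hx1 : 0 ≤ inner ℝ b x.1 := hx1
      have hc1 : 0 < α + 1 := by rw [← hcα]; positivity
      rw [hcα, norm_sub_sq_real, real_inner_comm b x.1]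
      have e1 : 0 ≤ (α + 1) * inner ℝ b x.1 := mul_nonneg hc1.le hx1
      have e2 : 0 ≤ -α * ‖x.1‖ ^ 2 := mul_nonneg (by linarith) (sq_nonneg _)
      have e3 : d * 2 ≤ d * x.2 := mul_le_mul_of_nonpos_left hx3 hd.le
      linarith
    rw [Measure.prod_prod, velMeasure_halfSpace, Real.volume_Ioc, ENNReal.top_mul (by norm_num)]
      at hsub
    exact absurd hlt (not_lt.2 hsub)
  -- Completing the square in |ξ|² - (α + 1)|ξ - b|² gives the centre (α + 1)/α · b and the
  -- remainder (1 + 1/α)|b|².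
  refine ⟨C * Real.exp ((1 + 1 / α) * ‖b‖ ^ 2), α, -d, ((α + 1) / α) • b, by positivity, hαpos,
    by linarith, ?_⟩
  filter_upwards [hfx] with x hx
  rw [hx, mul_right_comm C (Real.exp _), mul_assoc _ (Real.exp _), ← Real.exp_add]
  congr 2
  rw [hcα, norm_sub_sq_real, norm_sub_sq_real, real_inner_smul_right, norm_smul, mul_pow,
    Real.norm_eq_abs, sq_abs]
  field_simp
  ring

end

/-! ### Gibbs densities and the collision invariants -/

/-- At `x`, the density `f` has the form `C I^(δ/2-1) exp (-α |ξ - u|² - γ I)`. -/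
def IsGibbsAt (δ : ℝ) (f : Phase → ℝ) (C α γ : ℝ) (u : Vel) (x : Phase) : Prop :=
  0 < x.2 ∧ f x = C * x.2 ^ (δ / 2 - 1) * Real.exp (-(α * ‖x.1 - u‖ ^ 2) - γ * x.2)

section Gibbs

variable {δ : ℝ} {f : Phase → ℝ} {C α γ : ℝ} {u : Vel}

lemma IsGibbsAt.pairDensity_eq {x y : Phase} (hx : IsGibbsAt δ f C α γ u x)
    (hy : IsGibbsAt δ f C α γ u y) : pairDensity δ f x y =
      C ^ 2 * Real.exp (-(α * (‖x.1 - u‖ ^ 2 + ‖y.1 - u‖ ^ 2)) - γ * (x.2 + y.2)) := by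
  have h1 := Real.rpow_pos_of_pos hx.1 (δ / 2 - 1)
  have h2 := Real.rpow_pos_of_pos hy.1 (δ / 2 - 1)
  rw [pairDensity, hx.2, hy.2, Real.mul_rpow hx.1.le hy.1.le,
    show -(α * (‖x.1 - u‖ ^ 2 + ‖y.1 - u‖ ^ 2)) - γ * (x.2 + y.2) =
      (-(α * ‖x.1 - u‖ ^ 2) - γ * x.2) + (-(α * ‖y.1 - u‖ ^ 2) - γ * y.2) by ring, Real.exp_add]
  generalize x.2 ^ (δ / 2 - 1) = p at h1 ⊢
  generalize y.2 ^ (δ / 2 - 1) = r at h2 ⊢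
  field_simp

lemma gainLoss_eq_zero_iff_of_isGibbsAt (hC : 0 < C) {z : Phase × Phase × Phase × Phase}
    (h : IsGibbsAt δ f C α γ u z.1 ∧ IsGibbsAt δ f C α γ u z.2.1 ∧
      IsGibbsAt δ f C α γ u z.2.2.1 ∧ IsGibbsAt δ f C α γ u z.2.2.2) :
    gainLoss δ f f z = 0 ↔
      α * (‖z.2.2.1.1 - u‖ ^ 2 + ‖z.2.2.2.1 - u‖ ^ 2) + γ * (z.2.2.1.2 + z.2.2.2.2) =
        α * (‖z.1.1 - u‖ ^ 2 + ‖z.2.1.1 - u‖ ^ 2) + γ * (z.1.2 + z.2.1.2) := by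
  rw [gainLoss_eq_zero_iff, h.1.pairDensity_eq h.2.1, h.2.2.1.pairDensity_eq h.2.2.2,
    mul_right_inj' (by positivity), Real.exp_eq_exp]
  constructor <;> intro h <;> linarith

end Gibbs

/-- By the parallelogram law, kinetic energy splits into a part of the centre of mass, which is
unchanged, and one of the relative velocity. -/
lemma norm_sq_postPair (x y : Phase) (s : ℝ) (ω : Dir) (a b : ℝ) (u : Vel) :
    ‖(postPair x y s ω a b).1.1 - u‖ ^ 2 + ‖(postPair x y s ω a b).2.1 - u‖ ^ 2 =
      ‖x.1 - u‖ ^ 2 + ‖y.1 - u‖ ^ 2 + (s ^ 2 - ‖x.1 - y.1‖ ^ 2) / 2 := by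
  have par : ∀ v w : Vel, ‖v‖ ^ 2 + ‖w‖ ^ 2 = (‖v + w‖ ^ 2 + ‖v - w‖ ^ 2) / 2 := by
    intro v w
    rw [norm_add_sq_real, norm_sub_sq_real]; ring
  have hω : ‖(ω : Vel)‖ = 1 := mem_sphere_zero_iff_norm.1 ω.2
  rw [par, par (x.1 - u)]
  have e1 : (postPair x y s ω a b).1.1 - u + ((postPair x y s ω a b).2.1 - u) =
      x.1 - u + (y.1 - u) := by simp only [postPair]; module
  have e2 : (postPair x y s ω a b).1.1 - u - ((postPair x y s ω a b).2.1 - u) =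
      s • (ω : Vel) := by simp only [postPair]; module
  rw [e1, e2, sub_sub_sub_cancel_right, norm_smul, hω, mul_one, Real.norm_eq_abs, sq_abs]
  ring

lemma ae_energy_conservedS {m δ : ℝ} (hm : 0 < m) {σ : CrossSection}
    (hσ : IsCrossSectionS m δ σ) (u : Vel) :
    ∀ᵐ z ∂collisionMeasureS m δ σ,
      m / 2 * (‖z.2.2.1.1 - u‖ ^ 2 + ‖z.2.2.2.1 - u‖ ^ 2) + (z.2.2.1.2 + z.2.2.2.2) =
        m / 2 * (‖z.1.1 - u‖ ^ 2 + ‖z.2.1.1 - u‖ ^ 2) + (z.1.2 + z.2.1.2) := by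
  rw [collisionMeasureS_eq, (isFluxS hσ).ae_iff (measurableSet_eq_fun (by fun_prop) (by fun_prop))]
  refine Filter.Eventually.of_forall fun q hq => ?_
  have hs : 0 < postSpeedSq m q.1 q.2.1 q.2.2.1 q.2.2.2.1 := by
    by_contra h
    exact hq (by rw [densityS, if_neg h])
  dsimp only
  rw [postS, norm_sq_postPair, Real.sq_sqrt hs.le]
  simp only [postSpeedSq, postPair]
  field_simp
  ring

lemma ae_energies_conservedR {δ : ℝ} {σ : CrossSection} (hσ : IsCrossSectionR δ σ) (u : Vel) :
    ∀ᵐ z ∂collisionMeasureR δ σ,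
      ‖z.2.2.1.1 - u‖ ^ 2 + ‖z.2.2.2.1 - u‖ ^ 2 = ‖z.1.1 - u‖ ^ 2 + ‖z.2.1.1 - u‖ ^ 2 ∧
        z.2.2.1.2 + z.2.2.2.2 = z.1.2 + z.2.1.2 := by
  rw [collisionMeasureR_eq]
  refine Filter.Eventually.and ?_ ?_
  · rw [(isFluxR hσ).ae_iff (measurableSet_eq_fun (by fun_prop) (by fun_prop))]
    refine Filter.Eventually.of_forall fun q _ => ?_
    dsimp only
    rw [postR, norm_sq_postPair, sub_self, zero_div, add_zero]
  · rw [(isFluxR hσ).ae_iff (measurableSet_eq_fun (by fun_prop) (by fun_prop))]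
    refine Filter.Eventually.of_forall fun q _ => ?_
    simp [postR, postPair]

lemma phaseMeasure_prod_ne_zero {t : Set ℝ} (ht : energyMeasure t ≠ 0) :
    phaseMeasure (univ ×ˢ t) ≠ 0 := by
  rw [phaseMeasure, Measure.prod_prod]
  refine mul_ne_zero ?_ ht
  rw [Ne, Measure.measure_univ_eq_zero]
  exact NeZero.ne velMeasure

/-- Standard collisions exchange internal and kinetic energy. -/
lemma not_ae_internal_conservedS {m δ : ℝ} (hm : 0 < m) {σ : CrossSection}
    (hσ : IsCrossSectionS m δ σ) :
    ¬ ∀ᵐ z ∂collisionMeasureS m δ σ, z.2.2.1.2 + z.2.2.2.2 = z.1.2 + z.2.1.2 := by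
  intro h
  rw [collisionMeasureS_eq, (isFluxS hσ).ae_iff (measurableSet_eq_fun (by fun_prop) (by fun_prop))]
    at h
  have hI : energyMeasure (Ioi 1) ≠ 0 := by
    rw [Measure.restrict_apply measurableSet_Ioi,
      inter_eq_left.2 (Ioi_subset_Ioi zero_le_one), Real.volume_Ioi]
    exact ENNReal.top_ne_zero
  -- Collisions with incoming energies above 1 and outgoing energies below 1 are always possible and
  -- strictly lower the internal energy.
  have hset : phaseMeasure.prod (phaseMeasure.prod paramSMeasure)
      ((univ ×ˢ Ioi 1) ×ˢ ((univ ×ˢ Ioi 1) ×ˢ (Iio 1 ×ˢ (Iio 1 ×ˢ univ)))) ≠ 0 := by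
    rw [Measure.prod_prod, Measure.prod_prod, paramSMeasure, Measure.prod_prod, Measure.prod_prod]
    have h1 := energyMeasure_Iio_ne_zero one_pos
    exact mul_ne_zero (phaseMeasure_prod_ne_zero hI) (mul_ne_zero (phaseMeasure_prod_ne_zero hI)
      (mul_ne_zero h1 (mul_ne_zero h1 dirMeasure_univ_ne_zero)))
  obtain ⟨q, hq, h1, h2, h3⟩ := ((frequently_ae_mem_iff.2 hset).and_eventually
    (h.and (hσ.pos.and (ae_collision_nondegenerate paramSMeasure)))).exists
  obtain ⟨⟨-, hx⟩, ⟨-, hy⟩, ha, hb, -⟩ := hq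
  have hx : 1 < q.1.2 := hx
  have hy : 1 < q.2.1.2 := hy
  have ha : q.2.2.1 < 1 := ha
  have hb : q.2.2.2.1 < 1 := hb
  have hs : 0 < postSpeedSq m q.1 q.2.1 q.2.2.1 q.2.2.2.1 := by
    have : 0 < 4 / m * (q.1.2 + q.2.1.2 - q.2.2.1 - q.2.2.2.1) :=
      mul_pos (by positivity) (by linarith)
    simp only [postSpeedSq]
    nlinarith [sq_nonneg ‖q.1.1 - q.2.1.1‖]
  have hσq := h2 hs
  have hp := Real.rpow_pos_of_pos (mul_pos h3.1 h3.2.1) (δ / 2 - 1)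
  have hn := h3.2.2
  have := h1 (by
    rw [densityS, if_pos hs]
    simp only [ne_eq, ENNReal.ofReal_eq_zero, not_le]
    positivity)
  simp only [postS, postPair] at this
  linarith

section Conditions

variable {m δ : ℝ} {σ : CrossSection} {f : Phase → ℝ} {C α γ : ℝ} {u : Vel}

lemma ae_gainLoss_eq_zeroR (hσ : IsCrossSectionR δ σ) (hC : 0 < C)
    (h : ∀ᵐ x ∂phaseMeasure, IsGibbsAt δ f C α γ u x) :
    ∀ᵐ z ∂collisionMeasureR δ σ, gainLoss δ f f z = 0 := by
  filter_upwards [ae_energies_conservedR hσ u, ae_collision (measurePreserving_revertR hσ)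
    (measurePreserving_relabelR hσ) (isFluxR hσ).quasiMeasurePreserving_fst h] with z hz hg
  rw [gainLoss_eq_zero_iff_of_isGibbsAt hC hg, hz.1, hz.2]

lemma ae_gainLoss_eq_zeroS (hm : 0 < m) (hσ : IsCrossSectionS m δ σ) (hC : 0 < C)
    (hα : α = γ * (m / 2)) (h : ∀ᵐ x ∂phaseMeasure, IsGibbsAt δ f C α γ u x) :
    ∀ᵐ z ∂collisionMeasureS m δ σ, gainLoss δ f f z = 0 := by
  filter_upwards [ae_energy_conservedS hm hσ u, ae_collision (measurePreserving_revertS hm hσ)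
    (measurePreserving_relabelS hm hσ) (isFluxS hσ).quasiMeasurePreserving_fst h] with z hz hg
  rw [gainLoss_eq_zero_iff_of_isGibbsAt hC hg, hα, mul_assoc, mul_assoc, ← mul_add, ← mul_add, hz]

/-- Eliminating kinetic energy between total energy conservation and conservation of the exponent
leaves (α - γ m/2) ΔI = 0, and ΔI is not almost everywhere zero. -/
lemma temperatures_eq_of_ae_gainLoss_eq_zeroS (hm : 0 < m) (hσ : IsCrossSectionS m δ σ)
    (hC : 0 < C) (h : ∀ᵐ x ∂phaseMeasure, IsGibbsAt δ f C α γ u x)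
    (h0 : ∀ᵐ z ∂collisionMeasureS m δ σ, gainLoss δ f f z = 0) : α = γ * (m / 2) := by
  by_contra hne
  refine not_ae_internal_conservedS hm hσ ?_
  filter_upwards [ae_energy_conservedS hm hσ u, ae_collision (measurePreserving_revertS hm hσ)
    (measurePreserving_relabelS hm hσ) (isFluxS hσ).quasiMeasurePreserving_fst h, h0] with z hz hg h0
  rw [gainLoss_eq_zero_iff_of_isGibbsAt hC hg] at h0
  have : (α - γ * (m / 2)) * ((z.2.2.1.2 + z.2.2.2.2) - (z.1.2 + z.2.1.2)) = 0 := by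
    linear_combination α * hz - m / 2 * h0
  rcases mul_eq_zero.1 this with h | h
  · exact absurd (sub_eq_zero.1 h) hne
  · exact sub_eq_zero.1 h

end Conditions

/-! ### Maxwellians are Gibbs densities -/

lemma maxwellianS_eq {m kB T : ℝ} (hkB : 0 < kB) (hT : 0 < T) (δ n : ℝ) (u : Vel) :
    maxwellianS m kB δ n u T = maxwellianR m kB δ n u T T := by
  funext x
  rw [maxwellianS, maxwellianR]
  congr 2
  field_simp
  ring

/-- The normalization constant of the Maxwellian. -/
def maxwellianNorm (m kB δ Ttr Tint : ℝ) : ℝ :=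
  (2 * Real.pi * kB * Ttr / m) ^ (3 / 2 : ℝ) * (kB * Tint) ^ (δ / 2) * Real.Gamma (δ / 2)

section Maxwellian

variable {m kB δ n Ttr Tint : ℝ}

lemma maxwellianNorm_pos (hm : 0 < m) (hkB : 0 < kB) (hδ : 2 ≤ δ) (hTtr : 0 < Ttr)
    (hTint : 0 < Tint) : 0 < maxwellianNorm m kB δ Ttr Tint := by
  have := Real.Gamma_pos_of_pos (show 0 < δ / 2 by linarith)
  unfold maxwellianNorm
  positivity

lemma maxwellianR_eq (m kB δ n : ℝ) (u : Vel) (Ttr Tint : ℝ) (x : Phase) :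
    maxwellianR m kB δ n u Ttr Tint x = n / maxwellianNorm m kB δ Ttr Tint *
      x.2 ^ (δ / 2 - 1) * Real.exp (-(m / (2 * kB * Ttr) * ‖x.1 - u‖ ^ 2) - 1 / (kB * Tint) * x.2) := by
  rw [maxwellianR, ← maxwellianNorm, mul_div_right_comm, mul_div_right_comm, one_div,
    inv_mul_eq_div]

lemma ae_phase_energy_pos : ∀ᵐ x ∂phaseMeasure, 0 < x.2 :=
  Measure.quasiMeasurePreserving_snd.ae (ae_restrict_mem measurableSet_Ioi)

lemma ae_isGibbsAt {f : Phase → ℝ} {u : Vel}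
    (h : f =ᵐ[phaseMeasure] maxwellianR m kB δ n u Ttr Tint) :
    ∀ᵐ x ∂phaseMeasure, IsGibbsAt δ f (n / maxwellianNorm m kB δ Ttr Tint)
      (m / (2 * kB * Ttr)) (1 / (kB * Tint)) u x := by
  filter_upwards [h, ae_phase_energy_pos] with x hx hx0
  exact ⟨hx0, by rw [hx, maxwellianR_eq]⟩

lemma maxwellianR_ae_eq {f : Phase → ℝ} {C α γ : ℝ} {u : Vel} (hm : 0 < m) (hkB : 0 < kB)
    (hδ : 2 ≤ δ) (hα : 0 < α) (hγ : 0 < γ)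
    (h : ∀ᵐ x ∂phaseMeasure, IsGibbsAt δ f C α γ u x) :
    f =ᵐ[phaseMeasure] maxwellianR m kB δ
      (C * maxwellianNorm m kB δ (m / (2 * kB * α)) (1 / (kB * γ))) u
      (m / (2 * kB * α)) (1 / (kB * γ)) := by
  have := maxwellianNorm_pos (Ttr := m / (2 * kB * α)) (Tint := 1 / (kB * γ)) hm hkB hδ
    (by positivity) (by positivity)
  filter_upwards [h] with x hx
  rw [hx.2, maxwellianR_eq, mul_div_cancel_right₀ _ this.ne']
  congr 4 <;> field_simp

end Maxwellian

/-! ### The mixed collision measure -/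

section Mixed

variable {m kB δ θ : ℝ} {σs σr : CrossSection} {f : Phase → ℝ}

lemma measurePreserving_collisionMeasure
    {T : Phase × Phase × Phase × Phase → Phase × Phase × Phase × Phase}
    (hS : MeasurePreserving T (collisionMeasureS m δ σs) (collisionMeasureS m δ σs))
    (hR : MeasurePreserving T (collisionMeasureR δ σr) (collisionMeasureR δ σr)) :
    MeasurePreserving T (collisionMeasure m δ θ σs σr) (collisionMeasure m δ θ σs σr) := by
  refine ⟨hS.measurable, ?_⟩
  rw [collisionMeasure, Measure.map_add _ _ hS.measurable, Measure.map_smul, Measure.map_smul,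
    hS.map_eq, hR.map_eq]

lemma ae_collisionMeasure {P : Phase × Phase × Phase × Phase → Prop}
    (hS : θ ≠ 0 → ∀ᵐ z ∂collisionMeasureS m δ σs, P z)
    (hR : ∀ᵐ z ∂collisionMeasureR δ σr, P z) :
    ∀ᵐ z ∂collisionMeasure m δ θ σs σr, P z := by
  rw [collisionMeasure, ae_add_measure_iff]
  refine ⟨?_, Measure.ae_smul_measure hR _⟩
  rcases eq_or_ne θ 0 with rfl | h
  · simp
  · exact Measure.ae_smul_measure (hS h) _

lemma quasiMeasurePreserving_fst_collisionMeasure (hσs : IsCrossSectionS m δ σs)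
    (hσr : IsCrossSectionR δ σr) :
    Measure.QuasiMeasurePreserving Prod.fst (collisionMeasure m δ θ σs σr) phaseMeasure := by
  refine ⟨measurable_fst, Measure.AbsolutelyContinuous.mk fun s hs h0 => ?_⟩
  rw [Measure.map_apply measurable_fst hs, measure_eq_zero_iff_ae_notMem]
  have h0 : ∀ᵐ x ∂phaseMeasure, x ∉ s := measure_eq_zero_iff_ae_notMem.1 h0
  exact ae_collisionMeasure (fun _ => (isFluxS hσs).quasiMeasurePreserving_fst.ae h0)
    ((isFluxR hσr).quasiMeasurePreserving_fst.ae h0)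

lemma ae_collisionMeasureS_of_ae {P : Phase × Phase × Phase × Phase → Prop} (hθ : 0 < θ)
    (h : ∀ᵐ z ∂collisionMeasure m δ θ σs σr, P z) : ∀ᵐ z ∂collisionMeasureS m δ σs, P z := by
  rw [collisionMeasure, ae_add_measure_iff] at h
  exact (Measure.ae_ennreal_smul_measure_iff (by simpa using hθ)).1 h.1

lemma ae_collisionMeasureR_of_ae {P : Phase × Phase × Phase × Phase → Prop} (hθ : θ < 1)
    (h : ∀ᵐ z ∂collisionMeasure m δ θ σs σr, P z) : ∀ᵐ z ∂collisionMeasureR δ σr, P z := by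
  rw [collisionMeasure, ae_add_measure_iff] at h
  exact (Measure.ae_ennreal_smul_measure_iff (by simpa using hθ)).1 h.2

/-- If gain and loss balance at almost every collision, then `Q_θ (f, f)` vanishes. -/
lemma collisionOp_ae_eq_zero (hσs : IsCrossSectionS m δ σs) (hσr : IsCrossSectionR δ σr)
    (hf : Measurable f) (hθ : 0 ≤ θ) (hθ_one : θ ≤ 1)
    (h : ∀ᵐ z ∂collisionMeasure m δ θ σs σr, gainLoss δ f f z = 0) :
    ∀ᵐ x ∂phaseMeasure, collisionOp m δ θ σs σr f f x = 0 := by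
  have hms := measurableSet_gainLoss_eq_zero (δ := δ) hf
  have hS : ∀ᵐ x ∂phaseMeasure, ∀ᵐ z ∂(ENNReal.ofReal θ • transitionS m δ σs x),
      gainLoss δ f f (x, z) = 0 := by
    rcases hθ.eq_or_lt with rfl | h0
    · simp
    · filter_upwards [(isFluxS hσs).ae_transition hms (ae_collisionMeasureS_of_ae h0 h)] with x hx
      exact Measure.ae_smul_measure hx _
  have hR : ∀ᵐ x ∂phaseMeasure, ∀ᵐ z ∂(ENNReal.ofReal (1 - θ) • transitionR δ σr x),
      gainLoss δ f f (x, z) = 0 := by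
    rcases hθ_one.eq_or_lt with rfl | h1
    · simp
    · filter_upwards [(isFluxR hσr).ae_transition hms (ae_collisionMeasureR_of_ae h1 h)] with x hx
      exact Measure.ae_smul_measure hx _
  filter_upwards [hS, hR] with x h1 h2
  rw [collisionOp, integral_eq_zero_of_ae, mul_zero]
  rw [transition]
  exact ae_add_measure_iff.2 ⟨h1, h2⟩

lemma entropyProduction_eq_zero_of_collisionOp
    (h : ∀ᵐ x ∂phaseMeasure, collisionOp m δ θ σs σr f f x = 0) :
    entropyProduction m δ θ σs σr f = 0 := by
  rw [entropyProduction, pairing]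
  refine integral_eq_zero_of_ae ?_
  filter_upwards [h] with x hx
  simp [hx]

/-- The entropy inequality, with equality exactly in the case of detailed balance. -/
lemma entropyProduction_nonpos (hm : 0 < m) (hσs : IsCrossSectionS m δ σs)
    (hσr : IsCrossSectionR δ σr) (hf : Measurable f) (hpos : ∀ᵐ x ∂phaseMeasure, 0 < f x)
    (hw : IsWellDefined m δ θ σs σr f) :
    entropyProduction m δ θ σs σr f ≤ 0 ∧ (entropyProduction m δ θ σs σr f = 0 ↔
      ∀ᵐ z ∂collisionMeasure m δ θ σs σr, gainLoss δ f f z = 0) := by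
  obtain ⟨h1, h2⟩ := entropy_inequality hf hpos
    (measurePreserving_collisionMeasure (θ := θ) (measurePreserving_revertS hm hσs)
      (measurePreserving_revertR hσr))
    (measurePreserving_collisionMeasure (measurePreserving_relabelS hm hσs)
      (measurePreserving_relabelR hσr))
    (quasiMeasurePreserving_fst_collisionMeasure hσs hσr) hw.weak
  rw [entropyProduction_eq hσs hσr hf hw, ← h2]
  refine ⟨by linarith, ?_⟩
  constructor <;> intro h <;> linarith

/-- Equality for `θ ≠ 0`: detailed balance holds exactly for one-temperature Maxwellians. -/
lemma ae_gainLoss_eq_zero_iff_isMaxwellianS (hm : 0 < m) (hkB : 0 < kB) (hδ : 2 ≤ δ)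
    (hθ : 0 < θ) (hσs : IsCrossSectionS m δ σs) (hσr : IsCrossSectionR δ σr) (hf : Measurable f)
    (hpos : ∀ᵐ x ∂phaseMeasure, 0 < f x) (hint : Integrable f phaseMeasure) :
    (∀ᵐ z ∂collisionMeasure m δ θ σs σr, gainLoss δ f f z = 0) ↔ IsMaxwellianS m kB δ f := by
  constructor
  · intro h
    have hS := ae_collisionMeasureS_of_ae hθ h
    obtain ⟨C, α, γ, u, hC, hα, hγ, hfx⟩ :=
      exists_gaussian hδ hf hpos hint (isRigidS hm hσs hf hS)
    have hg : ∀ᵐ x ∂phaseMeasure, IsGibbsAt δ f C α γ u x := ae_phase_energy_pos.and hfx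
    have hαγ := temperatures_eq_of_ae_gainLoss_eq_zeroS hm hσs hC hg hS
    have hT : m / (2 * kB * α) = 1 / (kB * γ) := by rw [hαγ]; field_simp
    have hN := maxwellianNorm_pos (Ttr := m / (2 * kB * α)) (Tint := 1 / (kB * γ)) hm hkB hδ
      (by positivity) (by positivity)
    refine ⟨_, u, 1 / (kB * γ), mul_pos hC hN, by positivity, ?_⟩
    rw [maxwellianS_eq hkB (by positivity)]
    have := maxwellianR_ae_eq hm hkB hδ hα hγ hg
    rwa [hT] at this ⊢
  · rintro ⟨n, u, T, hn, hT, h⟩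
    rw [maxwellianS_eq hkB hT] at h
    have hg := ae_isGibbsAt h
    have hC := div_pos hn (maxwellianNorm_pos hm hkB hδ hT hT)
    -- Resonant collisions conserve both energies separately, so they impose no further condition.
    refine ae_collisionMeasure (fun _ => ae_gainLoss_eq_zeroS hm hσs hC ?_ hg)
      (ae_gainLoss_eq_zeroR hσr hC hg)
    field_simp

/-- Equality for `θ = 0`: detailed balance holds exactly for two-temperature Maxwellians. -/
lemma ae_gainLoss_eq_zero_iff_isMaxwellianR (hm : 0 < m) (hkB : 0 < kB) (hδ : 2 ≤ δ)
    (hσr : IsCrossSectionR δ σr) (hf : Measurable f)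
    (hpos : ∀ᵐ x ∂phaseMeasure, 0 < f x) (hint : Integrable f phaseMeasure) :
    (∀ᵐ z ∂collisionMeasure m δ 0 σs σr, gainLoss δ f f z = 0) ↔ IsMaxwellianR m kB δ f := by
  constructor
  · intro h
    have hR := ae_collisionMeasureR_of_ae one_pos h
    obtain ⟨C, α, γ, u, hC, hα, hγ, hfx⟩ :=
      exists_gaussian hδ hf hpos hint (isRigidR hσr hf hR)
    have hg : ∀ᵐ x ∂phaseMeasure, IsGibbsAt δ f C α γ u x := ae_phase_energy_pos.and hfx
    have hN := maxwellianNorm_pos (Ttr := m / (2 * kB * α)) (Tint := 1 / (kB * γ)) hm hkB hδ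
      (by positivity) (by positivity)
    exact ⟨_, u, _, _, mul_pos hC hN, by positivity, by positivity,
      maxwellianR_ae_eq hm hkB hδ hα hγ hg⟩
  · rintro ⟨n, u, Ttr, Tint, hn, hTtr, hTint, h⟩
    exact ae_collisionMeasure (fun h => absurd rfl h)
      (ae_gainLoss_eq_zeroR hσr (div_pos hn (maxwellianNorm_pos hm hkB hδ hTtr hTint))
        (ae_isGibbsAt h))

lemma tfae_of_iff {P : Prop} (hm : 0 < m) (hσs : IsCrossSectionS m δ σs)
    (hσr : IsCrossSectionR δ σr) (hf : Measurable f) (hpos : ∀ᵐ x ∂phaseMeasure, 0 < f x)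
    (hθ : 0 ≤ θ) (hθ_one : θ ≤ 1) (hw : IsWellDefined m δ θ σs σr f)
    (hP : (∀ᵐ z ∂collisionMeasure m δ θ σs σr, gainLoss δ f f z = 0) ↔ P) :
    List.TFAE [entropyProduction m δ θ σs σr f = 0,
      ∀ᵐ x ∂phaseMeasure, collisionOp m δ θ σs σr f f x = 0, P] := by
  have h := (entropyProduction_nonpos hm hσs hσr hf hpos hw).2
  tfae_have 1 ↔ 3 := h.trans hP
  tfae_have 1 → 2 := fun h1 => collisionOp_ae_eq_zero hσs hσr hf hθ hθ_one (h.1 h1)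
  tfae_have 2 → 1 := entropyProduction_eq_zero_of_collisionOp
  tfae_finish

end Mixed

/-! ### Moments of the Maxwellians -/

lemma integrable_norm_sq_mul_gaussian {β : ℝ} (hβ : 0 < β) :
    Integrable (fun v => ‖v‖ ^ 2 * Real.exp (-(β * ‖v‖ ^ 2))) velMeasure := by
  refine ((integrable_gaussian_vel (half_pos hβ)).const_mul (2 / β)).mono'
    (by fun_prop) (Filter.Eventually.of_forall fun v => ?_)
  -- The factor ‖v‖² is absorbed by half of the Gaussian exponent.
  have h1 : β / 2 * ‖v‖ ^ 2 ≤ Real.exp (β / 2 * ‖v‖ ^ 2) :=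
    (by linarith : β / 2 * ‖v‖ ^ 2 ≤ β / 2 * ‖v‖ ^ 2 + 1).trans (Real.add_one_le_exp _)
  have h2 : ‖v‖ ^ 2 ≤ 2 / β * Real.exp (β / 2 * ‖v‖ ^ 2) := by
    rw [div_mul_eq_mul_div, le_div_iff₀ hβ]
    linarith
  rw [Real.norm_eq_abs, abs_of_nonneg (by positivity)]
  refine (mul_le_mul_of_nonneg_right h2 (Real.exp_pos _).le).trans_eq ?_
  rw [mul_assoc, ← Real.exp_add]
  congr 2
  ring

/-- In polar coordinates the surface factor cancels, and the ratio of the radial integrals of y⁴ and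
y² comes from Γ(5/2) = 3/2 · Γ(3/2). -/
lemma integral_norm_sq_mul_gaussian {β : ℝ} (hβ : 0 < β) :
    ∫ v, ‖v‖ ^ 2 * Real.exp (-(β * ‖v‖ ^ 2)) ∂velMeasure =
      3 / (2 * β) * ∫ v, Real.exp (-(β * ‖v‖ ^ 2)) ∂velMeasure := by
  have hradial : ∀ q : ℝ, -1 < q → ∫ y in Ioi (0 : ℝ), y ^ q * Real.exp (-β * y ^ (2 : ℝ)) =
      β ^ (-(q + 1) / 2) * (1 / 2) * Real.Gamma ((q + 1) / 2) := fun q hq =>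
    integral_rpow_mul_exp_neg_mul_rpow two_pos hq hβ
  have e1 := integral_fun_norm_addHaar velMeasure (fun y => y ^ 2 * Real.exp (-(β * y ^ 2)))
  have e2 := integral_fun_norm_addHaar velMeasure (fun y => Real.exp (-(β * y ^ 2)))
  rw [e1, e2]
  have h4 : ∫ y in Ioi (0 : ℝ), y ^ (Module.finrank ℝ Vel - 1) • (y ^ 2 * Real.exp (-(β * y ^ 2))) =
      β ^ (-(4 + 1) / 2 : ℝ) * (1 / 2) * Real.Gamma ((4 + 1) / 2) := by
    rw [← hradial 4 (by norm_num)]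
    refine integral_congr_ae (Filter.Eventually.of_forall fun y => ?_)
    simp only [finrank_euclideanSpace_fin, smul_eq_mul]
    norm_cast
    rw [neg_mul]
    ring
  have h2 : ∫ y in Ioi (0 : ℝ), y ^ (Module.finrank ℝ Vel - 1) • Real.exp (-(β * y ^ 2)) =
      β ^ (-(2 + 1) / 2 : ℝ) * (1 / 2) * Real.Gamma ((2 + 1) / 2) := by
    rw [← hradial 2 (by norm_num)]
    refine integral_congr_ae (Filter.Eventually.of_forall fun y => ?_)
    simp only [finrank_euclideanSpace_fin, smul_eq_mul]
    norm_cast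
    rw [neg_mul]
  have hΓ : Real.Gamma ((4 + 1) / 2) = 3 / 2 * Real.Gamma ((2 + 1) / 2) := by
    rw [show ((4 : ℝ) + 1) / 2 = (2 + 1) / 2 + 1 by norm_num, Real.Gamma_add_one (by norm_num)]
    norm_num
  have hβp : β ^ (-(4 + 1) / 2 : ℝ) = β ^ (-(2 + 1) / 2 : ℝ) / β := by
    rw [show (-(4 + 1) / 2 : ℝ) = -(2 + 1) / 2 - 1 by norm_num, Real.rpow_sub_one hβ.ne']
  rw [h4, h2, hΓ, hβp]
  simp only [nsmul_eq_mul, smul_eq_mul]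
  field_simp

lemma integrable_coord_mul_gaussian {β : ℝ} (hβ : 0 < β) (i : Fin 3) :
    Integrable (fun v : Vel => v i * Real.exp (-(β * ‖v‖ ^ 2))) velMeasure := by
  refine ((integrable_gaussian_vel hβ).add (integrable_norm_sq_mul_gaussian hβ)).mono'
    (by fun_prop) (Filter.Eventually.of_forall fun v => ?_)
  have h1 : |v i| ≤ ‖v‖ := PiLp.norm_apply_le v i
  rw [norm_mul, Real.norm_eq_abs, Real.norm_eq_abs, Real.abs_exp, Pi.add_apply]
  have : |v i| ≤ 1 + ‖v‖ ^ 2 := by nlinarith [sq_nonneg (‖v‖ - 1)]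
  nlinarith [Real.exp_pos (-(β * ‖v‖ ^ 2))]

lemma integral_coord_mul_gaussian (β : ℝ) (i : Fin 3) :
    ∫ v : Vel, v i * Real.exp (-(β * ‖v‖ ^ 2)) ∂velMeasure = 0 := by
  have h := integral_neg_eq_self (fun v : Vel => v i * Real.exp (-(β * ‖v‖ ^ 2))) velMeasure
  simp only [PiLp.neg_apply, norm_neg, neg_mul, integral_neg] at h
  linarith

section Shifted

variable {β : ℝ} (u : Vel)

lemma integrable_gaussian_shifted (hβ : 0 < β) :
    Integrable (fun v => Real.exp (-(β * ‖v - u‖ ^ 2))) velMeasure :=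
  (integrable_gaussian_vel hβ).comp_sub_right u

lemma integral_gaussian_shifted (hβ : 0 < β) :
    ∫ v, Real.exp (-(β * ‖v - u‖ ^ 2)) ∂velMeasure = (Real.pi / β) ^ (3 / 2 : ℝ) :=
  (integral_sub_right_eq_self (fun v : Vel => Real.exp (-(β * ‖v‖ ^ 2))) u).trans
    (integral_gaussian_vel hβ)

lemma integral_norm_sq_mul_gaussian_shifted (hβ : 0 < β) :
    ∫ v, ‖v - u‖ ^ 2 * Real.exp (-(β * ‖v - u‖ ^ 2)) ∂velMeasure =
      3 / (2 * β) * (Real.pi / β) ^ (3 / 2 : ℝ) := by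
  rw [← integral_gaussian_vel hβ, ← integral_norm_sq_mul_gaussian hβ]
  exact integral_sub_right_eq_self (fun v : Vel => ‖v‖ ^ 2 * Real.exp (-(β * ‖v‖ ^ 2))) u

lemma integrable_norm_sq_mul_gaussian_shifted (hβ : 0 < β) :
    Integrable (fun v => ‖v‖ ^ 2 * Real.exp (-(β * ‖v - u‖ ^ 2))) velMeasure := by
  have h1 : Integrable (fun v => ‖v - u‖ ^ 2 * Real.exp (-(β * ‖v - u‖ ^ 2))) velMeasure :=
    (integrable_norm_sq_mul_gaussian hβ).comp_sub_right u
  refine ((h1.const_mul 2).add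
    ((integrable_gaussian_shifted u hβ).const_mul (2 * ‖u‖ ^ 2))).mono' (by fun_prop)
    (Filter.Eventually.of_forall fun v => ?_)
  rw [Real.norm_eq_abs, abs_of_nonneg (by positivity), Pi.add_apply, ← mul_assoc, ← add_mul]
  refine mul_le_mul_of_nonneg_right ?_ (Real.exp_pos _).le
  have : ‖v‖ ≤ ‖v - u‖ + ‖u‖ := by simpa using norm_add_le (v - u) u
  nlinarith [sq_nonneg (‖v - u‖ - ‖u‖), norm_nonneg v, norm_nonneg (v - u), norm_nonneg u]

lemma integral_coord_mul_gaussian_shifted (hβ : 0 < β) (i : Fin 3) :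
    ∫ v : Vel, v i * Real.exp (-(β * ‖v - u‖ ^ 2)) ∂velMeasure =
      u i * (Real.pi / β) ^ (3 / 2 : ℝ) := by
  have h := integral_sub_right_eq_self (μ := velMeasure)
    (fun v : Vel => v i * Real.exp (-(β * ‖v‖ ^ 2)) + u i * Real.exp (-(β * ‖v‖ ^ 2))) u
  rw [integral_add (integrable_coord_mul_gaussian hβ i)
    ((integrable_gaussian_vel hβ).const_mul _), integral_coord_mul_gaussian, zero_add,
    integral_const_mul, integral_gaussian_vel hβ] at h
  rw [← h]
  refine integral_congr_ae (Filter.Eventually.of_forall fun v => ?_)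
  simp only [PiLp.sub_apply]
  ring

end Shifted

section Energy

variable {δ γ : ℝ}

lemma integral_energy (hδ : 0 < δ) (hγ : 0 < γ) :
    ∫ s, s ^ (δ / 2 - 1) * Real.exp (-(γ * s)) ∂energyMeasure =
      (1 / γ) ^ (δ / 2) * Real.Gamma (δ / 2) :=
  Real.integral_rpow_mul_exp_neg_mul_Ioi (half_pos hδ) hγ

lemma integral_energy_mul (hδ : 0 < δ) (hγ : 0 < γ) :
    ∫ s, s * (s ^ (δ / 2 - 1) * Real.exp (-(γ * s))) ∂energyMeasure =
      δ / (2 * γ) * ((1 / γ) ^ (δ / 2) * Real.Gamma (δ / 2)) := by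
  have h := Real.integral_rpow_mul_exp_neg_mul_Ioi (a := δ / 2 + 1) (by positivity) hγ
  have e : ∫ s, s * (s ^ (δ / 2 - 1) * Real.exp (-(γ * s))) ∂energyMeasure =
      ∫ s in Ioi (0 : ℝ), s ^ (δ / 2 + 1 - 1) * Real.exp (-(γ * s)) := by
    refine setIntegral_congr_fun measurableSet_Ioi fun s hs => ?_
    have hs : 0 < s := hs
    rw [show δ / 2 + 1 - 1 = (δ / 2 - 1) + 1 by ring, Real.rpow_add_one hs.ne']
    ring
  rw [e, h, Real.Gamma_add_one (by positivity), Real.rpow_add_one (by positivity)]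
  field_simp

lemma integrable_energy (hδ : 0 < δ) (hγ : 0 < γ) :
    Integrable (fun s => s ^ (δ / 2 - 1) * Real.exp (-(γ * s))) energyMeasure := by
  refine not_imp_comm.1 integral_undef ?_
  rw [integral_energy hδ hγ]
  have := Real.Gamma_pos_of_pos (half_pos hδ)
  positivity

lemma integrable_energy_mul (hδ : 0 < δ) (hγ : 0 < γ) :
    Integrable (fun s => s * (s ^ (δ / 2 - 1) * Real.exp (-(γ * s)))) energyMeasure := by
  refine not_imp_comm.1 integral_undef ?_
  rw [integral_energy_mul hδ hγ]
  have := Real.Gamma_pos_of_pos (half_pos hδ)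
  positivity

end Energy

lemma maxwellianNorm_eq {m kB δ Ttr Tint : ℝ} (hm : 0 < m) (hkB : 0 < kB) (hTtr : 0 < Ttr) :
    maxwellianNorm m kB δ Ttr Tint = (Real.pi / (m / (2 * kB * Ttr))) ^ (3 / 2 : ℝ) *
      ((1 / (1 / (kB * Tint))) ^ (δ / 2) * Real.Gamma (δ / 2)) := by
  rw [maxwellianNorm, one_div_one_div, ← mul_assoc]
  congr 3
  field_simp

lemma phaseMeasure_eq_prod : phaseMeasure = velMeasure.prod energyMeasure := rfl

/-- The parameters of the two-temperature Maxwellian are its macroscopic quantities. -/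
lemma hasMoments_maxwellianR {m kB δ n : ℝ} (hm : 0 < m) (hkB : 0 < kB) (hδ : 2 ≤ δ) (hn : 0 < n)
    (u : Vel) {Ttr Tint : ℝ} (hTtr : 0 < Ttr) (hTint : 0 < Tint) :
    HasMoments m kB δ (maxwellianR m kB δ n u Ttr Tint) n u Ttr Tint := by
  have hδ0 : 0 < δ := by linarith
  set β : ℝ := m / (2 * kB * Ttr) with hβ
  set γ : ℝ := 1 / (kB * Tint) with hγ
  have hβ0 : 0 < β := by positivity
  have hγ0 : 0 < γ := by positivity
  set Z : ℝ := (Real.pi / β) ^ (3 / 2 : ℝ) with hZ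
  set E : ℝ := (1 / γ) ^ (δ / 2) * Real.Gamma (δ / 2) with hE
  have hZ0 : 0 < Z := by positivity
  have hE0 : 0 < E := mul_pos (by positivity) (Real.Gamma_pos_of_pos (half_pos hδ0))
  set a : Vel → ℝ := fun v => Real.exp (-(β * ‖v - u‖ ^ 2)) with ha
  set b : ℝ → ℝ := fun s => s ^ (δ / 2 - 1) * Real.exp (-(γ * s)) with hb
  have hM : maxwellianR m kB δ n u Ttr Tint = fun x => n / (Z * E) * (a x.1 * b x.2) := by
    funext x
    rw [maxwellianR_eq, maxwellianNorm_eq hm hkB hTtr, sub_eq_add_neg (-(_ * _)), Real.exp_add]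
    simp only [ha, hb]
    ring
  have ia : Integrable a velMeasure := integrable_gaussian_shifted u hβ0
  have ib : Integrable b energyMeasure := integrable_energy hδ0 hγ0
  -- The factorization needs no integrability of `w` or `r`, so one identity serves all moments.
  have hint : ∀ (w : Vel → ℝ) (r : ℝ → ℝ),
      ∫ x : Phase, w x.1 * r x.2 * (n / (Z * E) * (a x.1 * b x.2)) ∂phaseMeasure =
        n / (Z * E) * ((∫ v, w v * a v ∂velMeasure) * ∫ s, r s * b s ∂energyMeasure) := by
    intro w r
    rw [phaseMeasure_eq_prod, ← integral_prod_mul, ← integral_const_mul]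
    refine integral_congr_ae (Filter.Eventually.of_forall fun x => ?_)
    simp only
    ring
  have h00 := hint (fun _ => 1) (fun _ => 1)
  have h20 := hint (fun v => m / 2 * ‖v - u‖ ^ 2) (fun _ => 1)
  have h01 := hint (fun _ => 1) (fun s => s)
  have h10 := fun i => hint (fun v => v i) (fun _ => 1)
  simp only [one_mul, mul_one] at h00 h20 h01 h10
  have va : ∫ v, a v ∂velMeasure = Z := integral_gaussian_shifted u hβ0
  have va1 : ∀ i, ∫ v : Vel, v i * a v ∂velMeasure = u i * Z :=
    integral_coord_mul_gaussian_shifted u hβ0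
  have va2 : ∫ v : Vel, m / 2 * ‖v - u‖ ^ 2 * a v ∂velMeasure = m / 2 * (3 / (2 * β) * Z) := by
    simp only [mul_assoc]
    rw [integral_const_mul]
    congr 1
    exact integral_norm_sq_mul_gaussian_shifted u hβ0
  have vb : ∫ s, b s ∂energyMeasure = E := integral_energy hδ0 hγ0
  have vb1 : ∫ s, s * b s ∂energyMeasure = δ / (2 * γ) * E := integral_energy_mul hδ0 hγ0
  rw [hM]
  refine ⟨?_, ?_, ?_, ?_, fun i => ?_, ?_, ?_⟩
  · exact (ia.mul_prod ib).const_mul _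
  · refine (((integrable_norm_sq_mul_gaussian_shifted u hβ0).mul_prod ib).const_mul
      (n / (Z * E))).congr (Filter.Eventually.of_forall fun x => ?_)
    simp only [ha]
    ring
  · refine ((ia.mul_prod (integrable_energy_mul hδ0 hγ0)).const_mul
      (n / (Z * E))).congr (Filter.Eventually.of_forall fun x => ?_)
    simp only [hb]
    ring
  · simp only [pairing, one_mul]
    rw [h00, va, vb]
    field_simp
  · simp only [pairing]
    rw [h10, va1, vb]
    field_simp
  · simp only [pairing]
    rw [h20, va2, vb, hβ]
    field_simp
  · simp only [pairing]
    rw [h01, va, vb1, hγ]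
    field_simp

end

end Polyatomic

/-! ### The theorem -/

theorem proposition4 (m kB δ θ : ℝ) (hm : 0 < m) (hkB : 0 < kB) (hδ : 2 ≤ δ)
    (hθ : 0 ≤ θ) (hθ_one : θ ≤ 1)
    (σs σr : CrossSection) (hσs : IsCrossSectionS m δ σs) (hσr : IsCrossSectionR δ σr) :
    -- the entropy inequality and the characterization of equality
    (∀ f : Phase → ℝ, Measurable f → (∀ᵐ x ∂phaseMeasure, 0 < f x) →
      MeasureTheory.Integrable f phaseMeasure → IsWellDefined m δ θ σs σr f →
        entropyProduction m δ θ σs σr f ≤ 0 ∧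
        (θ ≠ 0 → List.TFAE
          [entropyProduction m δ θ σs σr f = 0,
            ∀ᵐ x ∂phaseMeasure, collisionOp m δ θ σs σr f f x = 0,
            IsMaxwellianS m kB δ f]) ∧
        (θ = 0 → List.TFAE
          [entropyProduction m δ θ σs σr f = 0,
            ∀ᵐ x ∂phaseMeasure, collisionOp m δ θ σs σr f f x = 0,
            IsMaxwellianR m kB δ f])) ∧
    -- the parameters of the Maxwellians are their macroscopic quantities
    (∀ (n : ℝ) (u : Vel) (T : ℝ), 0 < n → 0 < T →
      HasMoments m kB δ (maxwellianS m kB δ n u T) n u T T) ∧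
    (∀ (n : ℝ) (u : Vel) (Ttr Tint : ℝ), 0 < n → 0 < Ttr → 0 < Tint →
      HasMoments m kB δ (maxwellianR m kB δ n u Ttr Tint) n u Ttr Tint) := by
  refine ⟨fun f hf hpos hint hw => ⟨?_, fun h0 => ?_, fun h0 => ?_⟩, fun n u T hn hT => ?_,
    fun n u Ttr Tint hn hTtr hTint => hasMoments_maxwellianR hm hkB hδ hn u hTtr hTint⟩
  · exact (entropyProduction_nonpos hm hσs hσr hf hpos hw).1
  · exact tfae_of_iff hm hσs hσr hf hpos hθ hθ_one hw (ae_gainLoss_eq_zero_iff_isMaxwellianS hm hkB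
      hδ (lt_of_le_of_ne hθ h0.symm) hσs hσr hf hpos hint)
  · subst h0
    exact tfae_of_iff hm hσs hσr hf hpos hθ hθ_one hw
      (ae_gainLoss_eq_zero_iff_isMaxwellianR hm hkB hδ hσr hf hpos hint)
  · rw [maxwellianS_eq hkB hT]
    exact hasMoments_maxwellianR hm hkB hδ hn u hT hT
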